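/- Let $\Delta=\sum_{m\ge 0}q^{(2m+1)^2}\in\mathbf F_2[[q]]$ (the reduction modulo $2$ of $\sum_{n\ge1}\tau(n)q^n$). Let $\mathcal F\subset\mathbf F_2[[q]]$ be the $\mathbf F_2$-vector space spanned by the odd powers $\Delta,\Delta^3,\Delta^5,\dots$, and for $n\ge 1$ let $\mathcal F(n)\subset\mathcal F$ be the subspace spanned by $\Delta,\Delta^3,\dots,\Delta^{2n-1}$. For an odd prime $p$, let $T_p$ be the Hecke operator on $\mathbf F_2[[q]]$ sending $\sum_m a_mq^m$ to $\sum_m b_mq^m$, where $b_m=a_{pm}$ if $p\nmid m$ and $b_m=a_{pm}+a_{m/p}$ if $p\mid m$. Each $\mathcal F(n)$ is stable under all the $T_p$, hence so is $\mathcal F$. Let $A(n)\subset\operatorname{End}_{\mathbf F_2}(\mathcal F(n))$ be the unital $\mathbf F_2$-subalgebra generated by the restrictions to $\mathcal F(n)$ of the $T_p$, $p$ an odd prime. Let $A=\varprojlim_n A(n)$ be the projective limit along the restriction maps $A(n+1)\to A(n)$; it acts on $\mathcal F=\bigcup_n\mathcal F(n)$ by $u\cdot f=u_n(f)$ for $u=(u_n)\in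 A$ and $f\in\mathcal F(n)$. Then $\mathcal F$ is a divisible $A$-module: for every $u\in A$ with $u\ne 0$, multiplication by $u$ is a surjective endomorphism of $\mathcal F$. In particular, for every odd prime $p$, the operator $T_p:\mathcal F\to\mathcal F$ is surjective. -/

import Mathlib

namespace HeckeModTwo

noncomputable section

open Classical in
/-- The reduction modulo 2 of the discriminant form: `Δ = ∑_{m ≥ 0} q ^ ((2m+1)^2)` in `𝔽₂⟦q⟧`. -/
def Delta : PowerSeries (ZMod 2) :=
  PowerSeries.mk fun n => if ∃ m : ℕ, n = (2 * m + 1) ^ 2 then 1 else 0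

/-- The Hecke operator `T_p` on `q`-expansions modulo 2 (used for `p` an odd prime):
the coefficient of `q ^ n` in `T_p f` is `a_{pn}(f)`, plus `a_{n/p}(f)` when `p ∣ n`. -/
def heckeT (p : ℕ) : PowerSeries (ZMod 2) →ₗ[ZMod 2] PowerSeries (ZMod 2) where
  toFun f := PowerSeries.mk fun n =>
    PowerSeries.coeff (p * n) f + if p ∣ n then PowerSeries.coeff (n / p) f else 0
  map_add' f g := by
    ext n
    by_cases h : p ∣ n
    · simp only [h, PowerSeries.coeff_mk, map_add, if_true]
      ring
    · simp [h]
  map_smul' c f := by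
    ext n
    by_cases h : p ∣ n
    · simp only [h, PowerSeries.coeff_mk, map_smul, if_true, smul_eq_mul, RingHom.id_apply]
      ring
    · simp [h]

/-- The space `ℱ` spanned by the odd powers `Δ, Δ³, Δ⁵, …`. -/
def F : Submodule (ZMod 2) (PowerSeries (ZMod 2)) :=
  Submodule.span (ZMod 2) (Set.range fun i : ℕ => Delta ^ (2 * i + 1))

/-- The space `ℱ(n)` spanned by `Δ, Δ³, …, Δ^(2n-1)` (so `ℱ(0) = 0`). -/
def Fn (n : ℕ) : Submodule (ZMod 2) (PowerSeries (ZMod 2)) :=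
  Submodule.span (ZMod 2) ((fun i : ℕ => Delta ^ (2 * i + 1)) '' Set.Iio n)

theorem Fn_mono {m n : ℕ} (h : m ≤ n) : Fn m ≤ Fn n :=
  Submodule.span_mono (Set.image_mono (Set.Iio_subset_Iio h))

theorem Fn_le_F (n : ℕ) : Fn n ≤ F :=
  Submodule.span_mono (Set.image_subset_range _ _)

theorem exists_mem_Fn {f : PowerSeries (ZMod 2)} (hf : f ∈ F) : ∃ n, f ∈ Fn n := by
  induction hf using Submodule.span_induction with
  | mem x hx =>
    obtain ⟨i, rfl⟩ := hx
    exact ⟨i + 1, Submodule.subset_span ⟨i, Nat.lt_succ_self i, rfl⟩⟩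
  | zero => exact ⟨0, zero_mem _⟩
  | add x y _ _ hx hy =>
    obtain ⟨m, hm⟩ := hx
    obtain ⟨n, hn⟩ := hy
    exact ⟨max m n, add_mem (Fn_mono (le_max_left m n) hm) (Fn_mono (le_max_right m n) hn)⟩
  | smul c x _ hx =>
    obtain ⟨n, hn⟩ := hx
    exact ⟨n, Submodule.smul_mem _ c hn⟩

/-- The algebra `A(n)`: the `𝔽₂`-subalgebra of `End(ℱ(n))` generated by the endomorphisms of
`ℱ(n)` induced by the `T_p`, `p` an odd prime. -/
def An (n : ℕ) : Subalgebra (ZMod 2) (Module.End (ZMod 2) (Fn n)) :=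
  Algebra.adjoin (ZMod 2)
    {T | ∃ p : ℕ, p.Prime ∧ p ≠ 2 ∧ ∀ f : Fn n,
      (T f : PowerSeries (ZMod 2)) = heckeT p (f : PowerSeries (ZMod 2))}

/-- The product ring of the `End(ℱ(n))`. -/
def EndProd : Type := ∀ n : ℕ, Module.End (ZMod 2) (Fn n)

instance : Ring EndProd := Pi.ring

/-- The projective limit of the `A(n)` along the restriction maps `A(n+1) → A(n)`: the ring of
families `(u_n)` with `u_n ∈ A(n) ⊆ End(ℱ(n))` such that `u_{n+1}` restricts to `u_n` on `ℱ(n)`.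
(The index `0` contributes nothing, since `A(0) = 0`.) -/
def limA : Subring EndProd where
  carrier := {u | (∀ n : ℕ, u n ∈ An n) ∧
    ∀ (n : ℕ) (f : Fn n),
      (u (n + 1) (Submodule.inclusion (Fn_mono n.le_succ) f) : PowerSeries (ZMod 2)) =
        (u n f : PowerSeries (ZMod 2))}
  mul_mem' {u v} hu hv := by
    refine ⟨fun n => mul_mem (hu.1 n) (hv.1 n), fun n f => ?_⟩
    have h : v (n + 1) (Submodule.inclusion (Fn_mono n.le_succ) f) =
        Submodule.inclusion (Fn_mono n.le_succ) (v n f) := Subtype.ext (hv.2 n f)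
    change (u (n + 1) (v (n + 1) _) : PowerSeries (ZMod 2)) = _
    rw [h, hu.2 n]
    rfl
  add_mem' {u v} hu hv :=
    ⟨fun n => add_mem (hu.1 n) (hv.1 n), fun n f => congrArg₂ (· + ·) (hu.2 n f) (hv.2 n f)⟩
  one_mem' := ⟨fun n => one_mem (An n), fun _ _ => rfl⟩
  zero_mem' := ⟨fun n => zero_mem (An n), fun _ _ => rfl⟩
  neg_mem' {u} hu := ⟨fun n => neg_mem (hu.1 n), fun n f => congrArg Neg.neg (hu.2 n f)⟩

/-- The algebra `A`, projective limit of the `A(n)`. -/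
def A : Type := limA

instance : Ring A := inferInstanceAs (Ring limA)

/-- The component `u_n ∈ A(n) ⊆ End(ℱ(n))` of `u ∈ A`. -/
def A.comp (u : A) (n : ℕ) : Module.End (ZMod 2) (Fn n) := u.1 n

theorem A.comp_succ (u : A) (n : ℕ) (f : Fn n) :
    (u.comp (n + 1) (Submodule.inclusion (Fn_mono n.le_succ) f) : PowerSeries (ZMod 2)) =
      (u.comp n f : PowerSeries (ZMod 2)) := u.2.2 n f

/-- For `u = (u_n)` in `A` and `f ∈ ℱ`, the element `u_n f ∈ ℱ` for some `n` with `f ∈ ℱ(n)`;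
by `act_eq` it does not depend on `n`. -/
def act (u : A) (f : F) : F :=
  ⟨(u.comp (Classical.choose (exists_mem_Fn f.2))
      (⟨f.1, Classical.choose_spec (exists_mem_Fn f.2)⟩ : Fn _) : PowerSeries (ZMod 2)),
    Fn_le_F _ (Subtype.property _)⟩

theorem apply_eq_of_le (u : A) {m n : ℕ} (h : m ≤ n) (f : PowerSeries (ZMod 2)) (hm : f ∈ Fn m) :
    (u.comp n ⟨f, Fn_mono h hm⟩ : PowerSeries (ZMod 2)) =
      (u.comp m ⟨f, hm⟩ : PowerSeries (ZMod 2)) := by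
  induction n, h using Nat.le_induction with
  | base => rfl
  | succ n hmn ih => exact (u.comp_succ n ⟨f, Fn_mono hmn hm⟩).trans ih

theorem act_eq (u : A) (f : F) (n : ℕ) (hn : (f : PowerSeries (ZMod 2)) ∈ Fn n) :
    (act u f : PowerSeries (ZMod 2)) =
      (u.comp n ⟨f, hn⟩ : PowerSeries (ZMod 2)) := by
  have hk := Classical.choose_spec (exists_mem_Fn f.2)
  have h1 := apply_eq_of_le u (le_max_left (Classical.choose (exists_mem_Fn f.2)) n) f.1 hk
  have h2 := apply_eq_of_le u (le_max_right (Classical.choose (exists_mem_Fn f.2)) n) f.1 hn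
  exact h1.symm.trans h2

/-- The natural `A`-module structure on `ℱ`: `u • f = u_n f` for `f ∈ ℱ(n)`. -/
instance : Module A F where
  smul := act
  one_smul f := by
    obtain ⟨n, hn⟩ := exists_mem_Fn f.2
    exact Subtype.ext (act_eq 1 f n hn)
  mul_smul u v f := by
    obtain ⟨n, hn⟩ := exists_mem_Fn f.2
    apply Subtype.ext
    have hv := act_eq v f n hn
    have hvn : (act v f : PowerSeries (ZMod 2)) ∈ Fn n := by
      rw [hv]; exact Subtype.property _
    refine (act_eq (u * v) f n hn).trans ((act_eq u (act v f) n hvn).trans ?_).symm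
    have : (⟨(act v f : PowerSeries (ZMod 2)), hvn⟩ : Fn n) =
        v.comp n ⟨f, hn⟩ := Subtype.ext hv
    rw [this]
    rfl
  smul_zero u := by
    refine Subtype.ext ((act_eq u 0 0 (zero_mem _)).trans ?_)
    exact congrArg Subtype.val (map_zero (u.comp 0))
  zero_smul f := by
    obtain ⟨n, hn⟩ := exists_mem_Fn f.2
    exact Subtype.ext (act_eq 0 f n hn)
  smul_add u f g := by
    obtain ⟨m, hm⟩ := exists_mem_Fn f.2
    obtain ⟨k, hk⟩ := exists_mem_Fn g.2
    have hf := Fn_mono (le_max_left m k) hm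
    have hg := Fn_mono (le_max_right m k) hk
    apply Subtype.ext
    refine (act_eq u (f + g) (max m k) (add_mem hf hg)).trans ?_
    refine Eq.trans ?_ (congrArg₂ (· + ·) (act_eq u f _ hf) (act_eq u g _ hg)).symm
    exact congrArg Subtype.val
      (map_add (u.comp (max m k)) ⟨f.1, hf⟩ ⟨g.1, hg⟩)
  add_smul u v f := by
    obtain ⟨n, hn⟩ := exists_mem_Fn f.2
    refine Subtype.ext ((act_eq (u + v) f n hn).trans ?_)
    exact (congrArg₂ (· + ·) (act_eq u f n hn) (act_eq v f n hn)).symm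

end

end HeckeModTwo

/-! The Hecke operators commute, so every `u` in `A` acts on `ℱ` by an endomorphism commuting with
`T₃` and `T₅`. It therefore suffices to know this pair well enough that every nonzero endomorphism
commuting with both is surjective; this is `surjective_of_commute_heckeF`. The purely algebraic
criterion `surjective_of_commute` asks for five facts: `T₃` and `T₅` are locally nilpotent, `T₅` is
surjective, `T₃` is surjective on `ker T₅`, and the common kernel is `{0, Δ}`. Surjectivity of `T_p`
is then the special case `u = T_p`, which is nonzero because the coefficient of `q` in `T_p(Δ^p)` is
1.

Stability comes from characteristic zero: an integral level-one form of weight `12k` reduces modulo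
2 to a polynomial of degree at most `k` in `Δ`, because `E₄ ≡ 1` and division by the discriminant
preserves integrality. Since `Δ` is transcendental over `𝔽₂`, everything transfers to `𝔽₂[X]` with
`X` standing for `Δ`. Writing `T_p` as the trace of a multiplicative family of matrices of size `p +
1`, Cayley–Hamilton yields linear recurrences for `T_p(X^k)`; for `p = 3, 5` their coefficients are
found from a few initial values.

The five facts follow from leading terms, in the style of Nicolas and Serre. An odd exponent is
written `code a b = 1 + 2 * spread a + 4 * spread b`, so that `a` and `b` collect the binary digits
in odd and in positive even positions. Its weight, the base-4 digits evaluated at 2, is `1 + 2a +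
2b`, and `hi` recovers `a`. Monomials are compared by weight, and for equal weight a larger `a`
counts as smaller. Up to smaller terms `T₅` sends the code `(a, b + 1)` to `(a, b)` and, on codes
with `b = 0`, lowers the weight by more than 2, while `T₃` sends `(a + 1, 0)` to `(a, 0)`. Hence
`T₅` is onto, its kernel has leading terms `(a, 0)`, and `T₃` acts on the kernel as a shift. Each
leading term is computed by induction on the top binary digit, with recurrences of step `2^r`
obtained by squaring characteristic polynomials. -/

namespace HeckeModTwo
-- Hecke operators on modular forms of level one
section
open UpperHalfPlane ModularForm ModularGroup MatrixGroups Matrix.SpecialLinearGroup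
open scoped Manifold

/-- The matrix `[1, b; 0, p]`. -/
noncomputable def upperRep (p : ℕ) [NeZero p] (b : ℤ) : GL (Fin 2) ℝ :=
  Matrix.GeneralLinearGroup.mkOfDetNeZero !![1, (b : ℝ); 0, (p : ℝ)]
    (by simp [Matrix.det_fin_two, NeZero.ne p])

/-- The matrix `[p, 0; 0, 1]`. -/
noncomputable def diagRep (p : ℕ) [NeZero p] : GL (Fin 2) ℝ :=
  Matrix.GeneralLinearGroup.mkOfDetNeZero !![(p : ℝ), 0; 0, 1]
    (by simp [Matrix.det_fin_two, NeZero.ne p])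

@[simp] lemma val_upperRep (p : ℕ) [NeZero p] (b : ℤ) :
    (upperRep p b).val = !![1, (b : ℝ); 0, (p : ℝ)] := rfl

@[simp] lemma val_diagRep (p : ℕ) [NeZero p] :
    (diagRep p).val = !![(p : ℝ), 0; 0, 1] := rfl

/-- Invariance of `f` absorbs the left factor `γ`, so each permutation of the coset representatives
reduces to exhibiting one integral matrix. -/
lemma slash_slash_eq_of_mul_eq {k : ℤ} (f : ModularForm 𝒮ℒ k) {A B : GL (Fin 2) ℝ}
    (δ γ : SL(2, ℤ)) (h : A.val * δ.1.map (Int.cast : ℤ → ℝ) = γ.1.map (Int.cast : ℤ → ℝ) * B.val) :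
    ((f : ℍ → ℂ) ∣[k] A) ∣[k] δ = (f : ℍ → ℂ) ∣[k] B := by
  rw [SL_slash]
  change ((f : ℍ → ℂ) ∣[k] A) ∣[k] (mapGL ℝ δ) = _
  have h' : A * (mapGL ℝ δ) = (mapGL ℝ γ) * B := Units.ext h
  rw [← SlashAction.slash_mul, h', SlashAction.slash_mul,
    SlashInvariantFormClass.slash_action_eq f _ (MonoidHom.mem_range.mpr ⟨γ, rfl⟩)]

lemma slash_upperRep_eq {k : ℤ} (f : ModularForm 𝒮ℒ k) (p : ℕ) [NeZero p] {b c : ℤ}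
    (h : (p : ℤ) ∣ b - c) :
    (f : ℍ → ℂ) ∣[k] upperRep p b = (f : ℍ → ℂ) ∣[k] upperRep p c := by
  obtain ⟨m, hm⟩ := h
  have := slash_slash_eq_of_mul_eq f (A := upperRep p b) (B := upperRep p c) 1 ⟨!![1, m; 0, 1], by simp [Matrix.det_fin_two_of]⟩ (by
    ext i j
    have : (b : ℝ) = c + p * m := by exact_mod_cast (by linarith : b = c + p * m)
    fin_cases i <;> fin_cases j <;>
      simp [Matrix.mul_apply, Fin.sum_univ_two, this, mul_comm])
  rw [← this, SlashAction.slash_one]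

lemma slash_upperRep_slash_T {k : ℤ} (f : ModularForm 𝒮ℒ k) (p : ℕ) [NeZero p] (b : ℤ) :
    ((f : ℍ → ℂ) ∣[k] upperRep p b) ∣[k] T = (f : ℍ → ℂ) ∣[k] upperRep p (b + 1) := by
  refine slash_slash_eq_of_mul_eq f T 1 ?_
  ext i j
  fin_cases i <;> fin_cases j <;>
    simp [Matrix.mul_apply, Fin.sum_univ_two, coe_T, add_comm]

lemma slash_diagRep_slash_T {k : ℤ} (f : ModularForm 𝒮ℒ k) (p : ℕ) [NeZero p] :
    ((f : ℍ → ℂ) ∣[k] diagRep p) ∣[k] T = (f : ℍ → ℂ) ∣[k] diagRep p := by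
  refine slash_slash_eq_of_mul_eq f T ⟨!![1, (p : ℤ); 0, 1], by simp [Matrix.det_fin_two_of]⟩ ?_
  ext i j
  fin_cases i <;> fin_cases j <;>
    simp [Matrix.mul_apply, Fin.sum_univ_two, coe_T]

lemma slash_diagRep_slash_S {k : ℤ} (f : ModularForm 𝒮ℒ k) (p : ℕ) [NeZero p] :
    ((f : ℍ → ℂ) ∣[k] diagRep p) ∣[k] S = (f : ℍ → ℂ) ∣[k] upperRep p 0 := by
  refine slash_slash_eq_of_mul_eq f S S ?_
  ext i j
  fin_cases i <;> fin_cases j <;>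
    simp [Matrix.mul_apply, Fin.sum_univ_two, coe_S]

lemma slash_upperRep_zero_slash_S {k : ℤ} (f : ModularForm 𝒮ℒ k) (p : ℕ) [NeZero p] :
    ((f : ℍ → ℂ) ∣[k] upperRep p 0) ∣[k] S = (f : ℍ → ℂ) ∣[k] diagRep p := by
  refine slash_slash_eq_of_mul_eq f S S ?_
  ext i j
  fin_cases i <;> fin_cases j <;>
    simp [Matrix.mul_apply, Fin.sum_univ_two, coe_S]

lemma slash_upperRep_slash_S {k : ℤ} (f : ModularForm 𝒮ℒ k) (p : ℕ) [NeZero p] {b c : ℤ}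
    (h : (p : ℤ) ∣ b * c + 1) :
    ((f : ℍ → ℂ) ∣[k] upperRep p b) ∣[k] S = (f : ℍ → ℂ) ∣[k] upperRep p c := by
  obtain ⟨m, hm⟩ := h
  refine slash_slash_eq_of_mul_eq f S ⟨!![b, -m; p, -c], by
    rw [Matrix.det_fin_two_of]; linarith⟩ ?_
  have : (b : ℝ) * c + 1 = p * m := by exact_mod_cast hm
  ext i j
  fin_cases i <;> fin_cases j <;>
    simp [Matrix.mul_apply, Fin.sum_univ_two, coe_S]
  · linarith
  · ring

/-- The Hecke operator `T_p` on functions on the upper half plane. -/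
noncomputable def heckeFun (k : ℤ) (p : ℕ) [NeZero p] (f : ℍ → ℂ) : ℍ → ℂ :=
  f ∣[k] diagRep p + ∑ b : ZMod p, f ∣[k] upperRep p (b.val : ℤ)

lemma heckeFun_slash_T {k : ℤ} (p : ℕ) [NeZero p] (f : ModularForm 𝒮ℒ k) :
    heckeFun k p f ∣[k] T = heckeFun k p f := by
  rw [heckeFun, SlashAction.add_slash, slash_diagRep_slash_T, SlashAction.sum_slash]
  congr 1
  simp_rw [slash_upperRep_slash_T]
  refine Fintype.sum_equiv (Equiv.addRight 1) _ _ fun b => slash_upperRep_eq f p ?_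
  rw [← ZMod.intCast_zmod_eq_zero_iff_dvd]
  simp

/-- `S` permutes the `p + 1` cosets as it does the projective line over `𝔽_p`: the diagonal coset
and `b = 0` are exchanged, and a nonzero `b` goes to `-b⁻¹`. -/
lemma heckeFun_slash_S {k : ℤ} (p : ℕ) [hp : Fact p.Prime] (f : ModularForm 𝒮ℒ k) :
    heckeFun k p f ∣[k] S = heckeFun k p f := by
  classical
  rw [heckeFun, SlashAction.add_slash, slash_diagRep_slash_S, SlashAction.sum_slash,
    Fintype.sum_eq_add_sum_compl (0 : ZMod p), Fintype.sum_eq_add_sum_compl (0 : ZMod p)]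
  simp only [ZMod.val_zero, Nat.cast_zero, slash_upperRep_zero_slash_S]
  rw [← add_assoc, ← add_assoc, add_comm ((f : ℍ → ℂ) ∣[k] upperRep p 0)]
  congr 1
  refine Finset.sum_bij' (fun b _ => -b⁻¹) (fun b _ => -b⁻¹) (by simp) (by simp) (by simp)
    (by simp) fun b hb => slash_upperRep_slash_S f p ?_
  rw [← ZMod.intCast_zmod_eq_zero_iff_dvd]
  have hb : b ≠ 0 := by simpa using hb
  simp [hb]

lemma heckeFun_isBoundedAtImInfty {k : ℤ} (p : ℕ) [NeZero p] (f : ModularForm 𝒮ℒ k) :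
    IsBoundedAtImInfty (heckeFun k p f) := by
  have hf : IsBoundedAtImInfty (f : ℍ → ℂ) := ModularFormClass.bdd_at_infty f
  have h1 := hf.slash (g := diagRep p) (k := k) (by simp)
  have h2 : ∀ b : ZMod p, IsBoundedAtImInfty ((f : ℍ → ℂ) ∣[k] upperRep p (b.val : ℤ)) :=
    fun b => hf.slash (g := upperRep p _) (k := k) (by simp)
  unfold IsBoundedAtImInfty Filter.BoundedAtFilter heckeFun at *
  refine h1.add ?_
  rw [Finset.sum_fn]
  exact Asymptotics.IsBigO.fun_sum fun b _ => h2 b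

/-- The Hecke operator `T_p` on modular forms of level one. -/
noncomputable def heckeForm {k : ℤ} (p : ℕ) [hp : Fact p.Prime] (f : ModularForm 𝒮ℒ k) :
    ModularForm 𝒮ℒ k where
  toFun := heckeFun k p f
  slash_action_eq' := fun _ ⟨γ, hγ⟩ ↦ hγ ▸
    SlashInvariantForm.slash_action_generators_SL2Z (heckeFun_slash_S p f)
      (heckeFun_slash_T p f) γ
  holo' := by
    change MDiff (heckeFun k p f)
    unfold heckeFun
    refine (f.holo'.slash k _).add ?_
    exact MDifferentiable.sum fun b _ => f.holo'.slash k _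
  bdd_at_cusps' {c} hc := by
    rw [Subgroup.IsArithmetic.isCusp_iff_isCusp_SL2Z] at hc
    rw [OnePoint.isBoundedAt_iff_forall_SL2Z hc]
    intro γ _
    rw [SlashInvariantForm.slash_action_generators_SL2Z (heckeFun_slash_S p f)
      (heckeFun_slash_T p f) γ]
    exact heckeFun_isBoundedAtImInfty p f

end
end HeckeModTwo

/-! ### The action of `T_p` on `q`-expansions -/

namespace HeckeModTwo
section
open UpperHalfPlane ModularForm ModularGroup MatrixGroups Matrix.SpecialLinearGroup
open scoped Manifold Real

lemma slash_diagRep_apply (k : ℤ) (f : ℍ → ℂ) (p : ℕ) [NeZero p] (τ : ℍ) :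
    (f ∣[k] diagRep p) τ = f (diagRep p • τ) * (p : ℂ) ^ (k - 1) := by
  have h : 0 < (diagRep p).det.val := by
    simp [diagRep, Matrix.det_fin_two, Nat.pos_of_ne_zero (NeZero.ne p)]
  rw [ModularForm.slash_apply, UpperHalfPlane.σ, if_pos h]
  simp [denom, diagRep, Matrix.det_fin_two]

lemma slash_upperRep_apply (k : ℤ) (f : ℍ → ℂ) (p : ℕ) [NeZero p] (b : ℤ) (τ : ℍ) :
    (f ∣[k] upperRep p b) τ = f (upperRep p b • τ) * (p : ℂ)⁻¹ := by
  have h : 0 < (upperRep p b).det.val := by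
    simp [upperRep, Matrix.det_fin_two, Nat.pos_of_ne_zero (NeZero.ne p)]
  rw [ModularForm.slash_apply, UpperHalfPlane.σ, if_pos h]
  have hp : (p : ℂ) ≠ 0 := Nat.cast_ne_zero.mpr (NeZero.ne p)
  simp [denom, upperRep, Matrix.det_fin_two]
  rw [mul_assoc, zpow_sub_one₀ hp]
  field_simp

lemma coe_diagRep_smul (p : ℕ) [NeZero p] (τ : ℍ) : ((diagRep p • τ : ℍ) : ℂ) = p * τ := by
  have h : 0 < (diagRep p).det.val := by
    simp [diagRep, Matrix.det_fin_two, Nat.pos_of_ne_zero (NeZero.ne p)]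
  rw [coe_smul_of_det_pos h]
  simp [num, denom]

lemma coe_upperRep_smul (p : ℕ) [NeZero p] (b : ℤ) (τ : ℍ) :
    ((upperRep p b • τ : ℍ) : ℂ) = (τ + b) / p := by
  have h : 0 < (upperRep p b).det.val := by
    simp [upperRep, Matrix.det_fin_two, Nat.pos_of_ne_zero (NeZero.ne p)]
  rw [coe_smul_of_det_pos h]
  simp [num, denom]

lemma qParam_diagRep_smul (p : ℕ) [NeZero p] (τ : ℍ) :
    Function.Periodic.qParam 1 (diagRep p • τ : ℍ) = Function.Periodic.qParam 1 τ ^ p := by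
  rw [coe_diagRep_smul, Function.Periodic.qParam, Function.Periodic.qParam, ← Complex.exp_nat_mul]
  congr 1
  simp; ring

lemma qParam_upperRep_smul (p : ℕ) [NeZero p] (b : ZMod p) (τ : ℍ) (m : ℕ) :
    Function.Periodic.qParam 1 (upperRep p (b.val : ℤ) • τ : ℍ) ^ m =
      Complex.exp (2 * π * Complex.I * τ / p) ^ m * ZMod.stdAddChar (b * (m : ZMod p)) := by
  have h : b * (m : ZMod p) = ((b.val * m : ℤ) : ZMod p) := by simp
  rw [h, ZMod.stdAddChar_coe, coe_upperRep_smul, Function.Periodic.qParam, ← Complex.exp_nat_mul,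
    ← Complex.exp_nat_mul, ← Complex.exp_add]
  congr 1
  have hp : (p : ℂ) ≠ 0 := Nat.cast_ne_zero.mpr (NeZero.ne p)
  push_cast
  field_simp

/-- The diagonal coset substitutes `q ^ p` for `q` and contributes the factor `p ^ (k - 1)`. The
upper cosets average `f` over additive characters of `ZMod p`, and orthogonality keeps only
exponents divisible by `p`. -/
lemma qExpansion_heckeForm {k : ℤ} (p : ℕ) [hp : Fact p.Prime] (f : ModularForm 𝒮ℒ k) (m : ℕ) :
    (qExpansion 1 (heckeForm p f)).coeff m = (qExpansion 1 f).coeff (p * m) +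
      if p ∣ m then (p : ℂ) ^ (k - 1) * (qExpansion 1 f).coeff (m / p) else 0 := by
  set a : ℕ → ℂ := fun m => (qExpansion 1 f).coeff m with ha
  have hp0 : (p : ℂ) ≠ 0 := Nat.cast_ne_zero.mpr (NeZero.ne p)
  have hinj : Function.Injective (fun m : ℕ => p * m) := fun x y h =>
    Nat.eq_of_mul_eq_mul_left hp.out.pos h
  have hf : ∀ τ : ℍ, HasSum (fun m => a m * Function.Periodic.qParam 1 τ ^ m) (f τ) :=
    fun τ => ModularForm.hasSum_qExpansion f one_pos one_mem_strictPeriods_SL τ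
  symm
  refine ModularFormClass.qExpansion_coeff_unique (f := heckeForm p f)
    (c := fun m => a (p * m) + if p ∣ m then (p : ℂ) ^ (k - 1) * a (m / p) else 0)
    one_pos one_mem_strictPeriods_SL (fun τ => ?_) m
  have h1 : HasSum (fun m => (if p ∣ m then (p : ℂ) ^ (k - 1) * a (m / p) else 0) *
      Function.Periodic.qParam 1 τ ^ m) (((f : ℍ → ℂ) ∣[k] diagRep p) τ) := by
    rw [slash_diagRep_apply]
    refine (hinj.hasSum_iff ?_).mp ?_
    rotate_left
    · refine ((hf (diagRep p • τ)).mul_right ((p : ℂ) ^ (k - 1))).congr_fun fun n => ?_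
      simp only [Function.comp, dvd_mul_right, if_true, Nat.mul_div_cancel_left n hp.out.pos,
        qParam_diagRep_smul, pow_mul]
      ring
    · intro n hn
      have : ¬ p ∣ n := fun ⟨r, hr⟩ => hn ⟨r, hr.symm⟩
      simp [this]
  have h2 : HasSum (fun m => a (p * m) * Function.Periodic.qParam 1 τ ^ m)
      (∑ b : ZMod p, ((f : ℍ → ℂ) ∣[k] upperRep p (b.val : ℤ)) τ) := by
    have h3 := hasSum_sum (s := (Finset.univ : Finset (ZMod p))) fun b _ =>
      (hf (upperRep p (b.val : ℤ) • τ)).mul_right ((p : ℂ)⁻¹)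
    simp_rw [← slash_upperRep_apply k] at h3
    refine ((hinj.hasSum_iff ?_).mpr h3).congr_fun fun n => ?_
    rotate_left
    · 
      simp only [Function.comp, qParam_upperRep_smul]
      have : ∀ b : ZMod p, ZMod.stdAddChar (b * ((p * n : ℕ) : ZMod p)) = (1 : ℂ) := by
        intro b; simp
      simp only [this, mul_one, Finset.sum_const, Finset.card_univ, ZMod.card, nsmul_eq_mul]
      rw [pow_mul, ← Complex.exp_nat_mul, Function.Periodic.qParam]
      have e : (p : ℂ) * (2 * π * Complex.I * τ / p) = 2 * π * Complex.I * τ / (1 : ℝ) := by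
        simp; field_simp
      rw [e]
      field_simp
    · intro n hn
      have hn' : (n : ZMod p) ≠ 0 := by
        rw [Ne, ZMod.natCast_eq_zero_iff]
        exact fun ⟨r, hr⟩ => hn ⟨r, hr.symm⟩
      simp only [qParam_upperRep_smul]
      rw [← Finset.sum_mul, ← Finset.mul_sum, ← Finset.mul_sum,
        AddChar.sum_mulShift _ (ZMod.isPrimitive_stdAddChar p), if_neg hn']
      simp
  have h3 := h1.add h2
  have e : (heckeForm p f) τ = ((f : ℍ → ℂ) ∣[k] diagRep p) τ +
      ∑ b : ZMod p, ((f : ℍ → ℂ) ∣[k] upperRep p (b.val : ℤ)) τ := by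
    change heckeFun k p f τ = _
    simp [heckeFun]
  rw [e]
  refine h3.congr_fun fun n => ?_
  simp only [smul_eq_mul]
  ring

end
end HeckeModTwo

/-! ### The discriminant over `ℤ` and its reduction modulo 2 -/

namespace HeckeModTwo
section
open UpperHalfPlane ModularForm ModularGroup MatrixGroups Matrix.SpecialLinearGroup
open scoped Manifold Real ArithmeticFunction.sigma

instance : CharP (PowerSeries (ZMod 2)) 2 :=
  charP_of_injective_algebraMap (algebraMap (ZMod 2) (PowerSeries (ZMod 2))).injective 2

lemma powerSeries_two_eq_zero : (2 : PowerSeries (ZMod 2)) = 0 := by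
  exact_mod_cast CharP.cast_eq_zero (PowerSeries (ZMod 2)) 2

lemma coeff_sq (f : PowerSeries (ZMod 2)) (n : ℕ) :
    PowerSeries.coeff n (f ^ 2) = if 2 ∣ n then PowerSeries.coeff (n / 2) f else 0 := by
  have h : f ^ 2 = PowerSeries.expand 2 two_ne_zero f := by
    have := MvPowerSeries.map_frobenius_expand 2 two_ne_zero (f := (f : MvPowerSeries Unit (ZMod 2)))
    rw [ZMod.frobenius_zmod, MvPowerSeries.map_id] at this
    exact this.symm
  rw [h, PowerSeries.coeff_expand]

/-- The involution `d ↦ n / d` cancels divisors in pairs, leaving at most the square root of `n`. -/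
lemma sum_divisors_one_zmod_two {n : ℕ} (hn : n ≠ 0) :
    ∑ _d ∈ n.divisors, (1 : ZMod 2) = if IsSquare n then 1 else 0 := by
  classical
  have h0 : ∑ _d ∈ n.divisors.filter (fun d => ¬ d * d = n), (1 : ZMod 2) = 0 := by
    refine Finset.sum_involution (fun d _ => n / d) (fun d _ => by decide) ?_ ?_ ?_
    · intro d hd _ h
      simp only [Finset.mem_filter, Nat.mem_divisors] at hd
      have := Nat.div_mul_cancel hd.1.1
      rw [h] at this
      exact hd.2 this
    · intro d hd
      simp only [Finset.mem_filter, Nat.mem_divisors] at hd ⊢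
      refine ⟨⟨Nat.div_dvd_of_dvd hd.1.1, hn⟩, fun h => hd.2 ?_⟩
      have h1 := Nat.div_mul_cancel hd.1.1
      have h2 : n / d ≠ 0 := fun h' => hn (by rw [← h1, h', zero_mul])
      have : n / d = d := Nat.eq_of_mul_eq_mul_left (Nat.pos_of_ne_zero h2) (h.trans h1.symm)
      rwa [this] at h
    · intro d hd
      simp only [Finset.mem_filter, Nat.mem_divisors] at hd
      exact Nat.div_div_self hd.1.1 hn
  rw [← Finset.sum_filter_add_sum_filter_not _ (fun d => d * d = n), h0, add_zero]
  split_ifs with h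
  · obtain ⟨m, rfl⟩ := h
    have : (m * m).divisors.filter (fun d => d * d = m * m) = {m} := by
      ext d
      simp only [Finset.mem_filter, Nat.mem_divisors, Finset.mem_singleton]
      constructor
      · rintro ⟨_, h⟩; exact Nat.mul_self_inj.mp h
      · rintro rfl; exact ⟨⟨dvd_mul_right _ _, hn⟩, rfl⟩
    rw [this]; simp
  · have : n.divisors.filter (fun d => d * d = n) = ∅ :=
      Finset.filter_eq_empty_iff.mpr fun d _ h' => h ⟨d, h'.symm⟩
    rw [this]; simp

/-- The number of odd divisors modulo 2, as a power series. -/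
noncomputable def oddDivisorSeries : PowerSeries (ZMod 2) :=
  PowerSeries.mk fun n => ∑ d ∈ n.divisors, (d : ZMod 2)

lemma zmod_two_natCast_even {d : ℕ} (h : 2 ∣ d) : (d : ZMod 2) = 0 :=
  (ZMod.natCast_eq_zero_iff _ _).mpr h

lemma zmod_two_natCast_odd {d : ℕ} (h : ¬ 2 ∣ d) : (d : ZMod 2) = 1 := by
  rw [ZMod.natCast_eq_one_iff_odd]
  exact Nat.odd_iff.mpr (by omega)

lemma sum_divisors_two_mul (n : ℕ) :
    ∑ d ∈ (2 * n).divisors, (d : ZMod 2) = ∑ d ∈ n.divisors, (d : ZMod 2) := by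
  classical
  rcases eq_or_ne n 0 with rfl | hn
  · simp
  symm
  refine Finset.sum_subset (Nat.divisors_subset_of_dvd (by omega) (dvd_mul_left _ _)) ?_
  intro d hd hd'
  by_contra h
  have h2 : ¬ 2 ∣ d := fun h' => h (zmod_two_natCast_even h')
  refine hd' (Nat.mem_divisors.mpr ⟨?_, hn⟩)
  exact (Nat.Coprime.symm ((Nat.Prime.coprime_iff_not_dvd Nat.prime_two).mpr h2)).dvd_of_dvd_mul_left
    (Nat.mem_divisors.mp hd).1

/-- Squaring substitutes `q ^ 2` for `q`. At even exponents the two series cancel, since `n` and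
`2n` have the same odd divisors; at odd exponents the number of divisors is odd exactly for squares.
-/
lemma oddDivisorSeries_add_sq : oddDivisorSeries + oddDivisorSeries ^ 2 = Delta := by
  classical
  ext n
  rw [map_add, coeff_sq, oddDivisorSeries, Delta, PowerSeries.coeff_mk, PowerSeries.coeff_mk,
    PowerSeries.coeff_mk]
  by_cases h : 2 ∣ n
  · obtain ⟨m, rfl⟩ := h
    rw [if_pos (dvd_mul_right _ _), Nat.mul_div_cancel_left _ two_pos, sum_divisors_two_mul,
      CharTwo.add_self_eq_zero, if_neg]
    rintro ⟨r, hr⟩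
    have : Odd ((2 * r + 1) ^ 2) := Odd.pow ⟨r, rfl⟩
    rw [← hr] at this
    exact (Nat.not_odd_iff_even.mpr (even_two_mul m)) this
  · have hn : n ≠ 0 := by rintro rfl; exact h (dvd_zero _)
    rw [if_neg h, add_zero]
    have h1 : ∑ d ∈ n.divisors, (d : ZMod 2) = ∑ _d ∈ n.divisors, (1 : ZMod 2) :=
      Finset.sum_congr rfl fun d hd => zmod_two_natCast_odd fun h' =>
        h (h'.trans (Nat.mem_divisors.mp hd).1)
    rw [h1, sum_divisors_one_zmod_two hn]
    refine if_congr ⟨?_, ?_⟩ rfl rfl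
    · rintro ⟨m, rfl⟩
      have hm : Odd m := by
        rw [← Nat.not_even_iff_odd]
        exact fun he => h ((even_iff_two_dvd.mp he).mul_left m)
      obtain ⟨r, rfl⟩ := hm
      exact ⟨r, by ring⟩
    · rintro ⟨m, rfl⟩
      exact ⟨2 * m + 1, by ring⟩

/-- The series `∑ σ_k(n) q^n`. -/
noncomputable def sigmaSeries (k : ℕ) : PowerSeries ℤ := PowerSeries.mk fun n => ((σ k n : ℕ) : ℤ)

/-- The `q`-expansion of `E₄` over `ℤ`. -/
noncomputable def E4Series : PowerSeries ℤ := 1 + 240 * sigmaSeries 3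

/-- The `q`-expansion of `E₆` over `ℤ`. -/
noncomputable def E6Series : PowerSeries ℤ := 1 - 504 * sigmaSeries 5

lemma map_E4Series :
    E4Series.map (Int.castRingHom ℂ) = qExpansion 1 (ModularForm.E (by norm_num : 3 ≤ 4)) := by
  ext n
  have h240 : (240 : PowerSeries ℤ) = PowerSeries.C (240 : ℤ) := by simp
  rw [EisensteinSeries.E_qExpansion_coeff _ ⟨2, rfl⟩, E4Series, sigmaSeries, h240]
  simp only [PowerSeries.coeff_map, map_add, PowerSeries.coeff_C_mul, PowerSeries.coeff_one,
    PowerSeries.coeff_mk]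
  rw [show bernoulli 4 = -1 / 30 by decide +kernel]
  split_ifs with h
  · subst h; simp
  · simp; norm_num

lemma map_E6Series :
    E6Series.map (Int.castRingHom ℂ) = qExpansion 1 (ModularForm.E (by norm_num : 3 ≤ 6)) := by
  ext n
  have h504 : (504 : PowerSeries ℤ) = PowerSeries.C (504 : ℤ) := by simp
  rw [EisensteinSeries.E_qExpansion_coeff _ ⟨3, rfl⟩, E6Series, sigmaSeries, h504]
  simp only [PowerSeries.coeff_map, map_sub, PowerSeries.coeff_C_mul, PowerSeries.coeff_one,
    PowerSeries.coeff_mk]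
  rw [show bernoulli 6 = 1 / 42 by decide +kernel]
  split_ifs with h
  · subst h; simp
  · simp; norm_num

/-- The summand in the divisor-sum formula for the discriminant. -/
def divisorTerm (d : ℕ) : ℤ := (5 * d ^ 3 + 7 * d ^ 5) / 12

lemma twelve_mul_divisorTerm (d : ℕ) : 12 * divisorTerm d = 5 * d ^ 3 + 7 * d ^ 5 := by
  refine Int.mul_ediv_cancel' ((ZMod.intCast_zmod_eq_zero_iff_dvd _ 12).mp ?_)
  push_cast
  generalize (d : ZMod 12) = x
  revert x
  decide

lemma divisorTerm_cast (d : ℕ) : (divisorTerm d : ZMod 2) = d := by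
  have h : (24 : ℤ) ∣ 12 * divisorTerm d - 12 * d := by
    rw [twelve_mul_divisorTerm]
    refine (ZMod.intCast_zmod_eq_zero_iff_dvd _ 24).mp ?_
    push_cast
    generalize (d : ZMod 24) = x
    revert x
    decide
  have : (2 : ℤ) ∣ divisorTerm d - d := by omega
  have := (ZMod.intCast_zmod_eq_zero_iff_dvd _ 2).mpr this
  push_cast at this
  exact sub_eq_zero.mp this

/-- The integral `q`-expansion of the discriminant. -/
noncomputable def discSeries : PowerSeries ℤ :=
  PowerSeries.mk (fun n => ∑ d ∈ n.divisors, divisorTerm d) + 100 * sigmaSeries 3 ^ 2 +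
    8000 * sigmaSeries 3 ^ 3 - 147 * sigmaSeries 5 ^ 2

lemma twelve_mul_divisorTermSeries :
    12 * PowerSeries.mk (fun n => ∑ d ∈ n.divisors, divisorTerm d) =
      5 * sigmaSeries 3 + 7 * sigmaSeries 5 := by
  ext n
  have h12 : (12 : PowerSeries ℤ) = PowerSeries.C (12 : ℤ) := by simp
  have h5 : (5 : PowerSeries ℤ) = PowerSeries.C (5 : ℤ) := by simp
  have h7 : (7 : PowerSeries ℤ) = PowerSeries.C (7 : ℤ) := by simp
  rw [h12, h5, h7]
  simp only [map_add, PowerSeries.coeff_C_mul, PowerSeries.coeff_mk, sigmaSeries,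
    ArithmeticFunction.sigma_apply]
  push_cast
  simp only [Finset.mul_sum, twelve_mul_divisorTerm, Finset.sum_add_distrib]

/-- The linear part of the left side is `144 (5 σ₃ + 7 σ₅)`, divisible by 1728 because 12 divides `5
d³ + 7 d⁵`. The other coefficients are multiples of 1728 outright, which produces 100, 8000 and 147.
-/
lemma E4Series_cube_sub_E6Series_sq : E4Series ^ 3 - E6Series ^ 2 = 1728 * discSeries := by
  rw [E4Series, E6Series, discSeries]
  linear_combination -144 * twelve_mul_divisorTermSeries

lemma map_discSeries : discSeries.map (Int.castRingHom ℂ) = qExpansion 1 discriminant := by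
  have h := congrArg (fun x => (1728 : ℂ) • x) discriminant_eq_E₄_cube_sub_E₆_sq_graded
  simp only [smul_smul] at h
  rw [show (1728 : ℂ) * (1 / 1728) = 1 by norm_num, one_smul,
    show (1728 : ℂ) = ((1728 : ℕ) : ℂ) by norm_num, Nat.cast_smul_eq_nsmul] at h
  have h2 := congrArg (qExpansionRingHom 1 one_pos one_mem_strictPeriods_SL) h
  rw [map_nsmul, map_sub, map_pow, map_pow, qExpansionRingHom_apply, qExpansionRingHom_apply,
    qExpansionRingHom_apply, ← map_E4Series, ← map_E6Series, ← map_pow, ← map_pow, ← map_sub,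
    E4Series_cube_sub_E6Series_sq, map_mul] at h2
  change 1728 • qExpansion 1 discriminant = _ at h2
  simp only [map_ofNat, nsmul_eq_mul, Nat.cast_ofNat] at h2
  have : (1728 : PowerSeries ℂ) ≠ 0 := fun h => by
    have h' := congrArg PowerSeries.constantCoeff h
    rw [map_ofNat, map_zero] at h'
    norm_num at h'
  exact (mul_left_cancel₀ this h2).symm

/-- Only the divisor sum and the odd coefficient 147 survive modulo 2. Both lead to the odd divisor
series `θ`, and the result is `θ + θ²`. -/
lemma map_discSeries_zmod_two : discSeries.map (Int.castRingHom (ZMod 2)) = Delta := by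
  have h1 : (PowerSeries.mk (fun n => ∑ d ∈ n.divisors, divisorTerm d)).map
      (Int.castRingHom (ZMod 2)) = oddDivisorSeries := by
    ext n
    simp [oddDivisorSeries, divisorTerm_cast]
  have h2 : (sigmaSeries 5).map (Int.castRingHom (ZMod 2)) = oddDivisorSeries := by
    ext n
    have : ∀ x : ZMod 2, x ^ 5 = x := by decide
    simp [oddDivisorSeries, sigmaSeries, ArithmeticFunction.sigma_apply, this]
  have two := powerSeries_two_eq_zero
  rw [← oddDivisorSeries_add_sq, discSeries]
  simp only [map_add, map_sub, map_mul, map_pow, map_ofNat, h1, h2]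
  linear_combination (50 * (sigmaSeries 3).map (Int.castRingHom (ZMod 2)) ^ 2 +
    4000 * (sigmaSeries 3).map (Int.castRingHom (ZMod 2)) ^ 3 - 74 * oddDivisorSeries ^ 2) * two

lemma map_E4Series_zmod_two : E4Series.map (Int.castRingHom (ZMod 2)) = 1 := by
  have two := powerSeries_two_eq_zero
  rw [E4Series]
  simp only [map_add, map_mul, map_one, map_ofNat]
  linear_combination (120 * (sigmaSeries 3).map (Int.castRingHom (ZMod 2))) * two

end
end HeckeModTwo

/-! ### Integral forms of weight `12k` reduce to polynomials in `Δ` -/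

namespace HeckeModTwo
section
open UpperHalfPlane ModularForm ModularGroup MatrixGroups Matrix.SpecialLinearGroup
open scoped Manifold Real ArithmeticFunction.sigma

/-- This makes division of an integral cuspidal expansion by the discriminant stay within `ℤ⟦q⟧`. -/
lemma exists_discSeries_eq_X_mul_unit : ∃ u : (PowerSeries ℤ)ˣ, discSeries = PowerSeries.X * (u : PowerSeries ℤ) := by
  have h0 : PowerSeries.constantCoeff discSeries = 0 := by
    have h := PowerSeries.coeff_of_lt_order (φ := qExpansion 1 discriminant) 0
      (by rw [discriminant_qExpansion_order]; norm_num)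
    rw [← map_discSeries] at h
    simpa using h
  obtain ⟨u, hu⟩ := PowerSeries.X_dvd_iff.mpr h0
  have h1 : PowerSeries.constantCoeff u = 1 := by
    have h := discriminant_qExpansion_coeff_one
    rw [← map_discSeries, hu, PowerSeries.coeff_map, ← zero_add 1,
      PowerSeries.coeff_succ_X_mul] at h
    simpa using h
  have hunit : IsUnit u := PowerSeries.isUnit_iff_constantCoeff.mpr (by rw [h1]; exact isUnit_one)
  obtain ⟨v, rfl⟩ := hunit
  exact ⟨v, hu⟩

/-- The span of `1, Δ, …, Δ^k`. -/
noncomputable def powersUpTo (k : ℕ) : Submodule (ZMod 2) (PowerSeries (ZMod 2)) :=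
  Submodule.span (ZMod 2) ((fun i : ℕ => Delta ^ i) '' Set.Iic k)

lemma pow_mem_powersUpTo {i k : ℕ} (h : i ≤ k) : Delta ^ i ∈ powersUpTo k :=
  Submodule.subset_span ⟨i, h, rfl⟩

lemma Delta_mul_mem_powersUpTo {k : ℕ} {f : PowerSeries (ZMod 2)} (hf : f ∈ powersUpTo k) :
    Delta * f ∈ powersUpTo (k + 1) := by
  have : powersUpTo k ≤ (powersUpTo (k + 1)).comap (LinearMap.mulLeft (ZMod 2) Delta) := by
    refine Submodule.span_le.mpr ?_
    rintro _ ⟨i, hi, rfl⟩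
    change Delta * Delta ^ i ∈ powersUpTo (k + 1)
    rw [← pow_succ']
    exact pow_mem_powersUpTo (Nat.succ_le_succ hi)
  exact this hf

/-- Removing the constant term with a power of `E₄` leaves a cusp form, and dividing it by the
discriminant lowers the weight by 12 and keeps coefficients integral. Weight 0 gives constants. -/
theorem map_zmod_two_mem_powersUpTo (k : ℕ) : ∀ {w : ℤ} (_ : w = 12 * k) (f : ModularForm 𝒮ℒ w)
    (φ : PowerSeries ℤ) (_ : φ.map (Int.castRingHom ℂ) = qExpansion 1 f),
    φ.map (Int.castRingHom (ZMod 2)) ∈ powersUpTo k := by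
  induction k with
  | zero =>
    intro w hw f φ hφ
    obtain rfl : w = 0 := by simpa using hw
    obtain ⟨c, hc⟩ := ModularFormClass.levelOne_weight_zero_const f
    have : ∀ n, n ≠ 0 → PowerSeries.coeff n φ = 0 := by
      intro n hn
      have h1 : PowerSeries.coeff n (qExpansion 1 f) = 0 := by
        have h2 := ModularFormClass.qExpansion_coeff_unique (f := f) (Γ := 𝒮ℒ)
          (c := fun m => if m = 0 then c else 0) one_pos one_mem_strictPeriods_SL
          (fun τ => by
            rw [hc]
            rw [Function.const_apply]
            convert hasSum_ite_eq 0 c using 2 with m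
            by_cases h : m = 0 <;> simp [h]) n
        rw [← h2, if_neg hn]
      rw [← hφ] at h1
      simpa using h1
    have : φ = PowerSeries.C (PowerSeries.coeff 0 φ) := by
      ext n
      rw [PowerSeries.coeff_C]
      split_ifs with h
      · rw [h]
      · exact this n h
    rw [this, PowerSeries.map_C]
    have h1 := Submodule.smul_mem (powersUpTo 0)
      ((Int.castRingHom (ZMod 2)) (PowerSeries.coeff 0 φ)) (pow_mem_powersUpTo le_rfl)
    rwa [pow_zero, PowerSeries.smul_eq_C_mul, mul_one] at h1
  | succ k ih =>
    intro w hw f φ hφ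
    set c := PowerSeries.coeff 0 φ with hc
    -- The power `E₄ ^ (3(k + 1))` has weight `12(k + 1)`, constant term 1 and reduction 1 modulo 2,
    -- so subtracting its multiple by `c` affects only the constant in the reduction.
    set E : ModularForm 𝒮ℒ w := ModularForm.mcast (by rw [hw]; push_cast; ring)
      ((ModularForm.E (by norm_num : 3 ≤ 4)).pow (3 * (k + 1))) with hE
    have hEq : qExpansion 1 E = (E4Series ^ (3 * (k + 1))).map (Int.castRingHom ℂ) := by
      rw [map_pow, map_E4Series, hE, coe_mcast,
        ModularForm.qExpansion_pow one_pos one_mem_strictPeriods_SL]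
    have hc0 : PowerSeries.coeff 0 (φ - PowerSeries.C c * E4Series ^ (3 * (k + 1))) = 0 := by
      have : PowerSeries.constantCoeff E4Series = 1 := by
        simp [E4Series, sigmaSeries]
      rw [map_sub, PowerSeries.coeff_C_mul, ← hc]
      simp [this]
    have hq : (φ - PowerSeries.C c * E4Series ^ (3 * (k + 1))).map (Int.castRingHom ℂ) =
        qExpansion 1 (f - (c : ℂ) • E : ModularForm 𝒮ℒ w) := by
      rw [FunLike.coe_sub, ModularForm.qExpansion_sub one_pos one_mem_strictPeriods_SL,
        FunLike.coe_smul, ModularForm.qExpansion_smul one_pos one_mem_strictPeriods_SL, hEq, ← hφ,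
        map_sub, map_mul, PowerSeries.map_C, PowerSeries.smul_eq_C_mul]
      rfl
    have hcusp : (qExpansion 1 (f - (c : ℂ) • E : ModularForm 𝒮ℒ w)).coeff 0 = 0 := by
      rw [← hq, PowerSeries.coeff_map, hc0, map_zero]
    have hdiv := ModularForm.qExpansion_eq_qExpansion_discriminant_mul _ hcusp
    set g := CuspForm.discriminantEquiv (toCuspForm (f - (c : ℂ) • E) hcusp)
    obtain ⟨u, hu⟩ := exists_discSeries_eq_X_mul_unit
    obtain ⟨θ, hθ⟩ := PowerSeries.X_dvd_iff.mpr
      (by simpa using hc0 : PowerSeries.constantCoeff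
        (φ - PowerSeries.C c * E4Series ^ (3 * (k + 1))) = 0)
    have hψ : φ - PowerSeries.C c * E4Series ^ (3 * (k + 1)) = discSeries * (↑u⁻¹ * θ) := by
      rw [hθ, hu, mul_assoc, ← mul_assoc (u : PowerSeries ℤ), Units.mul_inv, one_mul]
    have hg : (↑u⁻¹ * θ).map (Int.castRingHom ℂ) = qExpansion 1 g := by
      rw [← hq, hψ, map_mul, map_discSeries] at hdiv
      refine mul_left_cancel₀ (fun h => ?_) hdiv
      have := discriminant_qExpansion_order
      rw [h, PowerSeries.order_zero] at this
      simp at this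
    have h1 := ih (by rw [hw]; push_cast; ring) g _ hg
    have h2 : φ = PowerSeries.C c * E4Series ^ (3 * (k + 1)) + discSeries * (↑u⁻¹ * θ) := by
      rw [← hψ]; ring
    rw [h2, map_add, map_mul, map_mul, map_pow, map_E4Series_zmod_two, one_pow,
      map_discSeries_zmod_two, PowerSeries.map_C]
    refine add_mem ?_ (Delta_mul_mem_powersUpTo h1)
    have h3 := Submodule.smul_mem (powersUpTo (k + 1)) ((Int.castRingHom (ZMod 2)) c)
      (pow_mem_powersUpTo (Nat.zero_le _))
    rwa [pow_zero, PowerSeries.smul_eq_C_mul] at h3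

/-- The characteristic-zero operator in weight `12k` preserves integrality, as `12k - 1` is
nonnegative for `k ≠ 0`. It reduces to `heckeT`, as `p ^ (12k - 1)` is odd. -/
lemma heckeT_pow_mem_powersUpTo (p : ℕ) (hp : p.Prime) (hp2 : p ≠ 2) {k : ℕ} (hk : k ≠ 0) :
    heckeT p (Delta ^ k) ∈ powersUpTo k := by
  have : Fact p.Prime := ⟨hp⟩
  set D : ModularForm 𝒮ℒ ((k : ℤ) * 12) :=
    ((ModularFormClass.modularForm CuspForm.discriminant : ModularForm 𝒮ℒ 12).pow k) with hD
  have hDq : qExpansion 1 D = (discSeries ^ k).map (Int.castRingHom ℂ) := by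
    rw [hD, ModularForm.qExpansion_pow one_pos one_mem_strictPeriods_SL, map_pow, map_discSeries]
    rfl
  set φ : PowerSeries ℤ := PowerSeries.mk fun m => (discSeries ^ k).coeff (p * m) +
      if p ∣ m then (p : ℤ) ^ (12 * k - 1) * (discSeries ^ k).coeff (m / p) else 0 with hφ
  have hφq : φ.map (Int.castRingHom ℂ) = qExpansion 1 (heckeForm p D) := by
    ext m
    rw [qExpansion_heckeForm, hDq, hφ]
    have e : ((k : ℤ) * 12 - 1) = ((12 * k - 1 : ℕ) : ℤ) := by omega
    rw [e]
    simp only [PowerSeries.coeff_map, PowerSeries.coeff_mk, zpow_natCast]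
    split_ifs <;> simp
  have h := map_zmod_two_mem_powersUpTo k (by ring) (heckeForm p D) φ hφq
  convert h using 1
  ext m
  have hpodd : (p : ZMod 2) = 1 :=
    zmod_two_natCast_odd fun h => hp2 ((Nat.prime_dvd_prime_iff_eq Nat.prime_two hp).mp h).symm
  simp only [heckeT, LinearMap.coe_mk, AddHom.coe_mk, PowerSeries.coeff_map, PowerSeries.coeff_mk,
    hφ, ← map_discSeries_zmod_two, ← map_pow]
  split_ifs <;> simp [hpodd]

end
end HeckeModTwo

/-! ### Transfer to polynomials; exponents modulo 8; squares -/

namespace HeckeModTwo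
section
open Polynomial

/-- Evaluation of polynomials at `Δ`. -/
noncomputable def evalDelta : (ZMod 2)[X] →ₐ[ZMod 2] PowerSeries (ZMod 2) := aeval Delta

@[simp] lemma evalDelta_X : evalDelta X = Delta := aeval_X _

lemma coeff_Delta (n : ℕ) [Decidable (∃ m : ℕ, n = (2 * m + 1) ^ 2)] :
    PowerSeries.coeff n Delta = if ∃ m : ℕ, n = (2 * m + 1) ^ 2 then 1 else 0 := by
  rw [Delta, PowerSeries.coeff_mk]
  congr

lemma exists_Delta_eq_X_mul :
    ∃ r : PowerSeries (ZMod 2), Delta = PowerSeries.X * r ∧ PowerSeries.constantCoeff r = 1 := by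
  classical
  have h0 : PowerSeries.constantCoeff Delta = 0 := by
    rw [← PowerSeries.coeff_zero_eq_constantCoeff_apply, coeff_Delta, if_neg]
    rintro ⟨m, hm⟩
    exact (pow_ne_zero 2 (Nat.succ_ne_zero (2 * m))) hm.symm
  obtain ⟨r, hr⟩ := PowerSeries.X_dvd_iff.mpr h0
  refine ⟨r, hr, ?_⟩
  have h1 : PowerSeries.coeff 1 Delta = 1 := by
    rw [coeff_Delta, if_pos ⟨0, rfl⟩]
  rw [hr, ← zero_add 1, PowerSeries.coeff_succ_X_mul] at h1
  simpa using h1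

lemma Delta_ne_zero : Delta ≠ 0 := by
  obtain ⟨r, hr, h1⟩ := exists_Delta_eq_X_mul
  rw [hr]
  refine mul_ne_zero PowerSeries.X_ne_zero ?_
  rintro rfl
  simp at h1

lemma coeff_Delta_pow_self (k : ℕ) : PowerSeries.coeff k (Delta ^ k) = 1 := by
  obtain ⟨r, hr, h1⟩ := exists_Delta_eq_X_mul
  rw [hr, mul_pow]
  have := PowerSeries.coeff_X_pow_mul (r ^ k) k 0
  rw [zero_add] at this
  rw [this]
  simp [h1]

lemma constantCoeff_evalDelta (P : (ZMod 2)[X]) :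
    PowerSeries.constantCoeff (evalDelta P) = P.coeff 0 := by
  have h : PowerSeries.constantCoeff Delta = 0 := by
    obtain ⟨r, hr, _⟩ := exists_Delta_eq_X_mul
    simp [hr]
  have : evalDelta P = Delta * evalDelta P.divX + PowerSeries.C (P.coeff 0) := by
    conv_lhs => rw [← P.divX_mul_X_add]
    rw [map_add, map_mul, evalDelta_X, mul_comm]
    congr 1
    exact aeval_C _ _
  rw [this, map_add, map_mul, h, zero_mul, zero_add, PowerSeries.constantCoeff_C]

/-- A polynomial killed by evaluation has zero constant term because `Δ` has none; cancelling a
factor `Δ` then lowers the degree. -/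
lemma evalDelta_injective : Function.Injective evalDelta := by
  rw [injective_iff_map_eq_zero]
  intro P
  induction hn : P.natDegree using Nat.strong_induction_on generalizing P with
  | _ n ih =>
    intro hP
    have h0 : P.coeff 0 = 0 := by rw [← constantCoeff_evalDelta, hP, map_zero]
    have h1 : P = P.divX * X := by
      conv_lhs => rw [← P.divX_mul_X_add, h0, map_zero, add_zero]
    by_cases hd : n = 0
    · rw [Polynomial.eq_C_of_natDegree_eq_zero (hn.trans hd), h0, map_zero]
    · have h2 : evalDelta P.divX = 0 := by
        rw [h1, map_mul, evalDelta_X] at hP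
        exact (mul_eq_zero.mp hP).resolve_right Delta_ne_zero
      rw [h1, ih _ (by rw [natDegree_divX_eq_natDegree_tsub_one, hn]; omega) P.divX rfl h2, zero_mul]

lemma evalDelta_eq_sum (P : (ZMod 2)[X]) :
    evalDelta P = ∑ i ∈ P.support, P.coeff i • Delta ^ i := by
  rw [evalDelta, aeval_eq_sum_range]
  exact (P.sum_over_range' (f := fun i c => c • Delta ^ i) (by simp) _ (Nat.lt_succ_self _)).symm

lemma mem_powersUpTo_iff {k : ℕ} {f : PowerSeries (ZMod 2)} :
    f ∈ powersUpTo k ↔ ∃ P : (ZMod 2)[X], P.natDegree ≤ k ∧ evalDelta P = f := by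
  constructor
  · intro hf
    induction hf using Submodule.span_induction with
    | mem x hx =>
      obtain ⟨i, hi, rfl⟩ := hx
      exact ⟨X ^ i, by simpa using hi, by simp⟩
    | zero => exact ⟨0, by simp, by simp⟩
    | add x y _ _ hx hy =>
      obtain ⟨P, hP, rfl⟩ := hx
      obtain ⟨Q, hQ, rfl⟩ := hy
      exact ⟨P + Q, natDegree_add_le_of_degree_le hP hQ, map_add _ _ _⟩
    | smul c x _ hx =>
      obtain ⟨P, hP, rfl⟩ := hx
      exact ⟨c • P, (natDegree_smul_le _ _).trans hP, map_smul _ _ _⟩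
  · rintro ⟨P, hP, rfl⟩
    rw [evalDelta_eq_sum]
    exact Submodule.sum_mem _ fun i hi =>
      Submodule.smul_mem _ _ (pow_mem_powersUpTo ((le_natDegree_of_mem_supp i hi).trans hP))

lemma heckeT_one (p : ℕ) (hp : p ≠ 0) : heckeT p 1 = 0 := by
  ext n
  simp only [heckeT, LinearMap.coe_mk, AddHom.coe_mk, PowerSeries.coeff_mk, PowerSeries.coeff_one,
    map_zero]
  rcases eq_or_ne n 0 with rfl | hn
  · simp; decide
  · have : ¬ (p * n = 0) := mul_ne_zero hp hn
    rw [if_neg this]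
    split_ifs with h h'
    · exact absurd (Nat.eq_zero_of_dvd_of_div_eq_zero h h') hn
    · simp
    · simp

/-- `p` is an odd prime. -/
def OddPrime (p : ℕ) : Prop := p.Prime ∧ p ≠ 2

lemma heckeT_pow_mem {p : ℕ} (hp : OddPrime p) (k : ℕ) :
    heckeT p (Delta ^ k) ∈ powersUpTo k := by
  rcases eq_or_ne k 0 with rfl | hk
  · rw [pow_zero, heckeT_one p hp.1.ne_zero]; exact zero_mem _
  · exact heckeT_pow_mem_powersUpTo p hp.1 hp.2 hk

lemma heckeT_evalDelta_mem {p : ℕ} (hp : OddPrime p) (P : (ZMod 2)[X]) :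
    heckeT p (evalDelta P) ∈ LinearMap.range evalDelta.toLinearMap := by
  rw [evalDelta_eq_sum, map_sum]
  refine Submodule.sum_mem _ fun i _ => ?_
  rw [map_smul]
  obtain ⟨Q, _, hQ⟩ := mem_powersUpTo_iff.mp (heckeT_pow_mem hp i)
  exact Submodule.smul_mem _ _ ⟨Q, hQ⟩

/-- The Hecke operator `T_p` on polynomials in `Δ`. -/
noncomputable def heckePoly {p : ℕ} (hp : OddPrime p) : (ZMod 2)[X] →ₗ[ZMod 2] (ZMod 2)[X] :=
  (LinearEquiv.ofInjective evalDelta.toLinearMap evalDelta_injective).symm.toLinearMap ∘ₗ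
    ((heckeT p).comp evalDelta.toLinearMap).codRestrict (LinearMap.range evalDelta.toLinearMap)
      (heckeT_evalDelta_mem hp)

lemma evalDelta_heckePoly {p : ℕ} (hp : OddPrime p) (P : (ZMod 2)[X]) :
    evalDelta (heckePoly hp P) = heckeT p (evalDelta P) := by
  have h := (LinearEquiv.ofInjective evalDelta.toLinearMap evalDelta_injective).apply_symm_apply
    (((heckeT p).comp evalDelta.toLinearMap).codRestrict (LinearMap.range evalDelta.toLinearMap)
      (heckeT_evalDelta_mem hp) P)
  exact congrArg Subtype.val h

lemma natDegree_heckePoly_X_pow {p : ℕ} (hp : OddPrime p) (k : ℕ) :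
    (heckePoly hp (X ^ k)).natDegree ≤ k := by
  obtain ⟨Q, hQ, h⟩ := mem_powersUpTo_iff.mp (heckeT_pow_mem hp k)
  have : heckePoly hp (X ^ k) = Q := evalDelta_injective (by
    rw [evalDelta_heckePoly, h, map_pow, evalDelta_X])
  rwa [this]

/-- Power series supported on exponents congruent to `r` modulo `8`. -/
def SuppMod (r : ZMod 8) (f : PowerSeries (ZMod 2)) : Prop :=
  ∀ n, PowerSeries.coeff n f ≠ 0 → (n : ZMod 8) = r

lemma SuppMod.mul {r s : ZMod 8} {f g : PowerSeries (ZMod 2)} (hf : SuppMod r f)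
    (hg : SuppMod s g) : SuppMod (r + s) (f * g) := by
  intro n hn
  rw [PowerSeries.coeff_mul] at hn
  obtain ⟨⟨i, j⟩, hij, h⟩ := Finset.exists_ne_zero_of_sum_ne_zero hn
  rw [← hf i (left_ne_zero_of_mul h), ← hg j (right_ne_zero_of_mul h),
    ← Finset.HasAntidiagonal.mem_antidiagonal.mp hij]
  push_cast; rfl

/-- Odd squares are congruent to 1 modulo 8. -/
lemma SuppMod.Delta_pow (k : ℕ) : SuppMod k (Delta ^ k) := by
  classical
  induction k with
  | zero =>
    intro n hn
    rw [pow_zero, PowerSeries.coeff_one] at hn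
    by_cases h : n = 0
    · rw [h]
    · simp [h] at hn
  | succ k ih =>
    rw [pow_succ, Nat.cast_succ]
    refine ih.mul fun n hn => ?_
    rw [coeff_Delta] at hn
    by_cases h : ∃ m : ℕ, n = (2 * m + 1) ^ 2
    · obtain ⟨m, rfl⟩ := h
      push_cast
      generalize (m : ZMod 8) = x
      revert x; decide
    · simp [h] at hn

lemma OddPrime.sq_zmod_eight {p : ℕ} (hp : OddPrime p) : (p : ZMod 8) * p = 1 := by
  obtain ⟨m, rfl⟩ := hp.1.odd_of_ne_two hp.2
  push_cast
  generalize (m : ZMod 8) = x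
  revert x; decide

/-- Since `p² ≡ 1` modulo 8, both `p n ≡ r` and `n / p ≡ r` say that `n ≡ p r`. -/
lemma SuppMod.heckeT {p : ℕ} (hp : OddPrime p) {r : ZMod 8} {f : PowerSeries (ZMod 2)}
    (hf : SuppMod r f) : SuppMod (p * r) (heckeT p f) := by
  intro n hn
  simp only [HeckeModTwo.heckeT, LinearMap.coe_mk, AddHom.coe_mk, PowerSeries.coeff_mk] at hn
  by_cases h : PowerSeries.coeff (p * n) f = 0
  · rw [h, zero_add] at hn
    by_cases hd : p ∣ n
    · rw [if_pos hd] at hn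
      rw [← hf _ hn]
      conv_lhs => rw [← Nat.mul_div_cancel' hd]
      push_cast; rfl
    · exact absurd (if_neg hd) hn
  · have := hf _ h
    push_cast at this
    rw [← this, ← mul_assoc, hp.sq_zmod_eight, one_mul]

/-- The projection of a power series to exponents congruent to `r` modulo `8`. -/
noncomputable def projMod (r : ZMod 8) : PowerSeries (ZMod 2) →ₗ[ZMod 2] PowerSeries (ZMod 2) where
  toFun f := PowerSeries.mk fun n => if (n : ZMod 8) = r then PowerSeries.coeff n f else 0
  map_add' f g := by ext n; by_cases h : (n : ZMod 8) = r <;> simp [h]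
  map_smul' c f := by ext n; by_cases h : (n : ZMod 8) = r <;> simp [h]

lemma SuppMod.projMod {r s : ZMod 8} {f : PowerSeries (ZMod 2)} (hf : SuppMod r f) :
    projMod s f = if r = s then f else 0 := by
  ext n
  simp only [HeckeModTwo.projMod, LinearMap.coe_mk, AddHom.coe_mk, PowerSeries.coeff_mk]
  by_cases h : PowerSeries.coeff n f = 0
  · rw [h]; split_ifs <;> simp [h]
  · rw [hf n h]; split_ifs <;> simp

lemma SuppMod.mem_support {r : ZMod 8} {P : (ZMod 2)[X]} (h : SuppMod r (evalDelta P)) {i : ℕ}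
    (hi : i ∈ P.support) : (i : ZMod 8) = r := by
  have h1 : HeckeModTwo.projMod r (evalDelta P) =
      evalDelta (∑ i ∈ P.support.filter (fun i : ℕ => (i : ZMod 8) = r), C (P.coeff i) * X ^ i) := by
    rw [evalDelta_eq_sum, map_sum, map_sum, Finset.sum_filter]
    refine Finset.sum_congr rfl fun i _ => ?_
    rw [map_smul, (SuppMod.Delta_pow i).projMod]
    split_ifs with h
    · rw [map_mul, map_pow, evalDelta_X, Algebra.smul_def]
      congr 1
      exact (aeval_C _ _).symm
    · rw [smul_zero]
  rw [h.projMod, if_pos rfl] at h1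
  have h2 := evalDelta_injective h1
  by_contra hne
  rw [mem_support_iff] at hi
  apply hi
  rw [h2, finsetSum_coeff]
  refine Finset.sum_eq_zero fun j hj => ?_
  rw [coeff_C_mul, coeff_X_pow, if_neg, mul_zero]
  rintro rfl
  exact hne (Finset.mem_filter.mp hj).2

lemma mem_support_heckePoly_X_pow {p : ℕ} (hp : OddPrime p) {k i : ℕ}
    (hi : i ∈ (heckePoly hp (X ^ k)).support) : (i : ZMod 8) = p * k ∧ i ≤ k := by
  refine ⟨SuppMod.mem_support ?_ hi,
    (le_natDegree_of_mem_supp i hi).trans (natDegree_heckePoly_X_pow hp k)⟩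
  rw [evalDelta_heckePoly, map_pow, evalDelta_X]
  exact (SuppMod.Delta_pow k).heckeT hp

lemma heckePoly_X_pow_eq_zero {p : ℕ} (hp : OddPrime p) (k : ℕ)
    (h : ∀ i ≤ k, (i : ZMod 8) ≠ p * k) : heckePoly hp (X ^ k) = 0 := by
  rw [← support_eq_empty, Finset.eq_empty_iff_forall_notMem]
  intro i hi
  obtain ⟨h1, h2⟩ := mem_support_heckePoly_X_pow hp hi
  exact h i h2 h1

/-- When degree and congruence leave a single possible exponent `j`, its coefficient can be read off
at `q ^ j`, because `Δ ^ j` starts with `q ^ j`. This makes the initial values computable. -/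
lemma heckePoly_X_pow_eq {p : ℕ} (hp : OddPrime p) (k j : ℕ)
    (h : ∀ i ≤ k, (i : ZMod 8) = p * k → i = j) :
    heckePoly hp (X ^ k) = C (PowerSeries.coeff j (heckeT p (Delta ^ k))) * X ^ j := by
  have h1 : heckePoly hp (X ^ k) = C ((heckePoly hp (X ^ k)).coeff j) * X ^ j := by
    ext i
    rw [coeff_C_mul, coeff_X_pow]
    split_ifs with hij
    · rw [hij, mul_one]
    · rw [mul_zero]
      by_contra hne
      obtain ⟨h1, h2⟩ := mem_support_heckePoly_X_pow hp (mem_support_iff.mpr hne)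
      exact hij (h i h2 h1)
  generalize (heckePoly hp (X ^ k)).coeff j = q at h1
  have h2 : heckeT p (Delta ^ k) = PowerSeries.C q * Delta ^ j := by
    have := evalDelta_heckePoly hp (X ^ k)
    rw [map_pow evalDelta, evalDelta_X] at this
    rw [← this, h1, map_mul, map_pow, evalDelta_X]
    congr 1
    exact aeval_C _ _
  rw [h2, PowerSeries.coeff_C_mul, coeff_Delta_pow_self, mul_one]
  exact h1

/-- Squaring is the substitution `q ↦ q ^ 2`, which is compatible with `T_p` because 2 and `p` are
coprime. -/
lemma heckeT_sq (p : ℕ) (hp : OddPrime p) (f : PowerSeries (ZMod 2)) :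
    heckeT p (f ^ 2) = heckeT p f ^ 2 := by
  have hodd : ¬ 2 ∣ p := fun h => hp.2 ((Nat.prime_dvd_prime_iff_eq Nat.prime_two hp.1).mp h).symm
  have hcop : Nat.Coprime 2 p := (Nat.Prime.coprime_iff_not_dvd Nat.prime_two).mpr hodd
  ext n
  rw [coeff_sq]
  simp only [heckeT, LinearMap.coe_mk, AddHom.coe_mk, PowerSeries.coeff_mk, coeff_sq]
  by_cases h : 2 ∣ n
  · obtain ⟨m, rfl⟩ := h
    have e1 : 2 ∣ p * (2 * m) := ⟨p * m, by ring⟩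
    have e2 : p * (2 * m) / 2 = p * m := by
      rw [show p * (2 * m) = 2 * (p * m) by ring, Nat.mul_div_cancel_left _ two_pos]
    rw [if_pos e1, e2, if_pos (dvd_mul_right 2 m), Nat.mul_div_cancel_left _ two_pos]
    congr 1
    by_cases hd : p ∣ m
    · obtain ⟨r, rfl⟩ := hd
      have e3 : 2 * (p * r) / p = 2 * r := by
        rw [show 2 * (p * r) = p * (2 * r) by ring, Nat.mul_div_cancel_left _ hp.1.pos]
      rw [if_pos ⟨2 * r, by ring⟩, e3, if_pos (dvd_mul_right _ _), if_pos (dvd_mul_right _ _),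
        Nat.mul_div_cancel_left _ two_pos, Nat.mul_div_cancel_left _ hp.1.pos]
    · rw [if_neg hd, if_neg]
      exact fun h => hd (hcop.symm.dvd_of_dvd_mul_left h)
  · have e1 : ¬ 2 ∣ p * n := fun h' => h (hcop.dvd_of_dvd_mul_left h')
    rw [if_neg h, if_neg e1, zero_add]
    split_ifs with h1 h2
    · exact absurd (h2.trans (Nat.div_dvd_of_dvd h1)) h
    · rfl
    · rfl

lemma heckePoly_sq {p : ℕ} (hp : OddPrime p) (P : (ZMod 2)[X]) :
    heckePoly hp (P ^ 2) = heckePoly hp P ^ 2 :=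
  evalDelta_injective (by
    rw [evalDelta_heckePoly, map_pow, heckeT_sq p hp, map_pow, evalDelta_heckePoly])

end
end HeckeModTwo

/-! ### `T_p` as a trace, and its linear recurrence -/

namespace HeckeModTwo
section
open Polynomial

section Section
variable (p : ℕ)

/-- The series of coefficients of `f` at exponents congruent to `i` modulo `p`. -/
noncomputable def sectionSeries (i : Fin p) : PowerSeries (ZMod 2) →ₗ[ZMod 2] PowerSeries (ZMod 2) where
  toFun f := PowerSeries.mk fun n => PowerSeries.coeff (p * n + i) f
  map_add' f g := by ext n; simp
  map_smul' c f := by ext n; simp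

@[simp] lemma coeff_sectionSeries (i : Fin p) (f : PowerSeries (ZMod 2)) (n : ℕ) :
    PowerSeries.coeff n (sectionSeries p i f) = PowerSeries.coeff (p * n + i) f := by
  simp [sectionSeries]

variable [NeZero p]

lemma sectionSeries_expand_mul (i : Fin p) (g f : PowerSeries (ZMod 2)) :
    sectionSeries p i (PowerSeries.expand p (NeZero.ne p) g * f) = g * sectionSeries p i f := by
  have hp : 0 < p := Nat.pos_of_ne_zero (NeZero.ne p)
  ext n
  rw [coeff_sectionSeries, PowerSeries.coeff_mul, PowerSeries.coeff_mul]
  symm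
  refine Finset.sum_of_injOn (fun x : ℕ × ℕ => (p * x.1, p * x.2 + i)) ?_ ?_ ?_ ?_
  · rintro ⟨a, b⟩ _ ⟨c, d⟩ _ h
    simp only [Prod.mk.injEq, add_left_inj] at h
    exact Prod.ext (Nat.eq_of_mul_eq_mul_left hp h.1) (Nat.eq_of_mul_eq_mul_left hp h.2)
  · rintro ⟨a, b⟩ h
    have h' : a + b = n := by simpa using h
    simp only [← h', Finset.mem_coe,
      Finset.HasAntidiagonal.mem_antidiagonal]
    ring
  · rintro ⟨u, v⟩ h h'
    have hu : u + v = p * n + i := by simpa using h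
    rw [PowerSeries.coeff_expand]
    split_ifs with hd
    · exfalso
      obtain ⟨a, rfl⟩ := hd
      apply h'
      have han : a ≤ n := by
        by_contra hlt
        have : p * (n + 1) ≤ p * a := Nat.mul_le_mul_left p (by omega)
        have := i.2
        rw [Nat.mul_add] at *
        omega
      obtain ⟨b, rfl⟩ := Nat.exists_eq_add_of_le han
      refine ⟨(a, b), by simp, ?_⟩
      rw [Nat.mul_add] at hu
      simp only [Prod.mk.injEq, true_and]
      omega
    · rw [zero_mul]
  · rintro ⟨a, b⟩ _
    simp

/-- This exhibits `1, q, …, q ^ (p - 1)` as spanning `𝔽₂⟦q⟧` over `𝔽₂⟦q ^ p⟧`, with the sections as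
coordinates. -/
lemma sum_X_pow_mul_expand_sectionSeries (f : PowerSeries (ZMod 2)) :
    f = ∑ i : Fin p, PowerSeries.expand p (NeZero.ne p) (sectionSeries p i f) *
      PowerSeries.X ^ (i : ℕ) := by
  have hp : 0 < p := Nat.pos_of_ne_zero (NeZero.ne p)
  ext n
  rw [map_sum, Finset.sum_eq_single (⟨n % p, Nat.mod_lt _ hp⟩ : Fin p)]
  · rw [PowerSeries.coeff_mul_X_pow', if_pos (Nat.mod_le _ _), PowerSeries.coeff_expand,
      if_pos (Nat.dvd_sub_mod n), coeff_sectionSeries, Nat.mul_div_cancel' (Nat.dvd_sub_mod n)]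
    congr 2
    exact (Nat.sub_add_cancel (Nat.mod_le n p)).symm
  · intro i _ hi
    rw [PowerSeries.coeff_mul_X_pow']
    split_ifs with h
    · rw [PowerSeries.coeff_expand, if_neg]
      rintro ⟨a, ha⟩
      apply hi
      ext
      have : n = i + p * a := by omega
      simp only [this, Nat.add_mul_mod_self_left, Nat.mod_eq_of_lt i.2]
    · rfl
  · simp

/-- Multiplication by `f` on `𝔽₂⟦q⟧`, as a matrix over `𝔽₂⟦q ^ p⟧`. -/
noncomputable def mulMatrix (f : PowerSeries (ZMod 2)) :
    Matrix (Fin p) (Fin p) (PowerSeries (ZMod 2)) :=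
  Matrix.of fun i j => sectionSeries p i (f * PowerSeries.X ^ (j : ℕ))

lemma mulMatrix_mul (f g : PowerSeries (ZMod 2)) :
    mulMatrix p (f * g) = mulMatrix p f * mulMatrix p g := by
  ext1 i j
  rw [Matrix.mul_apply]
  simp only [mulMatrix, Matrix.of_apply]
  conv_lhs => rw [mul_assoc, sum_X_pow_mul_expand_sectionSeries p (g * PowerSeries.X ^ (j : ℕ)),
    Finset.mul_sum, map_sum]
  refine Finset.sum_congr rfl fun l _ => ?_
  rw [mul_left_comm, sectionSeries_expand_mul, mul_comm]

lemma mulMatrix_one : mulMatrix p 1 = 1 := by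
  have hp : 0 < p := Nat.pos_of_ne_zero (NeZero.ne p)
  ext i j n
  simp only [mulMatrix, Matrix.of_apply, one_mul, coeff_sectionSeries, PowerSeries.coeff_X_pow,
    Matrix.one_apply]
  have hi := i.2
  have hj := j.2
  by_cases h : i = j
  · subst h
    simp [PowerSeries.coeff_one, hp.ne']
  · have : p * n + i ≠ j := by
      intro h'
      rcases Nat.eq_zero_or_pos n with rfl | hn
      · exact h (Fin.ext (by simpa using h'))
      · have := Nat.le_mul_of_pos_right p hn
        omega
    simp [h, this]

/-- The matrix over `𝔽₂⟦q⟧` whose trace is the Hecke operator. -/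
noncomputable def heckeMatrix (f : PowerSeries (ZMod 2)) :
    Matrix (Fin p ⊕ Unit) (Fin p ⊕ Unit) (PowerSeries (ZMod 2)) :=
  Matrix.fromBlocks (mulMatrix p f) 0 0 (Matrix.of fun _ _ => PowerSeries.expand p (NeZero.ne p) f)

lemma heckeMatrix_mul (f g : PowerSeries (ZMod 2)) :
    heckeMatrix p (f * g) = heckeMatrix p f * heckeMatrix p g := by
  rw [heckeMatrix, heckeMatrix, heckeMatrix, Matrix.fromBlocks_multiply, mulMatrix_mul, map_mul]
  congr 1
  · simp
  · simp
  · simp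
  · ext1 i j
    simp [Matrix.mul_apply]

lemma heckeMatrix_pow (f : PowerSeries (ZMod 2)) (k : ℕ) :
    heckeMatrix p (f ^ k) = heckeMatrix p f ^ k := by
  induction k with
  | zero =>
    rw [pow_zero, pow_zero, heckeMatrix, mulMatrix_one, map_one, ← Matrix.fromBlocks_one]
    congr 1
  | succ k ih => rw [pow_succ, heckeMatrix_mul, ih, pow_succ]

/-- Each of the `p` diagonal entries of the multiplication matrix has `n`-th coefficient
`a_{pn}(f)`, and `p` is odd. The extra block supplies `f(q ^ p)`, the remaining term of the Hecke
operator. -/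
lemma trace_heckeMatrix (hp : ¬ 2 ∣ p) (f : PowerSeries (ZMod 2)) :
    (heckeMatrix p f).trace = heckeT p f := by
  ext n
  have h : ∀ i : Fin p, PowerSeries.coeff (p * n + i) (f * PowerSeries.X ^ (i : ℕ)) =
      PowerSeries.coeff (p * n) f := fun i => PowerSeries.coeff_mul_X_pow f i (p * n)
  rw [heckeMatrix, Matrix.trace, Fintype.sum_sum_type, map_add, map_sum]
  simp only [Matrix.diag_apply, Matrix.fromBlocks_apply₁₁, Matrix.fromBlocks_apply₂₂, mulMatrix, Matrix.of_apply, coeff_sectionSeries, h,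
    Finset.sum_const, Finset.card_univ, Fintype.card_fin, nsmul_eq_mul, zmod_two_natCast_odd hp,
    one_mul, Finset.univ_unique, Finset.card_singleton, Nat.cast_one, PowerSeries.coeff_expand]
  simp [heckeT]

end Section

/-- The operator `T_p` satisfies a linear recurrence of order `p + 1` on powers. -/
lemma exists_recurrence {p : ℕ} (hp : OddPrime p) (f : PowerSeries (ZMod 2)) :
    ∃ c : ℕ → PowerSeries (ZMod 2), ∀ k : ℕ, heckeT p (f ^ (k + (p + 1))) =
      ∑ i ∈ Finset.range (p + 1), c i * heckeT p (f ^ (k + i)) := by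
  have : NeZero p := ⟨hp.1.ne_zero⟩
  have hodd : ¬ 2 ∣ p := fun h => hp.2 ((Nat.prime_dvd_prime_iff_eq Nat.prime_two hp.1).mp h).symm
  set N := heckeMatrix p f with hN
  have hdeg : N.charpoly.natDegree = p + 1 := by
    rw [Matrix.charpoly_natDegree_eq_dim]; simp
  refine ⟨fun i => - N.charpoly.coeff i, fun k => ?_⟩
  -- Cayley–Hamilton, multiplied by `N ^ k` and traced: the powers of `N` are the Hecke matrices of
  -- the powers of `f`.
  have h := Matrix.aeval_self_charpoly N
  rw [N.charpoly_monic.as_sum, hdeg, map_add, map_pow, aeval_X, map_sum] at h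
  have h2 := congrArg (fun A => Matrix.trace (N ^ k * A)) h
  simp only [map_mul, aeval_C, map_pow, aeval_X, mul_add, mul_zero, Matrix.trace_add,
    Matrix.trace_zero, Finset.mul_sum, Matrix.trace_sum, ← pow_add] at h2
  have e : ∀ i, (N ^ k * ((algebraMap (PowerSeries (ZMod 2)) _) (N.charpoly.coeff i) * N ^ i)).trace
      = N.charpoly.coeff i * heckeT p (f ^ (k + i)) := by
    intro i
    rw [Algebra.left_comm, ← pow_add, ← Algebra.smul_def, Matrix.trace_smul, hN,
      ← heckeMatrix_pow, trace_heckeMatrix p hodd, smul_eq_mul]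
  simp only [e] at h2
  rw [hN, ← heckeMatrix_pow, trace_heckeMatrix p hodd] at h2
  simp only [neg_mul, Finset.sum_neg_distrib]
  exact eq_neg_of_add_eq_zero_left h2

end
end HeckeModTwo

/-! ### Initial values and explicit recurrences for `T₃` and `T₅` -/

namespace HeckeModTwo
section
open Polynomial

lemma oddPrime_three : OddPrime 3 := ⟨Nat.prime_three, by norm_num⟩
lemma oddPrime_five : OddPrime 5 := ⟨Nat.prime_five, by norm_num⟩

/-- The Hecke operator `T₃` on polynomials in `Δ`. -/
noncomputable abbrev T3 : (ZMod 2)[X] →ₗ[ZMod 2] (ZMod 2)[X] := heckePoly oddPrime_three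
/-- The Hecke operator `T₅` on polynomials in `Δ`. -/
noncomputable abbrev T5 : (ZMod 2)[X] →ₗ[ZMod 2] (ZMod 2)[X] := heckePoly oddPrime_five

lemma exists_Delta_eq :
    ∃ r : PowerSeries (ZMod 2), Delta = PowerSeries.X + PowerSeries.X ^ 9 + PowerSeries.X ^ 25 * r := by
  classical
  have h : PowerSeries.X ^ 25 ∣ Delta - PowerSeries.X - PowerSeries.X ^ 9 := by
    rw [PowerSeries.X_pow_dvd_iff]
    intro n hn
    rw [map_sub, map_sub, coeff_Delta, PowerSeries.coeff_X, PowerSeries.coeff_X_pow]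
    have : (∃ m : ℕ, n = (2 * m + 1) ^ 2) ↔ n = 1 ∨ n = 9 := by
      constructor
      · rintro ⟨m, rfl⟩
        have : m < 2 := by nlinarith
        interval_cases m <;> simp
      · rintro (rfl | rfl)
        · exact ⟨0, rfl⟩
        · exact ⟨1, rfl⟩
    rw [if_congr this rfl rfl]
    interval_cases n <;> decide
  obtain ⟨r, hr⟩ := h
  exact ⟨r, by rw [← hr]; ring⟩

lemma add_sq_powerSeries (f g : PowerSeries (ZMod 2)) : (f + g) ^ 2 = f ^ 2 + g ^ 2 :=
  add_pow_char f g 2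

lemma exists_Delta_sq_eq : ∃ r : PowerSeries (ZMod 2),
    Delta ^ 2 = PowerSeries.X ^ 2 + PowerSeries.X ^ 18 + PowerSeries.X ^ 50 * r := by
  obtain ⟨r, hr⟩ := exists_Delta_eq
  exact ⟨r ^ 2, by rw [hr, add_sq_powerSeries, add_sq_powerSeries]; ring⟩

lemma exists_Delta_pow_four_eq : ∃ r : PowerSeries (ZMod 2),
    Delta ^ 4 = PowerSeries.X ^ 4 + PowerSeries.X ^ 36 * r := by
  obtain ⟨r, hr⟩ := exists_Delta_sq_eq
  exact ⟨1 + PowerSeries.X ^ 64 * r ^ 2, by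
    rw [show 4 = 2 * 2 from rfl, pow_mul, hr, add_sq_powerSeries, add_sq_powerSeries]; ring⟩

lemma exists_Delta_pow_eight_eq : ∃ r : PowerSeries (ZMod 2),
    Delta ^ 8 = PowerSeries.X ^ 8 + PowerSeries.X ^ 72 * r := by
  obtain ⟨r, hr⟩ := exists_Delta_pow_four_eq
  exact ⟨r ^ 2, by rw [show 8 = 4 * 2 from rfl, pow_mul, hr, add_sq_powerSeries]; ring⟩

lemma coeff_fifteen_Delta_pow_seven : PowerSeries.coeff 15 (Delta ^ 7) = 1 := by
  obtain ⟨r, hr⟩ := exists_Delta_eq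
  obtain ⟨s, hs⟩ := exists_Delta_sq_eq
  obtain ⟨t, ht⟩ := exists_Delta_pow_four_eq
  have : Delta ^ 7 = Delta ^ 4 * (Delta ^ 2 * Delta) := by ring
  rw [this, ht, hs, hr]
  simp [add_mul, mul_assoc, PowerSeries.coeff_X_pow_mul', PowerSeries.coeff_X,
    PowerSeries.coeff_X_pow]

lemma coeff_twentyfive_Delta_pow_nine : PowerSeries.coeff 25 (Delta ^ 9) = 0 := by
  obtain ⟨r, hr⟩ := exists_Delta_eq
  obtain ⟨s, hs⟩ := exists_Delta_pow_eight_eq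
  have : Delta ^ 9 = Delta ^ 8 * Delta := by ring
  rw [this, hs, hr]
  simp [add_mul, mul_assoc, PowerSeries.coeff_X_pow_mul', PowerSeries.coeff_X,
    PowerSeries.coeff_X_pow]

lemma coeff_thirtyfive_Delta_pow_eleven : PowerSeries.coeff 35 (Delta ^ 11) = 0 := by
  classical
  obtain ⟨s, hs⟩ := exists_Delta_pow_eight_eq
  obtain ⟨t, ht⟩ := exists_Delta_sq_eq
  have h9 : PowerSeries.coeff 9 Delta = 1 := by rw [coeff_Delta, if_pos ⟨1, rfl⟩]
  have h25 : PowerSeries.coeff 25 Delta = 1 := by rw [coeff_Delta, if_pos ⟨2, rfl⟩]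
  have : Delta ^ 11 = Delta ^ 8 * (Delta ^ 2 * Delta) := by ring
  rw [this, hs, ht]
  simp [add_mul, mul_assoc, PowerSeries.coeff_X_pow_mul', h9, h25]
  decide

lemma coeff_heckeT (p n : ℕ) (f : PowerSeries (ZMod 2)) :
    PowerSeries.coeff n (heckeT p f) =
      PowerSeries.coeff (p * n) f + if p ∣ n then PowerSeries.coeff (n / p) f else 0 := by
  simp [heckeT]

lemma heckePoly_one {p : ℕ} (hp : OddPrime p) : heckePoly hp 1 = 0 :=
  evalDelta_injective (by rw [evalDelta_heckePoly, map_one, heckeT_one p hp.1.ne_zero, map_zero])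

lemma T3_one : T3 1 = 0 := heckePoly_one _
lemma T3_X : T3 X = 0 := by
  simpa using heckePoly_X_pow_eq_zero oddPrime_three 1 (by decide)
lemma T3_X_sq : T3 (X ^ 2) = 0 := by rw [heckePoly_sq, T3_X]; simp
lemma T3_X_pow_three : T3 (X ^ 3) = X := by
  rw [heckePoly_X_pow_eq oddPrime_three 3 1 (by decide), coeff_heckeT, mul_one,
    coeff_Delta_pow_self, if_neg (by decide), add_zero, C_1, one_mul, pow_one]
lemma T3_X_pow_four : T3 (X ^ 4) = 0 := by
  rw [show 4 = 2 * 2 from rfl, pow_mul, heckePoly_sq, T3_X_sq]; simp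
lemma T3_X_pow_five : T3 (X ^ 5) = 0 :=
  heckePoly_X_pow_eq_zero oddPrime_three 5 (by decide)
lemma T3_X_pow_six : T3 (X ^ 6) = X ^ 2 := by
  rw [show 6 = 3 * 2 from rfl, pow_mul, heckePoly_sq, T3_X_pow_three]
lemma T3_X_pow_seven : T3 (X ^ 7) = X ^ 5 := by
  rw [heckePoly_X_pow_eq oddPrime_three 7 5 (by decide), coeff_heckeT,
    coeff_fifteen_Delta_pow_seven, if_neg (by decide), add_zero, C_1, one_mul]

lemma T5_one : T5 1 = 0 := heckePoly_one _
lemma T5_X : T5 X = 0 := by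
  simpa using heckePoly_X_pow_eq_zero oddPrime_five 1 (by decide)
lemma T5_X_sq : T5 (X ^ 2) = 0 := by rw [heckePoly_sq, T5_X]; simp
lemma T5_X_pow_three : T5 (X ^ 3) = 0 :=
  heckePoly_X_pow_eq_zero oddPrime_five 3 (by decide)
lemma T5_X_pow_four : T5 (X ^ 4) = 0 := by
  rw [show 4 = 2 * 2 from rfl, pow_mul, heckePoly_sq, T5_X_sq]; simp
lemma T5_X_pow_five : T5 (X ^ 5) = X := by
  rw [heckePoly_X_pow_eq oddPrime_five 5 1 (by decide), coeff_heckeT, mul_one,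
    coeff_Delta_pow_self, if_neg (by decide), add_zero, C_1, one_mul, pow_one]
lemma T5_X_pow_six : T5 (X ^ 6) = 0 := by
  rw [show 6 = 3 * 2 from rfl, pow_mul, heckePoly_sq, T5_X_pow_three]; simp
lemma T5_X_pow_seven : T5 (X ^ 7) = X ^ 3 := by
  rw [heckePoly_X_pow_eq oddPrime_five 7 3 (by decide), coeff_heckeT,
    coeff_fifteen_Delta_pow_seven, if_neg (by decide), add_zero, C_1, one_mul]
lemma T5_X_pow_eight : T5 (X ^ 8) = 0 := by
  rw [show 8 = 4 * 2 from rfl, pow_mul, heckePoly_sq, T5_X_pow_four]; simp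
lemma T5_X_pow_nine : T5 (X ^ 9) = 0 := by
  have h5 : PowerSeries.coeff 1 (Delta ^ 9) = 0 := by
    obtain ⟨s, hs⟩ := exists_Delta_pow_eight_eq
    have : Delta ^ 9 = Delta ^ 8 * Delta := by ring
    rw [this, hs]
    simp [add_mul, mul_assoc, PowerSeries.coeff_X_pow_mul']
  rw [heckePoly_X_pow_eq oddPrime_five 9 5 (by decide), coeff_heckeT,
    coeff_twentyfive_Delta_pow_nine, if_pos (by decide), h5, add_zero, C_0, zero_mul]
lemma T5_X_pow_ten : T5 (X ^ 10) = X ^ 2 := by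
  rw [show 10 = 5 * 2 from rfl, pow_mul, heckePoly_sq, T5_X_pow_five]
lemma T5_X_pow_eleven : T5 (X ^ 11) = 0 := by
  rw [heckePoly_X_pow_eq oddPrime_five 11 7 (by decide), coeff_heckeT,
    coeff_thirtyfive_Delta_pow_eleven, if_neg (by decide), add_zero, C_0, zero_mul]

lemma heckeT_Delta_pow {p : ℕ} (hp : OddPrime p) (k : ℕ) :
    heckeT p (Delta ^ k) = evalDelta (heckePoly hp (X ^ k)) := by
  rw [evalDelta_heckePoly, map_pow evalDelta, evalDelta_X]

/-- The four unknown coefficients of the order-4 recurrence are determined by the values of `T₃` on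
`X ^ k` for `k < 8`. The equations can be solved one after another, and only division by `Δ` is
needed. -/
lemma T3_recurrence (f : (ZMod 2)[X]) : T3 (X ^ 4 * f) = X * T3 (X * f) + X ^ 4 * T3 f := by
  obtain ⟨c, hc⟩ := exists_recurrence oddPrime_three Delta
  simp only [heckeT_Delta_pow oddPrime_three] at hc
  have c0 := hc 0
  have c1 := hc 1
  have c2 := hc 2
  have c3 := hc 3
  simp only [Finset.sum_range_succ, Finset.sum_range_zero, zero_add, add_zero, Nat.reduceAdd,
    pow_zero, pow_one, T3_one, T3_X, T3_X_sq, T3_X_pow_three, T3_X_pow_four, T3_X_pow_five,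
    T3_X_pow_six, T3_X_pow_seven, map_zero, mul_zero, evalDelta_X, map_pow] at c0 c1 c2 c3
  have hΔ := Delta_ne_zero
  have e3 : c 3 = 0 := (mul_eq_zero.mp c0.symm).resolve_right hΔ
  have e2 : c 2 = 0 := by
    refine (mul_eq_zero.mp ?_).resolve_right hΔ
    linear_combination -c1
  have e1 : c 1 = Delta := by
    refine mul_right_cancel₀ hΔ ?_
    linear_combination -c2
  have e0 : c 0 = Delta ^ 4 := by
    refine mul_right_cancel₀ hΔ ?_
    linear_combination -c3 - Delta ^ 2 * e3
  induction f using Polynomial.induction_on' with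
  | add f g hf hg => simp only [mul_add, map_add, hf, hg]; ring
  | monomial n a =>
    rw [← C_mul_X_pow_eq_monomial, C_mul', mul_smul_comm, mul_smul_comm, map_smul, map_smul,
      map_smul, mul_smul_comm, mul_smul_comm, ← smul_add]
    congr 1
    apply evalDelta_injective
    have h := hc n
    simp only [Finset.sum_range_succ, Finset.sum_range_zero, e0, e1, e2, e3, zero_mul, add_zero,
      zero_add, Nat.reduceAdd] at h
    rw [← pow_add, ← pow_succ', add_comm 4, h, map_add, map_mul, map_mul, map_pow evalDelta,
      evalDelta_X]
    ring

/-- As for `T₃`, the six unknown coefficients are solved for successively, from the values of `T₅`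
on `X ^ k` for `k < 12`. -/
lemma T5_recurrence (f : (ZMod 2)[X]) : T5 (X ^ 6 * f) =
    X ^ 2 * T5 (X ^ 4 * f) + X ^ 4 * T5 (X ^ 2 * f) + X * T5 (X * f) + X ^ 6 * T5 f := by
  obtain ⟨c, hc⟩ := exists_recurrence oddPrime_five Delta
  simp only [heckeT_Delta_pow oddPrime_five] at hc
  have c0 := hc 0
  have c1 := hc 1
  have c2 := hc 2
  have c3 := hc 3
  have c4 := hc 4
  have c5 := hc 5
  simp only [Finset.sum_range_succ, Finset.sum_range_zero, zero_add, add_zero, Nat.reduceAdd,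
    pow_zero, pow_one, T5_one, T5_X, T5_X_sq, T5_X_pow_three, T5_X_pow_four, T5_X_pow_five,
    T5_X_pow_six, T5_X_pow_seven, T5_X_pow_eight, T5_X_pow_nine, T5_X_pow_ten, T5_X_pow_eleven,
    map_zero, mul_zero, evalDelta_X, map_pow] at c0 c1 c2 c3 c4 c5
  have hΔ := Delta_ne_zero
  have e5 : c 5 = 0 := (mul_eq_zero.mp c0.symm).resolve_right hΔ
  have e4 : c 4 = Delta ^ 2 := by
    refine mul_right_cancel₀ hΔ ?_
    linear_combination -c1
  have e3 : c 3 = 0 := by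
    refine (mul_eq_zero.mp ?_).resolve_right hΔ
    linear_combination -c2 - Delta ^ 3 * e5
  have two := powerSeries_two_eq_zero
  have e2 : c 2 = Delta ^ 4 := by
    refine mul_right_cancel₀ hΔ ?_
    linear_combination -c3 - Delta ^ 3 * e4 - Delta ^ 5 * two
  have e1 : c 1 = Delta := by
    refine mul_right_cancel₀ hΔ ?_
    linear_combination -c4 - Delta ^ 3 * e3
  have e0 : c 0 = Delta ^ 6 := by
    refine mul_right_cancel₀ hΔ ?_
    linear_combination -c5 - Delta ^ 3 * e2 - Delta ^ 2 * e5 - Delta ^ 7 * two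
  induction f using Polynomial.induction_on' with
  | add f g hf hg => simp only [mul_add, map_add, hf, hg]; ring
  | monomial n a =>
    rw [← C_mul_X_pow_eq_monomial, C_mul']
    simp only [mul_smul_comm, map_smul, ← smul_add]
    congr 1
    apply evalDelta_injective
    have h := hc n
    simp only [Finset.sum_range_succ, Finset.sum_range_zero, e0, e1, e2, e3, e4, e5, zero_mul,
      add_zero, zero_add, Nat.reduceAdd] at h
    rw [← pow_add, ← pow_add, ← pow_add, ← pow_succ', add_comm 6, h]
    simp only [map_add, map_mul, map_pow, evalDelta_X, add_comm 4 n, add_comm 2 n]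
    ring

end
end HeckeModTwo

/-! ### Base-4 digits, weights, codes and the weight filtration -/

namespace HeckeModTwo
section
open Polynomial

/-- The sum `∑ eᵢ 2^i`, where the `eᵢ` are the digits in base `4`. -/
def wt (n : ℕ) : ℕ := if n = 0 then 0 else 2 * wt (n / 4) + n % 4
decreasing_by omega

/-- The sum `∑ ⌊eᵢ / 2⌋ 2^i`, where the `eᵢ` are the digits in base `4`. -/
def hi (n : ℕ) : ℕ := if n = 0 then 0 else 2 * hi (n / 4) + n % 4 / 2
decreasing_by omega

/-- The number obtained by reading the binary digits in base `4`. -/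
def spread (n : ℕ) : ℕ := if n = 0 then 0 else 4 * spread (n / 2) + n % 2
decreasing_by omega

@[simp] lemma wt_zero : wt 0 = 0 := by rw [wt]; simp
@[simp] lemma hi_zero : hi 0 = 0 := by rw [hi]; simp
@[simp] lemma spread_zero : spread 0 = 0 := by rw [spread]; simp

lemma wt_four_mul_add (n : ℕ) {e : ℕ} (he : e < 4) : wt (4 * n + e) = 2 * wt n + e := by
  rw [wt]
  split_ifs with h
  · obtain ⟨rfl, rfl⟩ : n = 0 ∧ e = 0 := by omega
    simp
  · rw [show (4 * n + e) / 4 = n by omega, show (4 * n + e) % 4 = e by omega]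

lemma hi_four_mul_add (n : ℕ) {e : ℕ} (he : e < 4) : hi (4 * n + e) = 2 * hi n + e / 2 := by
  rw [hi]
  split_ifs with h
  · obtain ⟨rfl, rfl⟩ : n = 0 ∧ e = 0 := by omega
    simp
  · rw [show (4 * n + e) / 4 = n by omega, show (4 * n + e) % 4 = e by omega]

lemma spread_two_mul_add (n : ℕ) {e : ℕ} (he : e < 2) :
    spread (2 * n + e) = 4 * spread n + e := by
  rw [spread]
  split_ifs with h
  · obtain ⟨rfl, rfl⟩ : n = 0 ∧ e = 0 := by omega
    simp
  · rw [show (2 * n + e) / 2 = n by omega, show (2 * n + e) % 2 = e by omega]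

lemma wt_four_mul (n : ℕ) : wt (4 * n) = 2 * wt n := wt_four_mul_add n (by norm_num : 0 < 4)
lemma hi_four_mul (n : ℕ) : hi (4 * n) = 2 * hi n := hi_four_mul_add n (by norm_num : 0 < 4)

lemma wt_of_lt {e : ℕ} (he : e < 4) : wt e = e := by
  simpa using wt_four_mul_add 0 he

@[simp] lemma spread_one : spread 1 = 1 := by simpa using spread_two_mul_add 0 (e := 1) (by norm_num)

lemma wt_mod_two (n : ℕ) : wt n % 2 = n % 2 := by
  obtain ⟨m, e, he, rfl⟩ : ∃ m e, e < 4 ∧ n = 4 * m + e := ⟨n / 4, n % 4, by omega, by omega⟩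
  rw [wt_four_mul_add m he]
  omega

/-- `wt` is subadditive, and when it is additive, no digit exceeding `1` is lost. -/
lemma wt_hi_add (m n : ℕ) :
    wt (m + n) ≤ wt m + wt n ∧ (wt (m + n) = wt m + wt n → hi m + hi n ≤ hi (m + n)) := by
  induction hk : m + n using Nat.strong_induction_on generalizing m n with
  | _ k ih =>
    obtain ⟨m, e, he, rfl⟩ : ∃ r e, e < 4 ∧ m = 4 * r + e := ⟨m / 4, m % 4, by omega, by omega⟩
    obtain ⟨n, f, hf, rfl⟩ : ∃ r e, e < 4 ∧ n = 4 * r + e := ⟨n / 4, n % 4, by omega, by omega⟩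
    subst hk
    rcases Nat.lt_or_ge (e + f) 4 with h | h
    · rw [show 4 * m + e + (4 * n + f) = 4 * (m + n) + (e + f) by ring, wt_four_mul_add _ h,
        wt_four_mul_add _ he, wt_four_mul_add _ hf, hi_four_mul_add _ h, hi_four_mul_add _ he,
        hi_four_mul_add _ hf]
      rcases Nat.eq_zero_or_pos (m + n) with h0 | h0
      · obtain ⟨rfl, rfl⟩ : m = 0 ∧ n = 0 := by omega
        simp only [add_zero, wt_zero, hi_zero]
        omega
      · obtain ⟨h1, h2⟩ := ih (m + n) (by omega) m n rfl
        refine ⟨by omega, fun h3 => ?_⟩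
        have := h2 (by omega)
        omega
    · have e1 : 4 * m + e + (4 * n + f) = 4 * (m + (n + 1)) + (e + f - 4) := by omega
      rw [e1, wt_four_mul_add _ (by omega : e + f - 4 < 4), wt_four_mul_add _ he,
        wt_four_mul_add _ hf]
      have h1 := (ih (m + (n + 1)) (by omega) m (n + 1) rfl).1
      have h2 : wt (n + 1) ≤ wt n + 1 := by
        have := (ih (n + 1) (by omega) n 1 rfl).1
        rwa [wt_of_lt (by norm_num : 1 < 4)] at this
      refine ⟨by omega, fun h3 => ?_⟩
      omega

lemma wt_add_le (m n : ℕ) : wt (m + n) ≤ wt m + wt n := (wt_hi_add m n).1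

/-- The number with base `4` digits `2 aᵢ + bᵢ`. -/
def interleave (a b : ℕ) : ℕ := 2 * spread a + spread b

lemma interleave_two_mul_add (a b : ℕ) {x y : ℕ} (hx : x < 2) (hy : y < 2) :
    interleave (2 * a + x) (2 * b + y) = 4 * interleave a b + (2 * x + y) := by
  rw [interleave, interleave, spread_two_mul_add a hx, spread_two_mul_add b hy]
  ring

lemma wt_hi_interleave (a b : ℕ) :
    wt (interleave a b) = 2 * a + b ∧ hi (interleave a b) = a := by
  induction hn : a + b using Nat.strong_induction_on generalizing a b with
  | _ n ih =>
    rcases Nat.eq_zero_or_pos n with h0 | h0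
    · obtain ⟨rfl, rfl⟩ : a = 0 ∧ b = 0 := by omega
      simp [interleave]
    · obtain ⟨a, x, hx, rfl⟩ : ∃ r e, e < 2 ∧ a = 2 * r + e := ⟨a / 2, a % 2, by omega, by omega⟩
      obtain ⟨b, y, hy, rfl⟩ : ∃ r e, e < 2 ∧ b = 2 * r + e := ⟨b / 2, b % 2, by omega, by omega⟩
      obtain ⟨h1, h2⟩ := ih (a + b) (by omega) a b rfl
      rw [interleave_two_mul_add a b hx hy, wt_four_mul_add _ (by omega),
        hi_four_mul_add _ (by omega), h1, h2]
      omega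

lemma exists_interleave (n : ℕ) : ∃ a b, n = interleave a b := by
  induction n using Nat.strong_induction_on with
  | _ n ih =>
    rcases Nat.eq_zero_or_pos n with h0 | h0
    · exact ⟨0, 0, by simp [interleave, h0]⟩
    · obtain ⟨a, b, h⟩ := ih (n / 4) (by omega)
      refine ⟨2 * a + n % 4 / 2, 2 * b + n % 2, ?_⟩
      rw [interleave_two_mul_add a b (by omega) (by omega), ← h]
      omega

/-- The odd number with code `(a, b)`. -/
def code (a b : ℕ) : ℕ := 1 + 2 * spread a + 4 * spread b

lemma code_eq (a b : ℕ) {x : ℕ} (hx : x < 2) :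
    code (2 * a + x) b = 4 * interleave a b + (1 + 2 * x) := by
  rw [code, interleave, spread_two_mul_add a hx]
  ring

/-- The base-4 digits are `2 aᵢ + bᵢ₋₁` in terms of binary digits, with the constant 1 playing the
part of `b₋₁`. -/
lemma wt_hi_code (a b : ℕ) : wt (code a b) = 1 + 2 * a + 2 * b ∧ hi (code a b) = a := by
  obtain ⟨a, x, hx, rfl⟩ : ∃ r e, e < 2 ∧ a = 2 * r + e := ⟨a / 2, a % 2, by omega, by omega⟩
  obtain ⟨h1, h2⟩ := wt_hi_interleave a b
  rw [code_eq a b hx, wt_four_mul_add _ (by omega), hi_four_mul_add _ (by omega), h1, h2]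
  omega

lemma wt_code (a b : ℕ) : wt (code a b) = 1 + 2 * a + 2 * b := (wt_hi_code a b).1
lemma hi_code (a b : ℕ) : hi (code a b) = a := (wt_hi_code a b).2

lemma code_mod_two (a b : ℕ) : code a b % 2 = 1 := by rw [code]; omega

lemma exists_code {k : ℕ} (hk : k % 2 = 1) : ∃ a b, k = code a b := by
  obtain ⟨a, b, h⟩ := exists_interleave (k / 4)
  refine ⟨2 * a + k % 4 / 2, b, ?_⟩
  rw [code_eq a b (by omega), ← h]
  omega

lemma wt_two_mul_spread (a : ℕ) : wt (2 * spread a) = 2 * a := by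
  simpa [interleave] using (wt_hi_interleave a 0).1

lemma hi_two_mul_spread (a : ℕ) : hi (2 * spread a) = a := by
  simpa [interleave] using (wt_hi_interleave a 0).2

lemma spread_add_two_pow (i : ℕ) : ∀ {a : ℕ}, a < 2 ^ i → spread (2 ^ i + a) = 4 ^ i + spread a := by
  induction i with
  | zero =>
    intro a ha
    obtain rfl : a = 0 := by simpa using ha
    simp
  | succ i ih =>
    intro a ha
    obtain ⟨a, x, hx, rfl⟩ : ∃ r e, e < 2 ∧ a = 2 * r + e := ⟨a / 2, a % 2, by omega, by omega⟩
    rw [pow_succ] at ha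
    rw [pow_succ, show 2 ^ i * 2 + (2 * a + x) = 2 * (2 ^ i + a) + x by ring,
      spread_two_mul_add _ hx, ih (by omega), spread_two_mul_add _ hx]
    ring

lemma wt_four_pow_mul (i n : ℕ) : wt (4 ^ i * n) = 2 ^ i * wt n := by
  induction i with
  | zero => simp
  | succ i ih => rw [pow_succ', mul_assoc, wt_four_mul, ih]; ring

/-- Adding a new top binary digit causes no carry in base 4. This is what allows inductions on
exponents to strip the top digit without losing weight. -/
lemma wt_two_pow_add (i : ℕ) : ∀ {j : ℕ}, j < 2 ^ i → wt (2 ^ i + j) = wt (2 ^ i) + wt j := by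
  induction i using Nat.strong_induction_on with
  | _ i ih =>
    intro j hj
    match i with
    | 0 =>
      obtain rfl : j = 0 := by simpa using hj
      simp
    | 1 =>
      rw [wt_of_lt (by omega : 2 ^ 1 + j < 4), wt_of_lt (by omega : 2 ^ 1 < 4),
        wt_of_lt (by omega : j < 4)]
    | i + 2 =>
      obtain ⟨j, x, hx, rfl⟩ : ∃ r e, e < 4 ∧ j = 4 * r + e := ⟨j / 4, j % 4, by omega, by omega⟩
      rw [pow_add] at hj
      have h := ih i (by omega) (j := j) (by omega)
      rw [show 2 ^ (i + 2) + (4 * j + x) = 4 * (2 ^ i + j) + x by ring, wt_four_mul_add _ hx, h,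
        show 2 ^ (i + 2) = 4 * 2 ^ i by ring, wt_four_mul, wt_four_mul_add _ hx]
      ring

/-- Polynomials with exponents of weight at most `n - c`, with equality only for exponents `l` with
`s ≤ hi l`. -/
def wtFil (s c n : ℕ) : Submodule (ZMod 2) (ZMod 2)[X] where
  carrier := {f | ∀ l ∈ f.support, wt l + c ≤ n ∧ (wt l + c = n → s ≤ hi l)}
  add_mem' {f g} hf hg l hl := by
    rcases Finset.mem_union.mp (support_add hl) with h | h
    · exact hf l h
    · exact hg l h
  zero_mem' := by simp
  smul_mem' c f hf l hl := hf l (support_smul c f hl)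

lemma X_pow_mem_wtFil {s c n l : ℕ} (h : wt l + c ≤ n ∧ (wt l + c = n → s ≤ hi l)) :
    (X ^ l : (ZMod 2)[X]) ∈ wtFil s c n := by
  intro m hm
  rw [mem_support_iff, coeff_X_pow] at hm
  obtain rfl : m = l := by by_contra h'; exact hm (if_neg h')
  exact h

lemma X_pow_mem_wtFil_self (l : ℕ) : (X ^ l : (ZMod 2)[X]) ∈ wtFil (hi l) 0 (wt l) :=
  X_pow_mem_wtFil ⟨le_rfl, fun _ => le_rfl⟩

lemma wtFil_mono {s c n s' c' n' : ℕ} (h : c' + n ≤ c + n') (hs : c' + n = c + n' → s' ≤ s) :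
    wtFil s c n ≤ wtFil s' c' n' := fun f hf l hl => by
  obtain ⟨h1, h2⟩ := hf l hl
  exact ⟨by omega, fun h3 => (hs (by omega)).trans (h2 (by omega))⟩

/-- A product monomial of extremal weight comes from extremal factors added without loss, and then
the lower bounds on `hi` add up by `wt_hi_add`. -/
lemma mul_mem_wtFil {s c n s' c' n' : ℕ} {f g : (ZMod 2)[X]} (hf : f ∈ wtFil s c n)
    (hg : g ∈ wtFil s' c' n') : f * g ∈ wtFil (s + s') (c + c') (n + n') := by
  intro l hl
  rw [mem_support_iff, coeff_mul] at hl
  obtain ⟨⟨i, j⟩, hij, hne⟩ := Finset.exists_ne_zero_of_sum_ne_zero hl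
  obtain rfl : i + j = l := by simpa using hij
  have hi' : i ∈ f.support := mem_support_iff.mpr (left_ne_zero_of_mul hne)
  have hj : j ∈ g.support := mem_support_iff.mpr (right_ne_zero_of_mul hne)
  obtain ⟨h1, h2⟩ := hf i hi'
  obtain ⟨h3, h4⟩ := hg j hj
  obtain ⟨h5, h6⟩ := wt_hi_add i j
  refine ⟨by omega, fun h7 => ?_⟩
  have := h2 (by omega)
  have := h4 (by omega)
  have := h6 (by omega)
  omega

lemma map_mem_of_support {V : Submodule (ZMod 2) (ZMod 2)[X]}
    (L : (ZMod 2)[X] →ₗ[ZMod 2] (ZMod 2)[X]) (f : (ZMod 2)[X])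
    (h : ∀ l ∈ f.support, L (X ^ l) ∈ V) : L f ∈ V := by
  rw [f.as_sum_support_C_mul_X_pow, map_sum]
  refine Submodule.sum_mem _ fun l hl => ?_
  rw [C_mul', map_smul]
  exact Submodule.smul_mem _ _ (h l hl)

end
end HeckeModTwo

/-! ### Recurrences with step a power of 2 -/

namespace HeckeModTwo
section
open Polynomial

lemma two_eq_zero_polynomial : (2 : (ZMod 2)[X]) = 0 := CharTwo.two_eq_zero

lemma X_pow_two_mul (q : ℕ) : (X ^ (2 * q) : (ZMod 2)[X]) = (X ^ q) ^ 2 := by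
  rw [mul_comm, pow_mul]

/-- In characteristic 2, squaring the characteristic polynomial `x⁴ + a x + a⁴` gives the same
polynomial in `x²` and `a²`, so the step doubles. -/
lemma T3_recurrence_two_pow (r n : ℕ) : T3 (X ^ (n + 4 * 2 ^ r)) =
    X ^ 2 ^ r * T3 (X ^ (n + 1 * 2 ^ r)) + (X ^ 2 ^ r) ^ 4 * T3 (X ^ n) := by
  induction r generalizing n with
  | zero =>
    have := T3_recurrence (X ^ n)
    simpa [pow_add, mul_comm] using this
  | succ r ih =>
    have h0 := ih n
    have h1 := ih (n + 1 * 2 ^ r)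
    have h4 := ih (n + 4 * 2 ^ r)
    rw [pow_succ']
    simp only [add_assoc n, ← add_mul, ← mul_assoc, Nat.reduceAdd, Nat.reduceMul] at h0 h1 h4 ⊢
    rw [X_pow_two_mul]
    linear_combination h4 + X ^ 2 ^ r * h1 + (X ^ 2 ^ r) ^ 4 * h0 +
      (X ^ 2 ^ r) ^ 5 * T3 (X ^ (n + 1 * 2 ^ r)) * two_eq_zero_polynomial

/-- The recurrence satisfied by the Hecke operator `T₅`. -/
def Recurrence (L : (ZMod 2)[X] →ₗ[ZMod 2] (ZMod 2)[X]) : Prop :=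
  ∀ f, L (X ^ 6 * f) =
    X ^ 2 * L (X ^ 4 * f) + X ^ 4 * L (X ^ 2 * f) + X * L (X * f) + X ^ 6 * L f

/-- This is the Frobenius square of the characteristic polynomial `P = x⁶ + a² x⁴ + a⁴ x² + a x +
a⁶`. -/
lemma sequence_recurrence_double {R : Type*} [CommRing R] (two : (2 : R) = 0) {g : ℕ → R} {a : R}
    {q : ℕ} (h : ∀ n, g (n + 6 * q) = a ^ 2 * g (n + 4 * q) + a ^ 4 * g (n + 2 * q) +
      a * g (n + 1 * q) + a ^ 6 * g n) (n : ℕ) :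
    g (n + 12 * q) = a ^ 4 * g (n + 8 * q) + a ^ 8 * g (n + 4 * q) + a ^ 2 * g (n + 2 * q) +
      a ^ 12 * g n := by
  have h0 := h n
  have h1 := h (n + 1 * q)
  have h2 := h (n + 2 * q)
  have h4 := h (n + 4 * q)
  have h6 := h (n + 6 * q)
  simp only [add_assoc n, ← add_mul, Nat.reduceAdd] at h0 h1 h2 h4 h6
  linear_combination h6 + a ^ 2 * h4 + a ^ 4 * h2 + a * h1 + a ^ 6 * h0 +
    (a ^ 6 * g (n + 6 * q) + a ^ 3 * g (n + 5 * q) + a ^ 8 * g (n + 4 * q) +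
      a ^ 5 * g (n + 3 * q) + a ^ 10 * g (n + 2 * q) + a ^ 7 * g (n + 1 * q)) * two

/-- Multiplying `P` by `x² + a²` cancels its middle terms and leaves `x⁸ + a x³ + a³ x + a⁸`, which
can strip a single binary digit. -/
lemma sequence_recurrence_eight {R : Type*} [CommRing R] (two : (2 : R) = 0) {g : ℕ → R} {a : R}
    {q : ℕ} (h : ∀ n, g (n + 6 * q) = a ^ 2 * g (n + 4 * q) + a ^ 4 * g (n + 2 * q) +
      a * g (n + 1 * q) + a ^ 6 * g n) (n : ℕ) :
    g (n + 8 * q) = a ^ 3 * g (n + 1 * q) + a * g (n + 3 * q) + a ^ 8 * g n := by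
  have h0 := h n
  have h2 := h (n + 2 * q)
  simp only [add_assoc n, ← add_mul, Nat.reduceAdd] at h0 h2
  linear_combination h2 + a ^ 2 * h0 + (a ^ 4 * g (n + 4 * q) + a ^ 6 * g (n + 2 * q)) * two

/-- The square of the eight-step relation reads `x¹⁶ = a² x⁶ + a⁶ x² + a¹⁶`; its term in `x⁶` is
then reduced by `P`. -/
lemma sequence_recurrence_sixteen {R : Type*} [CommRing R] (two : (2 : R) = 0) {g : ℕ → R}
    {a : R} {q : ℕ} (h : ∀ n, g (n + 6 * q) = a ^ 2 * g (n + 4 * q) + a ^ 4 * g (n + 2 * q) +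
      a * g (n + 1 * q) + a ^ 6 * g n) (n : ℕ) :
    g (n + 16 * q) = (a ^ 16 + a ^ 8) * g n + a ^ 3 * g (n + 1 * q) + a ^ 4 * g (n + 4 * q) := by
  have h0 := h n
  have k0 := sequence_recurrence_eight two h n
  have k1 := sequence_recurrence_eight two h (n + 1 * q)
  have k3 := sequence_recurrence_eight two h (n + 3 * q)
  have k8 := sequence_recurrence_eight two h (n + 8 * q)
  simp only [add_assoc n, ← add_mul, Nat.reduceAdd] at h0 k0 k1 k3 k8
  linear_combination k8 + a * k3 + a ^ 3 * k1 + a ^ 8 * k0 + a ^ 2 * h0 +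
    (a ^ 4 * g (n + 4 * q) + a ^ 6 * g (n + 2 * q) + a ^ 9 * g (n + 3 * q) +
      a ^ 11 * g (n + 1 * q)) * two

lemma Recurrence.two_pow {L : (ZMod 2)[X] →ₗ[ZMod 2] (ZMod 2)[X]} (hL : Recurrence L) (r n : ℕ) :
    L (X ^ (n + 6 * 2 ^ r)) = (X ^ 2 ^ r) ^ 2 * L (X ^ (n + 4 * 2 ^ r)) +
      (X ^ 2 ^ r) ^ 4 * L (X ^ (n + 2 * 2 ^ r)) + X ^ 2 ^ r * L (X ^ (n + 1 * 2 ^ r)) +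
      (X ^ 2 ^ r) ^ 6 * L (X ^ n) := by
  induction r generalizing n with
  | zero =>
    have := hL (X ^ n)
    simpa [pow_add, mul_comm] using this
  | succ r ih =>
    have h := sequence_recurrence_double two_eq_zero_polynomial (g := fun n => L (X ^ n)) ih n
    rw [pow_succ']
    simp only [← mul_assoc, Nat.reduceMul]
    rw [X_pow_two_mul]
    linear_combination h

lemma Recurrence.eight {L : (ZMod 2)[X] →ₗ[ZMod 2] (ZMod 2)[X]} (hL : Recurrence L) (r n : ℕ) :
    L (X ^ (n + 8 * 2 ^ r)) = (X ^ 2 ^ r) ^ 3 * L (X ^ (n + 1 * 2 ^ r)) +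
      X ^ 2 ^ r * L (X ^ (n + 3 * 2 ^ r)) + (X ^ 2 ^ r) ^ 8 * L (X ^ n) :=
  sequence_recurrence_eight two_eq_zero_polynomial (g := fun n => L (X ^ n)) (hL.two_pow r) n

lemma Recurrence.sixteen {L : (ZMod 2)[X] →ₗ[ZMod 2] (ZMod 2)[X]} (hL : Recurrence L)
    (r n : ℕ) : L (X ^ (n + 16 * 2 ^ r)) = ((X ^ 2 ^ r) ^ 16 + (X ^ 2 ^ r) ^ 8) * L (X ^ n) +
      (X ^ 2 ^ r) ^ 3 * L (X ^ (n + 1 * 2 ^ r)) +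
      (X ^ 2 ^ r) ^ 4 * L (X ^ (n + 4 * 2 ^ r)) :=
  sequence_recurrence_sixteen two_eq_zero_polynomial (g := fun n => L (X ^ n)) (hL.two_pow r) n

end
end HeckeModTwo

/-! ### `T₃` and `T₅` lower the weight by 2 -/

namespace HeckeModTwo
section
open Polynomial

lemma mul_mem_wtFil_of {s c n s' c' n' : ℕ} (s'' c'' n'' : ℕ) {f g : (ZMod 2)[X]}
    (hf : f ∈ wtFil s c n) (hg : g ∈ wtFil s' c' n') (h : c'' + (n + n') ≤ c + c' + n'')
    (hs : c'' + (n + n') = c + c' + n'' → s'' ≤ s + s') : f * g ∈ wtFil s'' c'' n'' :=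
  wtFil_mono h hs (mul_mem_wtFil hf hg)

lemma wt_mul_two_pow (i m : ℕ) : wt (m * 2 ^ (2 * i)) = 2 ^ i * wt m := by
  rw [pow_mul, mul_comm, show 2 ^ 2 = 4 from rfl, wt_four_pow_mul]

lemma hi_mul_two_pow (i m : ℕ) : hi (m * 2 ^ (2 * i)) = 2 ^ i * hi m := by
  induction i with
  | zero => simp
  | succ i ih =>
    rw [show m * 2 ^ (2 * (i + 1)) = 4 * (m * 2 ^ (2 * i)) by ring, hi_four_mul, ih]
    ring

lemma X_two_pow_pow_mem (i m : ℕ) :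
    ((X ^ 2 ^ (2 * i)) ^ m : (ZMod 2)[X]) ∈ wtFil (2 ^ i * hi m) 0 (2 ^ i * wt m) := by
  rw [← pow_mul, mul_comm (2 ^ (2 * i)) m, ← hi_mul_two_pow, ← wt_mul_two_pow]
  exact X_pow_mem_wtFil_self _

lemma wt_add_mul_two_pow_le (j i m : ℕ) : wt (j + m * 2 ^ (2 * i)) ≤ wt j + 2 ^ i * wt m := by
  rw [← wt_mul_two_pow]
  exact wt_add_le _ _

lemma exists_two_pow_add {n : ℕ} (hn : n ≠ 0) : ∃ i j, j < 2 ^ i ∧ n = 2 ^ i + j := by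
  refine ⟨Nat.log 2 n, n - 2 ^ Nat.log 2 n, ?_, ?_⟩
  · have := Nat.lt_pow_succ_log_self (b := 2) (by norm_num) n
    rw [pow_succ] at this
    have := Nat.pow_log_le_self 2 hn
    omega
  · have := Nat.pow_log_le_self 2 hn
    omega

@[simp] lemma wt_one : wt 1 = 1 := wt_of_lt (by norm_num)
@[simp] lemma wt_two : wt 2 = 2 := wt_of_lt (by norm_num)
@[simp] lemma wt_three : wt 3 = 3 := wt_of_lt (by norm_num)
@[simp] lemma wt_four : wt 4 = 2 := by simp [wt]
@[simp] lemma wt_five : wt 5 = 3 := by simp [wt]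
@[simp] lemma wt_seven : wt 7 = 5 := by simp [wt]
@[simp] lemma wt_eight : wt 8 = 4 := by simp [wt]
@[simp] lemma wt_sixteen : wt 16 = 4 := by simp [wt]
@[simp] lemma hi_three : hi 3 = 1 := by simp [hi]
@[simp] lemma hi_eight : hi 8 = 2 := by simp [hi]

/-- The eight- and sixteen-step relations are homogeneous for the weight: in each term the weights
of the power of `a` and of the shift sum to 4, the weight of 8 and of 16. Stripping the top digit of
`k` thus propagates a weight drop from `k < 8`. -/
lemma Recurrence.mem_wtFil {L : (ZMod 2)[X] →ₗ[ZMod 2] (ZMod 2)[X]} (hL : Recurrence L) {c : ℕ}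
    (h : ∀ k < 8, L (X ^ k) ∈ wtFil 0 c (wt k)) (k : ℕ) : L (X ^ k) ∈ wtFil 0 c (wt k) := by
  induction k using Nat.strong_induction_on with
  | _ k ih =>
    rcases Nat.lt_or_ge k 8 with hk | hk
    · exact h k hk
    obtain ⟨s, j, hj, rfl⟩ := exists_two_pow_add (by omega : k ≠ 0)
    have hs : 3 ≤ s := by
      by_contra hs
      have : 2 ^ s ≤ 2 ^ 2 := Nat.pow_le_pow_right (by norm_num) (by omega)
      omega
    -- The scaling factor must be a power of 4 for weights to scale, so the top digit is `16 * 4 ^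
    -- i` or `8 * 4 ^ i` according to the parity of `s`.
    rcases Nat.even_or_odd' s with ⟨i, rfl | rfl⟩
    · obtain ⟨i, rfl⟩ : ∃ i', i = i' + 2 := ⟨i - 2, by omega⟩
      have e : 2 ^ (2 * (i + 2)) = 16 * 2 ^ (2 * i) := by ring
      have hw := wt_two_pow_add _ hj
      rw [e, wt_mul_two_pow, wt_sixteen] at hw
      rw [e] at hj ih ⊢
      rw [hw, add_comm _ j, hL.sixteen]
      have hq : 0 < 2 ^ (2 * i) := by positivity
      have i0 := ih j (by omega)
      have i1 := ih (j + 1 * 2 ^ (2 * i)) (by omega)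
      have i4 := ih (j + 4 * 2 ^ (2 * i)) (by omega)
      have b1 := wt_add_mul_two_pow_le j i 1
      have b4 := wt_add_mul_two_pow_le j i 4
      rw [wt_one] at b1
      rw [wt_four] at b4
      have m16 := X_two_pow_pow_mem i 16
      have m8 := X_two_pow_pow_mem i 8
      have m3 := X_two_pow_pow_mem i 3
      have m4 := X_two_pow_pow_mem i 4
      rw [wt_sixteen] at m16
      rw [wt_eight] at m8
      rw [wt_three] at m3
      rw [wt_four] at m4
      rw [add_mul]
      refine add_mem (add_mem (add_mem ?_ ?_) ?_) ?_
      · exact mul_mem_wtFil_of _ _ _ m16 i0 (by omega) (by omega)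
      · exact mul_mem_wtFil_of _ _ _ m8 i0 (by omega) (by omega)
      · exact mul_mem_wtFil_of _ _ _ m3 i1 (by omega) (by omega)
      · exact mul_mem_wtFil_of _ _ _ m4 i4 (by omega) (by omega)
    · obtain ⟨i, rfl⟩ : ∃ i', i = i' + 1 := ⟨i - 1, by omega⟩
      have e : 2 ^ (2 * (i + 1) + 1) = 8 * 2 ^ (2 * i) := by ring
      have hw := wt_two_pow_add _ hj
      rw [e, wt_mul_two_pow, wt_eight] at hw
      rw [e] at hj ih ⊢
      rw [hw, add_comm _ j, hL.eight]
      have hq : 0 < 2 ^ (2 * i) := by positivity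
      have i0 := ih j (by omega)
      have i1 := ih (j + 1 * 2 ^ (2 * i)) (by omega)
      have i3 := ih (j + 3 * 2 ^ (2 * i)) (by omega)
      have b1 := wt_add_mul_two_pow_le j i 1
      have b3 := wt_add_mul_two_pow_le j i 3
      rw [wt_one] at b1
      rw [wt_three] at b3
      have m8 := X_two_pow_pow_mem i 8
      have m3 := X_two_pow_pow_mem i 3
      have m1 := X_two_pow_pow_mem i 1
      rw [wt_eight] at m8
      rw [wt_three] at m3
      rw [wt_one, pow_one] at m1
      refine add_mem (add_mem ?_ ?_) ?_
      · exact mul_mem_wtFil_of _ _ _ m3 i1 (by omega) (by omega)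
      · exact mul_mem_wtFil_of _ _ _ m1 i3 (by omega) (by omega)
      · exact mul_mem_wtFil_of _ _ _ m8 i0 (by omega) (by omega)

lemma T5_X_pow_mem_wtFil (k : ℕ) : T5 (X ^ k) ∈ wtFil 0 2 (wt k) := by
  refine Recurrence.mem_wtFil T5_recurrence (fun k hk => ?_) k
  interval_cases k
  · rw [pow_zero, T5_one]; exact zero_mem _
  · rw [pow_one, T5_X]; exact zero_mem _
  · rw [T5_X_sq]; exact zero_mem _
  · rw [T5_X_pow_three]; exact zero_mem _
  · rw [T5_X_pow_four]; exact zero_mem _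
  · rw [T5_X_pow_five, ← pow_one X]; exact X_pow_mem_wtFil (by simp)
  · rw [T5_X_pow_six]; exact zero_mem _
  · rw [T5_X_pow_seven]; exact X_pow_mem_wtFil (by simp)

/-- The failure of `T₅` to commute with the multiplication by `X ^ 2`. -/
noncomputable def sqDefect : (ZMod 2)[X] →ₗ[ZMod 2] (ZMod 2)[X] :=
  T5 ∘ₗ LinearMap.mulLeft (ZMod 2) (X ^ 2) + LinearMap.mulLeft (ZMod 2) (X ^ 2) ∘ₗ T5

lemma sqDefect_apply (f : (ZMod 2)[X]) : sqDefect f = T5 (X ^ 2 * f) + X ^ 2 * T5 f := rfl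

/-- Multiplication by `X ^ 2` commutes with the coefficients of the recurrence, so the defect
inherits it, and its weight bound follows from values at `k < 8`. -/
lemma sqDefect_recurrence : Recurrence sqDefect := by
  intro f
  have h1 := T5_recurrence (X ^ 2 * f)
  have h2 := T5_recurrence f
  simp only [sqDefect_apply]
  rw [mul_left_comm (X ^ 2) (X ^ 6), mul_left_comm (X ^ 2) (X ^ 4), mul_left_comm (X ^ 2) X, h1,
    h2]
  ring

lemma sqDefect_X_pow_mem_wtFil (k : ℕ) : sqDefect (X ^ k) ∈ wtFil 0 1 (wt k) := by
  refine Recurrence.mem_wtFil sqDefect_recurrence (fun k hk => ?_) k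
  rw [sqDefect_apply, ← pow_add]
  interval_cases k
  · rw [pow_zero, T5_one, T5_X_sq]; simp
  · rw [pow_one, T5_X, T5_X_pow_three]; simp
  · rw [T5_X_sq, T5_X_pow_four]; simp
  · rw [T5_X_pow_three, T5_X_pow_five, mul_zero, add_zero, ← pow_one X]
    exact X_pow_mem_wtFil (by simp)
  · rw [T5_X_pow_four, T5_X_pow_six]; simp
  · rw [T5_X_pow_five, T5_X_pow_seven, ← pow_succ, CharTwo.add_self_eq_zero]; exact zero_mem _
  · rw [T5_X_pow_six, T5_X_pow_eight]; simp
  · rw [T5_X_pow_seven, T5_X_pow_nine, zero_add, ← pow_add]; exact X_pow_mem_wtFil (by simp)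

/-- The bound is one unit better than the drop by 2 that each summand has. The eight-step relation
writes the defect at level `i + 1` as `X ^ 4 ^ i` times the defect at level `i`, evaluated at `k + 4
^ i`. -/
lemma T5_defect_mem (i k : ℕ) : T5 (X ^ (k + 2 * 2 ^ (2 * i))) +
    (X ^ 2 ^ (2 * i)) ^ 2 * T5 (X ^ k) ∈ wtFil 0 3 (wt k + 2 * 2 ^ i) := by
  induction i generalizing k with
  | zero =>
    have := sqDefect_X_pow_mem_wtFil k
    rw [sqDefect_apply, ← pow_add, add_comm 2 k] at this
    refine wtFil_mono (s := 0) (c := 1) (n := wt k) (by omega) (by omega) (by simpa using this)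
  | succ i ih =>
    have h0 := Recurrence.two_pow T5_recurrence (2 * i) k
    have h2 := Recurrence.two_pow T5_recurrence (2 * i) (k + 2 * 2 ^ (2 * i))
    have e : T5 (X ^ (k + 2 * 2 ^ (2 * (i + 1)))) + (X ^ 2 ^ (2 * (i + 1))) ^ 2 * T5 (X ^ k) =
        X ^ 2 ^ (2 * i) * (T5 (X ^ (k + 1 * 2 ^ (2 * i) + 2 * 2 ^ (2 * i))) +
          (X ^ 2 ^ (2 * i)) ^ 2 * T5 (X ^ (k + 1 * 2 ^ (2 * i)))) := by
      have e1 : 2 ^ (2 * (i + 1)) = 4 * 2 ^ (2 * i) := by ring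
      have e2 : (X ^ (4 * 2 ^ (2 * i)) : (ZMod 2)[X]) = (X ^ 2 ^ (2 * i)) ^ 4 := by
        rw [mul_comm, pow_mul]
      rw [e1, e2]
      simp only [add_assoc k, ← add_mul, ← mul_assoc, Nat.reduceAdd, Nat.reduceMul] at h0 h2 ⊢
      have h := Recurrence.eight T5_recurrence (2 * i) k
      linear_combination h + (X ^ 2 ^ (2 * i)) ^ 8 * T5 (X ^ k) * two_eq_zero_polynomial
    rw [e]
    have := wt_add_mul_two_pow_le k i 1
    rw [wt_one] at this
    have m1 := X_two_pow_pow_mem i 1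
    rw [wt_one, pow_one] at m1
    exact mul_mem_wtFil_of _ _ _ m1 (ih (k + 1 * 2 ^ (2 * i))) (by rw [pow_succ]; omega) (by omega)

/-- Up to terms of small weight, `T₅` commutes with the multiplication by `X ^ (2 * spread a)`. -/
lemma T5_defect_spread_mem (a k : ℕ) : T5 (X ^ (k + 2 * spread a)) +
    X ^ (2 * spread a) * T5 (X ^ k) ∈ wtFil 0 3 (wt k + 2 * a) := by
  induction a using Nat.strong_induction_on with
  | _ a ih =>
    rcases eq_or_ne a 0 with rfl | ha
    · simp [CharTwo.add_self_eq_zero]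
    obtain ⟨i, b, hb, rfl⟩ := exists_two_pow_add ha
    have h1 := ih b (by have : 0 < 2 ^ i := by positivity
                        omega)
    have h2 := T5_defect_mem i (k + 2 * spread b)
    have hw := wt_add_le k (2 * spread b)
    rw [wt_two_mul_spread] at hw
    have m2 := X_two_pow_pow_mem i 2
    rw [wt_two] at m2
    have h3 := mul_mem_wtFil_of 0 3 (wt k + 2 * (2 ^ i + b)) m2 h1 (by omega) (by omega)
    have h4 : _ ∈ wtFil 0 3 (wt k + 2 * (2 ^ i + b)) := wtFil_mono (by omega) (by omega) h2
    have h5 := add_mem h3 h4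
    have e1 : spread (2 ^ i + b) = 2 ^ (2 * i) + spread b := by
      rw [spread_add_two_pow i hb, pow_mul]; norm_num
    have e2 : k + 2 * spread (2 ^ i + b) = k + 2 * spread b + 2 * 2 ^ (2 * i) := by
      rw [e1]; ring
    have e3 : (X ^ (2 * spread (2 ^ i + b)) : (ZMod 2)[X]) =
        (X ^ 2 ^ (2 * i)) ^ 2 * X ^ (2 * spread b) := by
      rw [← pow_mul, ← pow_add, e1]; ring_nf
    rw [e2, e3]
    convert h5 using 1
    linear_combination -(X ^ 2 ^ (2 * i)) ^ 2 * T5 (X ^ (k + 2 * spread b)) *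
      two_eq_zero_polynomial

lemma T3_X_pow_mem_wtFil (k : ℕ) : T3 (X ^ k) ∈ wtFil 0 2 (wt k) := by
  induction k using Nat.strong_induction_on with
  | _ k ih =>
    rcases Nat.lt_or_ge k 4 with hk | hk
    · interval_cases k
      · rw [pow_zero, T3_one]; exact zero_mem _
      · rw [pow_one, T3_X]; exact zero_mem _
      · rw [T3_X_sq]; exact zero_mem _
      · rw [T3_X_pow_three, ← pow_one X]; exact X_pow_mem_wtFil (by simp)
    obtain ⟨s, j, hj, rfl⟩ := exists_two_pow_add (by omega : k ≠ 0)
    have hs : 2 ≤ s := by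
      by_contra hs
      have : 2 ^ s ≤ 2 ^ 1 := Nat.pow_le_pow_right (by norm_num) (by omega)
      omega
    obtain ⟨r, rfl⟩ : ∃ r, s = r + 2 := ⟨s - 2, by omega⟩
    have e : 2 ^ (r + 2) = 4 * 2 ^ r := by ring
    have hw := wt_two_pow_add _ hj
    rw [e] at hw hj ih ⊢
    rw [wt_four_mul] at hw
    rw [hw, add_comm _ j, T3_recurrence_two_pow]
    have hq : 0 < 2 ^ r := by positivity
    have m1 := X_pow_mem_wtFil_self (2 ^ r)
    have m4 := X_pow_mem_wtFil_self (4 * 2 ^ r)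
    rw [mul_comm 4, pow_mul, mul_comm _ 4, wt_four_mul] at m4
    have := wt_add_le j (1 * 2 ^ r)
    rw [one_mul] at this
    refine add_mem ?_ ?_
    · exact mul_mem_wtFil_of _ _ _ m1 (ih (j + 1 * 2 ^ r) (by omega)) (by rw [one_mul]; omega)
        (by omega)
    · exact mul_mem_wtFil_of _ _ _ m4 (ih j (by omega)) (by omega) (by omega)

end
end HeckeModTwo

/-! ### Leading terms of `T₃` and `T₅` on codes -/

namespace HeckeModTwo
section
open Polynomial

lemma code_zero_zero : code 0 0 = 1 := by simp [code]

lemma two_pow_two_mul (i : ℕ) : 2 ^ (2 * i) = 4 ^ i := by rw [pow_mul]; norm_num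

lemma code_two_pow_add {i a : ℕ} (ha : a < 2 ^ i) (b : ℕ) :
    code (2 ^ i + a) b = code a b + 2 * 2 ^ (2 * i) := by
  rw [code, code, spread_add_two_pow i ha, two_pow_two_mul]; ring

lemma code_add_two_pow {i b : ℕ} (hb : b < 2 ^ i) (a : ℕ) :
    code a (2 ^ i + b) = code a b + 4 * 2 ^ (2 * i) := by
  rw [code, code, spread_add_two_pow i hb, two_pow_two_mul]; ring

lemma code_eq_code_zero_add (a b : ℕ) : code a b = code 0 b + 2 * spread a := by
  simp [code]; ring

lemma X_pow_add_mul (k m q : ℕ) : (X ^ (k + m * q) : (ZMod 2)[X]) = (X ^ q) ^ m * X ^ k := by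
  rw [← pow_mul, ← pow_add]; ring_nf

lemma X_pow_code_mem (a b : ℕ) : (X ^ code a b : (ZMod 2)[X]) ∈ wtFil a 0 (1 + 2 * a + 2 * b) := by
  have := X_pow_mem_wtFil_self (code a b)
  rwa [hi_code, wt_code] at this

lemma add_mem_of_add_mem {V : Submodule (ZMod 2) (ZMod 2)[X]} {f g h : (ZMod 2)[X]}
    (h1 : f + g ∈ V) (h2 : g + h ∈ V) : f + h ∈ V := by
  have := add_mem h1 h2
  rwa [show f + g + (g + h) = f + h by linear_combination g * two_eq_zero_polynomial] at this

/-- The top digit of `b + 1` is stripped with the sixteen-step relation. Writing `x = X ^ 4 ^ i`,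
the terms with `x³` and `x⁸` are negligible because these factors have positive `hi`; the leading
term comes from `x¹⁶`, or from `x⁴` when `b + 1` is a power of 2. -/
lemma T5_X_pow_code_zero_succ (b : ℕ) :
    T5 (X ^ code 0 (b + 1)) + X ^ code 0 b ∈ wtFil 1 2 (3 + 2 * b) := by
  induction b using Nat.strong_induction_on with
  | _ b ih =>
    obtain ⟨i, d, hd, hbd⟩ := exists_two_pow_add (by omega : b + 1 ≠ 0)
    rcases i with _ | i
    · obtain ⟨rfl, rfl⟩ : d = 0 ∧ b = 0 := by simp at hd; simp [hd] at hbd; omega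
      have e : code 0 1 = 5 := by simp [code]
      rw [zero_add, e, T5_X_pow_five, code_zero_zero, pow_one, CharTwo.add_self_eq_zero]
      exact zero_mem _
    have hv : 0 < 2 ^ i := by positivity
    have hv' : 2 ^ (i + 1) = 2 ^ i + 2 ^ i := by ring
    have ek : code 0 (b + 1) = code 0 d + 16 * 2 ^ (2 * i) := by
      rw [hbd, code_add_two_pow hd]; ring
    have hrec := Recurrence.sixteen T5_recurrence (2 * i) (code 0 d)
    have m3 := X_two_pow_pow_mem i 3
    have m4 := X_two_pow_pow_mem i 4
    have m8 := X_two_pow_pow_mem i 8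
    have m16 := X_two_pow_pow_mem i 16
    rw [wt_three, hi_three] at m3
    rw [wt_four] at m4
    rw [wt_eight, hi_eight] at m8
    rw [wt_sixteen] at m16
    have b1 := wt_add_mul_two_pow_le (code 0 d) i 1
    rw [wt_one, wt_code] at b1
    have hd0 := T5_X_pow_mem_wtFil (code 0 d)
    rw [wt_code] at hd0
    have t8 : (X ^ 2 ^ (2 * i)) ^ 8 * T5 (X ^ code 0 d) ∈ wtFil 1 2 (3 + 2 * b) :=
      mul_mem_wtFil_of _ _ _ m8 hd0 (by omega) (by omega)
    have t3 : (X ^ 2 ^ (2 * i)) ^ 3 * T5 (X ^ (code 0 d + 1 * 2 ^ (2 * i))) ∈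
        wtFil 1 2 (3 + 2 * b) :=
      mul_mem_wtFil_of _ _ _ m3 (T5_X_pow_mem_wtFil _) (by omega) (by omega)
    suffices h : (X ^ 2 ^ (2 * i)) ^ 16 * T5 (X ^ code 0 d) +
        (X ^ 2 ^ (2 * i)) ^ 4 * T5 (X ^ (code 0 d + 4 * 2 ^ (2 * i))) + X ^ code 0 b ∈
        wtFil 1 2 (3 + 2 * b) by
      have := add_mem (add_mem t8 t3) h
      convert this using 1
      rw [ek, hrec]
      ring
    rcases Nat.eq_zero_or_pos d with rfl | hd1
    · rw [code_zero_zero, pow_one, T5_X, mul_zero, zero_add]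
      have h1 := ih (2 ^ i - 1) (by omega)
      have e1 : code 0 (2 ^ i - 1 + 1) = 1 + 4 * 2 ^ (2 * i) := by
        rw [Nat.sub_add_cancel hv, ← add_zero (2 ^ i), code_add_two_pow hv, code_zero_zero]
      have e2 : code 0 b = code 0 (2 ^ i - 1) + 4 * 2 ^ (2 * i) := by
        rw [← code_add_two_pow (by omega)]; congr 1; omega
      rw [e1] at h1
      rw [e2, X_pow_add_mul (code 0 (2 ^ i - 1)), ← mul_add]
      exact mul_mem_wtFil_of _ _ _ m4 h1 (by omega) (by omega)
    have h1 := ih (d - 1) (by omega)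
    rw [Nat.sub_add_cancel hd1] at h1
    have e1 : code 0 b = code 0 (d - 1) + 16 * 2 ^ (2 * i) := by
      rw [show b = 2 ^ (i + 1) + (d - 1) by omega, code_add_two_pow (by omega)]; ring
    have h2 : (X ^ 2 ^ (2 * i)) ^ 16 * T5 (X ^ code 0 d) + X ^ code 0 b ∈
        wtFil 1 2 (3 + 2 * b) := by
      rw [e1, X_pow_add_mul, ← mul_add]
      exact mul_mem_wtFil_of _ _ _ m16 h1 (by omega) (by omega)
    suffices h3 : (X ^ 2 ^ (2 * i)) ^ 4 * T5 (X ^ (code 0 d + 4 * 2 ^ (2 * i))) ∈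
        wtFil 1 2 (3 + 2 * b) by
      have := add_mem h2 h3
      rwa [add_right_comm] at this
    -- The remaining `x⁴` term is negligible. If digit `i` of `d` is absent, its leading monomial
    -- acquires the factor `x⁸`, whose `hi` is positive; if it is present, adding the digit carries,
    -- and the defect estimate again extracts `x⁸`.
    rcases Nat.lt_or_ge d (2 ^ i) with hd2 | hd2
    · have h3 := ih (2 ^ i + d - 1) (by omega)
      rw [Nat.sub_add_cancel (by omega), code_add_two_pow hd2] at h3
      have e2 : code 0 (2 ^ i + d - 1) = code 0 (d - 1) + 4 * 2 ^ (2 * i) := by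
        rw [← code_add_two_pow (by omega)]; congr 1; omega
      have h4 := mul_mem_wtFil_of 1 2 (3 + 2 * b) m4 h3 (by omega) (by omega)
      have h5 : (X ^ 2 ^ (2 * i)) ^ 8 * X ^ code 0 (d - 1) ∈ wtFil 1 2 (3 + 2 * b) :=
        mul_mem_wtFil_of _ _ _ m8 (X_pow_code_mem 0 (d - 1)) (by omega) (by omega)
      rw [e2, X_pow_add_mul (code 0 (d - 1)), mul_add] at h4
      have := add_mem h4 h5
      convert this using 1
      linear_combination -(X ^ 2 ^ (2 * i)) ^ 8 * X ^ code 0 (d - 1) * two_eq_zero_polynomial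
    · obtain ⟨d, rfl⟩ := Nat.exists_eq_add_of_le hd2
      have e2 : code 0 (2 ^ i + d) + 4 * 2 ^ (2 * i) = code 0 d + 2 * 2 ^ (2 * (i + 1)) := by
        rw [code_add_two_pow (by omega)]; ring
      have h3 := T5_defect_mem (i + 1) (code 0 d)
      have h4 := T5_X_pow_mem_wtFil (code 0 d)
      have e3 : (X ^ 2 ^ (2 * (i + 1)) : (ZMod 2)[X]) = (X ^ 2 ^ (2 * i)) ^ 4 := by
        rw [← pow_mul]; ring_nf
      rw [wt_code] at h4
      rw [wt_code, ← e2, e3, ← pow_mul] at h3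
      have h5 : (X ^ 2 ^ (2 * i)) ^ (4 * 2) * T5 (X ^ code 0 d) ∈
          wtFil 1 2 (4 * 2 ^ i + (1 + 2 * d)) :=
        mul_mem_wtFil_of _ _ _ m8 h4 (by omega) (by omega)
      have h6 : _ ∈ wtFil 1 2 (4 * 2 ^ i + (1 + 2 * d)) :=
        wtFil_mono (by omega) (by omega) h3
      have h7 := add_mem h6 h5
      rw [add_assoc, CharTwo.add_self_eq_zero, add_zero] at h7
      exact mul_mem_wtFil_of _ _ _ m4 h7 (by omega) (by omega)

lemma T5_X_pow_code_succ (a b : ℕ) :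
    T5 (X ^ code a (b + 1)) + X ^ code a b ∈ wtFil (a + 1) 2 (3 + 2 * a + 2 * b) := by
  have h1 := T5_defect_spread_mem a (code 0 (b + 1))
  have h2 := T5_X_pow_code_zero_succ b
  have m := X_pow_mem_wtFil_self (2 * spread a)
  rw [wt_two_mul_spread, hi_two_mul_spread] at m
  have h3 := mul_mem_wtFil_of (a + 1) 2 (3 + 2 * a + 2 * b) m h2 (by omega) (by omega)
  rw [mul_add, ← pow_add, add_comm _ (code 0 b), ← code_eq_code_zero_add] at h3
  rw [← code_eq_code_zero_add, wt_code] at h1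
  have h1' : _ ∈ wtFil (a + 1) 2 (3 + 2 * a + 2 * b) := wtFil_mono (by omega) (by omega) h1
  exact add_mem_of_add_mem h1' h3

lemma T5_X_pow_code_zero_right (a : ℕ) : T5 (X ^ code a 0) ∈ wtFil 0 3 (1 + 2 * a) := by
  have h1 := T5_defect_spread_mem a (code 0 0)
  rwa [← code_eq_code_zero_add, wt_code, code_zero_zero, pow_one, T5_X, mul_zero, mul_zero,
    add_zero, add_zero, add_zero] at h1

/-- Again the top digit is stripped, now with step `2 * 4 ^ i`. With `x = X ^ 4 ^ i`, the `x⁸` term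
carries the leading monomial, except when `a + 1` is a power of 2 and the `x²` term does. -/
lemma T3_X_pow_code_succ (a : ℕ) :
    T3 (X ^ code (a + 1) 0) + X ^ code a 0 ∈ wtFil 0 3 (3 + 2 * a) := by
  induction a using Nat.strong_induction_on with
  | _ a ih =>
    obtain ⟨i, d, hd, had⟩ := exists_two_pow_add (by omega : a + 1 ≠ 0)
    rcases i with _ | i
    · obtain ⟨rfl, rfl⟩ : d = 0 ∧ a = 0 := by simp at hd; simp [hd] at had; omega
      have e : code 1 0 = 3 := by simp [code]
      rw [zero_add, e, T3_X_pow_three, code_zero_zero, pow_one, CharTwo.add_self_eq_zero]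
      exact zero_mem _
    have hv : 0 < 2 ^ i := by positivity
    have hv' : 2 ^ (i + 1) = 2 ^ i + 2 ^ i := by ring
    have ep : 2 ^ (2 * i + 1) = 2 * 2 ^ (2 * i) := by ring
    have ek : code (a + 1) 0 = code d 0 + 4 * 2 ^ (2 * i + 1) := by
      rw [had, code_two_pow_add hd]; ring
    have hrec := T3_recurrence_two_pow (2 * i + 1) (code d 0)
    have e8 : ((X ^ (2 * 2 ^ (2 * i))) ^ 4 : (ZMod 2)[X]) = (X ^ 2 ^ (2 * i)) ^ 8 := by
      rw [X_pow_two_mul, ← pow_mul (X ^ 2 ^ (2 * i))]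
    rw [← ek, ep, one_mul, e8, X_pow_two_mul] at hrec
    rw [hrec]
    have m2 := X_two_pow_pow_mem i 2
    have m8 := X_two_pow_pow_mem i 8
    rw [wt_two] at m2
    rw [wt_eight] at m8
    rcases Nat.eq_zero_or_pos d with rfl | hd1
    · rw [code_zero_zero, pow_one, T3_X, mul_zero, add_zero]
      have h1 := ih (2 ^ i - 1) (by omega)
      have e1 : code (2 ^ i - 1 + 1) 0 = 1 + 2 * 2 ^ (2 * i) := by
        rw [Nat.sub_add_cancel hv, ← add_zero (2 ^ i), code_two_pow_add hv, code_zero_zero]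
      have e2 : code a 0 = code (2 ^ i - 1) 0 + 2 * 2 ^ (2 * i) := by
        rw [← code_two_pow_add (by omega)]; congr 1; omega
      rw [e1] at h1
      rw [e2, X_pow_add_mul (code (2 ^ i - 1) 0), ← mul_add]
      exact mul_mem_wtFil_of _ _ _ m2 h1 (by omega) (by omega)
    have h1 := ih (d - 1) (by omega)
    rw [Nat.sub_add_cancel hd1] at h1
    have e1 : code a 0 = code (d - 1) 0 + 8 * 2 ^ (2 * i) := by
      rw [show a = 2 ^ (i + 1) + (d - 1) by omega, code_two_pow_add (by omega)]; ring
    have h2 : (X ^ 2 ^ (2 * i)) ^ 8 * T3 (X ^ code d 0) + X ^ code a 0 ∈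
        wtFil 0 3 (3 + 2 * a) := by
      rw [e1, X_pow_add_mul, ← mul_add]
      exact mul_mem_wtFil_of _ _ _ m8 h1 (by omega) (by omega)
    rw [add_assoc]
    refine add_mem ?_ h2
    -- In both cases the `x²` term loses weight through a carry: either `x² * x² = x⁴` has weight
    -- multiplier 2 instead of 4, or the shifted exponent itself carries.
    rcases Nat.lt_or_ge d (2 ^ i) with hd2 | hd2
    · have h3 := ih (2 ^ i + d - 1) (by omega)
      rw [Nat.sub_add_cancel (by omega), code_two_pow_add hd2] at h3
      have e2 : code (2 ^ i + d - 1) 0 = code (d - 1) 0 + 2 * 2 ^ (2 * i) := by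
        rw [← code_two_pow_add (by omega)]; congr 1; omega
      have h4 := mul_mem_wtFil_of 0 3 (3 + 2 * a) m2 h3 (by omega) (by omega)
      have m4 := X_two_pow_pow_mem i 4
      rw [wt_four] at m4
      have h5 : (X ^ 2 ^ (2 * i)) ^ 4 * X ^ code (d - 1) 0 ∈ wtFil 0 3 (3 + 2 * a) :=
        mul_mem_wtFil_of _ _ _ m4 (X_pow_code_mem (d - 1) 0) (by omega) (by omega)
      rw [e2, X_pow_add_mul (code (d - 1) 0), mul_add] at h4
      have := add_mem h4 h5
      convert this using 1
      linear_combination -(X ^ 2 ^ (2 * i)) ^ 4 * X ^ code (d - 1) 0 * two_eq_zero_polynomial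
    · obtain ⟨d, rfl⟩ := Nat.exists_eq_add_of_le hd2
      have h4 := T3_X_pow_mem_wtFil (code (2 ^ i + d) 0 + 2 * 2 ^ (2 * i))
      have e2 : code (2 ^ i + d) 0 + 2 * 2 ^ (2 * i) = code d 0 + 4 * 2 ^ (2 * i) := by
        rw [code_two_pow_add (by omega)]; ring
      have b4 := wt_add_mul_two_pow_le (code d 0) i 4
      rw [← e2, wt_four, wt_code] at b4
      exact mul_mem_wtFil_of _ _ _ m2 h4 (by omega) (by omega)

end
end HeckeModTwo

/-! ### Surjectivity of `T₅`, and `T₃` on its kernel -/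

namespace HeckeModTwo
section
open Polynomial

/-- The polynomials with only odd exponents. -/
def oddPoly : Submodule (ZMod 2) (ZMod 2)[X] where
  carrier := {f | ∀ l ∈ f.support, l % 2 = 1}
  add_mem' {f g} hf hg l hl := by
    rcases Finset.mem_union.mp (support_add hl) with h | h
    · exact hf l h
    · exact hg l h
  zero_mem' := by simp
  smul_mem' c f hf l hl := hf l (support_smul c f hl)

lemma mem_support_X_pow_iff {k l : ℕ} : l ∈ (X ^ k : (ZMod 2)[X]).support ↔ l = k := by
  rw [mem_support_iff, coeff_X_pow]
  split_ifs with h <;> simp [h]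

lemma X_pow_mem_oddPoly {k : ℕ} (hk : k % 2 = 1) : (X ^ k : (ZMod 2)[X]) ∈ oddPoly := by
  intro l hl
  rwa [mem_support_X_pow_iff.mp hl]

lemma OddPrime.natCast_zmod_two {p : ℕ} (hp : OddPrime p) : (p : ZMod 2) = 1 :=
  zmod_two_natCast_odd (hp.1.odd_of_ne_two hp.2).not_two_dvd_nat

lemma heckePoly_X_pow_mem_oddPoly {p : ℕ} (hp : OddPrime p) {k : ℕ} (hk : k % 2 = 1) :
    heckePoly hp (X ^ k) ∈ oddPoly := by
  intro i hi
  have h := congrArg (ZMod.castHom (show 2 ∣ 8 by norm_num) (ZMod 2))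
    (mem_support_heckePoly_X_pow hp hi).1
  rw [map_mul, map_natCast, map_natCast, map_natCast, hp.natCast_zmod_two, one_mul,
    ZMod.natCast_eq_natCast_iff'] at h
  omega

lemma heckePoly_mem_oddPoly {p : ℕ} (hp : OddPrime p) {f : (ZMod 2)[X]} (hf : f ∈ oddPoly) :
    heckePoly hp f ∈ oddPoly :=
  map_mem_of_support _ f fun l hl => heckePoly_X_pow_mem_oddPoly hp (hf l hl)

lemma mem_of_support {V : Submodule (ZMod 2) (ZMod 2)[X]} (f : (ZMod 2)[X])
    (h : ∀ l ∈ f.support, X ^ l ∈ V) : f ∈ V :=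
  map_mem_of_support LinearMap.id f h

lemma T5_mem_wtFil {c n : ℕ} {f : (ZMod 2)[X]} (hf : f ∈ wtFil 0 c n) :
    T5 f ∈ wtFil 0 (c + 2) n :=
  map_mem_of_support _ f fun l hl => by
    have := (hf l hl).1
    exact wtFil_mono (by omega) (by omega) (T5_X_pow_mem_wtFil l)

lemma T3_mem_wtFil {c n : ℕ} {f : (ZMod 2)[X]} (hf : f ∈ wtFil 0 c n) :
    T3 f ∈ wtFil 0 (c + 2) n :=
  map_mem_of_support _ f fun l hl => by
    have := (hf l hl).1
    exact wtFil_mono (by omega) (by omega) (T3_X_pow_mem_wtFil l)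

/-- The error in `T₅(X ^ code a (b + 1)) = X ^ code a b + …` has smaller weight, or equal weight and
smaller `b`, so a double induction on `a + b` and `b` solves for `X ^ code a b`. The weight bound on
the preimage is kept for constructing kernel elements. -/
lemma exists_T5_eq_X_pow_code (a b : ℕ) :
    (X ^ code a b : (ZMod 2)[X]) ∈ (oddPoly ⊓ wtFil 0 0 (3 + 2 * a + 2 * b)).map T5 := by
  induction hn : a + b using Nat.strong_induction_on generalizing a b with
  | _ n ihn =>
    induction b using Nat.strong_induction_on generalizing a with
    | _ b ihb =>
      have hw := wt_code a (b + 1)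
      have h1 : T5 (X ^ code a (b + 1)) ∈ (oddPoly ⊓ wtFil 0 0 (3 + 2 * a + 2 * b)).map T5 :=
        ⟨_, ⟨X_pow_mem_oddPoly (code_mod_two _ _), X_pow_mem_wtFil (by omega)⟩, rfl⟩
      have h2 : T5 (X ^ code a (b + 1)) + X ^ code a b ∈
          (oddPoly ⊓ wtFil 0 0 (3 + 2 * a + 2 * b)).map T5 := by
        refine mem_of_support _ fun l hl => ?_
        have h3 := T5_X_pow_code_succ a b l hl
        have h4 : T5 (X ^ code a (b + 1)) + X ^ code a b ∈ oddPoly :=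
          add_mem (heckePoly_X_pow_mem_oddPoly _ (code_mod_two _ _))
            (X_pow_mem_oddPoly (code_mod_two _ _))
        obtain ⟨a', b', rfl⟩ := exists_code (h4 l hl)
        rw [wt_code, hi_code] at h3
        refine Submodule.map_mono (inf_le_inf_left _ (wtFil_mono (s := 0) (c := 0)
          (n := 3 + 2 * a' + 2 * b') (by omega) (by omega))) ?_
        rcases Nat.lt_or_ge (a' + b') n with h | h
        · exact ihn _ h a' b' rfl
        · exact ihb b' (by omega) a' (by omega)
      have := add_mem h1 h2
      rwa [← add_assoc, CharTwo.add_self_eq_zero, zero_add] at this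

lemma exists_T5_eq {c n : ℕ} {f : (ZMod 2)[X]} (hf : f ∈ oddPoly) (hc : f ∈ wtFil 0 c n) :
    ∃ g ∈ oddPoly, g ∈ wtFil 0 c (n + 2) ∧ T5 g = f := by
  have h : f ∈ (oddPoly ⊓ wtFil 0 c (n + 2)).map T5 := by
    refine mem_of_support _ fun l hl => ?_
    have h1 := (hc l hl).1
    obtain ⟨a, b, rfl⟩ := exists_code (hf l hl)
    rw [wt_code] at h1
    exact Submodule.map_mono (inf_le_inf_left _ (wtFil_mono (by omega) (by omega)))
      (exists_T5_eq_X_pow_code a b)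
  obtain ⟨g, ⟨h1, h2⟩, h3⟩ := h
  exact ⟨g, h1, h2, h3⟩

/-- The kernel of `T₅` contains an element with any leading term `X ^ code a 0`. -/
lemma exists_T5_ker (a : ℕ) :
    ∃ κ ∈ oddPoly, T5 κ = 0 ∧ κ + X ^ code a 0 ∈ wtFil 0 1 (1 + 2 * a) := by
  obtain ⟨g, h1, h2, h3⟩ := exists_T5_eq (heckePoly_X_pow_mem_oddPoly oddPrime_five
    (code_mod_two a 0)) (T5_X_pow_code_zero_right a)
  refine ⟨X ^ code a 0 + g, add_mem (X_pow_mem_oddPoly (code_mod_two a 0)) h1, ?_, ?_⟩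
  · rw [map_add, h3, CharTwo.add_self_eq_zero]
  · rw [add_right_comm, CharTwo.add_self_eq_zero, zero_add]
    exact wtFil_mono (by omega) (by omega) h2

lemma add_X_pow_mem_support {f : (ZMod 2)[X]} {k l : ℕ} (hk : k ∈ f.support)
    (hl : l ∈ (f + X ^ k).support) : l ∈ f.support ∧ l ≠ k := by
  have h1 : ∀ x : ZMod 2, x ≠ 0 → x + 1 = 0 := by decide
  rw [mem_support_iff, coeff_add, coeff_X_pow] at hl
  have hne : l ≠ k := by
    rintro rfl
    rw [if_pos rfl] at hl
    exact hl (h1 _ (mem_support_iff.mp hk))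
  rw [if_neg hne, add_zero] at hl
  exact ⟨mem_support_iff.mpr hl, hne⟩

/-- If some exponent of maximal weight had `b > 0`, the one with least `a` would produce under `T₅`
a monomial that nothing else can cancel. So the top-weight part is a single `X ^ code a 0`. -/
lemma exists_leading_of_T5_eq_zero {f : (ZMod 2)[X]} (hf : f ∈ oddPoly) (hf0 : T5 f = 0)
    (hne : f ≠ 0) : ∃ a, code a 0 ∈ f.support ∧ f + X ^ code a 0 ∈ wtFil 0 1 (1 + 2 * a) := by
  obtain ⟨k, hk, hmax⟩ := Finset.exists_max_image f.support wt (support_nonempty.mpr hne)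
  obtain ⟨a₀, b₀, rfl⟩ := exists_code (hf k hk)
  rw [wt_code] at hmax
  by_cases hB : ∃ l ∈ f.support, wt l = 1 + 2 * a₀ + 2 * b₀ ∧ hi l < a₀ + b₀
  · exfalso
    classical
    obtain ⟨l, hl, hmin⟩ := Finset.exists_min_image
      (f.support.filter fun l => wt l = 1 + 2 * a₀ + 2 * b₀ ∧ hi l < a₀ + b₀) hi
      (by obtain ⟨l, h1, h2⟩ := hB; exact ⟨l, Finset.mem_filter.mpr ⟨h1, h2⟩⟩)
    obtain ⟨hl, hl1, hl2⟩ := Finset.mem_filter.mp hl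
    obtain ⟨a, b, rfl⟩ := exists_code (hf l hl)
    rw [wt_code] at hl1
    rw [hi_code] at hl2 hmin
    obtain ⟨b, rfl⟩ : ∃ b', b = b' + 1 := ⟨b - 1, by omega⟩
    have h1 : T5 (f + X ^ code a (b + 1)) ∈ wtFil (a + 1) 2 (3 + 2 * a + 2 * b) := by
      refine map_mem_of_support _ _ fun m hm => ?_
      obtain ⟨hm, hne⟩ := add_X_pow_mem_support hl hm
      have hmw := hmax m hm
      rcases Nat.lt_or_ge (wt m) (3 + 2 * a + 2 * b) with h | h
      · exact wtFil_mono (by omega) (by omega) (T5_X_pow_mem_wtFil m)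
      obtain ⟨a', b', rfl⟩ := exists_code (hf m hm)
      rw [wt_code] at hmw h
      rcases b' with _ | b'
      · exact wtFil_mono (by omega) (by omega) (T5_X_pow_code_zero_right a')
      have h2 := hmin (code a' (b' + 1)) (Finset.mem_filter.mpr ⟨hm, by
        rw [wt_code, hi_code]; omega⟩)
      rw [hi_code] at h2
      have h3 : a' ≠ a := by
        rintro rfl
        exact hne (by congr 1; omega)
      have h4 : _ ∈ wtFil (a + 1) 2 (3 + 2 * a + 2 * b) :=
        wtFil_mono (by omega) (by omega) (T5_X_pow_code_succ a' b')
      have h5 : (X ^ code a' b' : (ZMod 2)[X]) ∈ wtFil (a + 1) 2 (3 + 2 * a + 2 * b) :=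
        wtFil_mono (by omega) (by omega) (X_pow_code_mem a' b')
      have := add_mem h4 h5
      rwa [add_assoc (T5 _), CharTwo.add_self_eq_zero, add_zero] at this
    rw [map_add, hf0, zero_add] at h1
    have h2 := add_mem h1 (T5_X_pow_code_succ a b)
    rw [← add_assoc, CharTwo.add_self_eq_zero, zero_add] at h2
    have h3 := h2 (code a b) (mem_support_X_pow_iff.mpr rfl)
    rw [wt_code, hi_code] at h3
    omega
  · push Not at hB
    have h0 := hB _ hk (wt_code _ _)
    rw [hi_code] at h0
    obtain rfl : b₀ = 0 := by omega
    refine ⟨a₀, hk, fun l hl => ?_⟩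
    obtain ⟨hl, hne⟩ := add_X_pow_mem_support hk hl
    refine ⟨?_, fun _ => Nat.zero_le _⟩
    by_contra h
    have h1 := hmax l hl
    have h2 := hB l hl (by omega)
    obtain ⟨a, b, rfl⟩ := exists_code (hf l hl)
    rw [wt_code] at h1 h
    rw [hi_code] at h2
    exact hne (by congr 1 <;> omega)

lemma eq_zero_of_mem_wtFil {s c n : ℕ} (h : n < c) {f : (ZMod 2)[X]} (hf : f ∈ wtFil s c n) :
    f = 0 := by
  rw [← support_eq_empty, Finset.eq_empty_iff_forall_notMem]
  intro l hl
  have := (hf l hl).1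
  omega

lemma exists_wtFil (f : (ZMod 2)[X]) : ∃ n, f ∈ wtFil 0 0 n :=
  ⟨f.support.sup wt, fun _ hl => ⟨Finset.le_sup hl, fun _ => Nat.zero_le _⟩⟩

/-- `T₃` sends a kernel element with leading code `(a + 1, 0)` to one with leading code `(a, 0)`.
Subtracting this image lowers the weight of `f` while staying in the kernel, by commutation. -/
lemma exists_T3_eq_of_T5_eq_zero (hcomm : ∀ f, T5 (T3 f) = T3 (T5 f)) {f : (ZMod 2)[X]} (hf : f ∈ oddPoly)
    (hf0 : T5 f = 0) : ∃ g ∈ oddPoly, T5 g = 0 ∧ T3 g = f := by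
  obtain ⟨n, hn⟩ := exists_wtFil f
  induction n using Nat.strong_induction_on generalizing f with
  | _ n ih =>
    rcases eq_or_ne f 0 with rfl | hne
    · exact ⟨0, zero_mem _, map_zero _, map_zero _⟩
    obtain ⟨a, ha, hfa⟩ := exists_leading_of_T5_eq_zero hf hf0 hne
    obtain ⟨κ, h1, h2, h3⟩ := exists_T5_ker (a + 1)
    have h4 := T3_mem_wtFil h3
    rw [map_add] at h4
    rw [show 1 + 2 * (a + 1) = 3 + 2 * a by ring] at h4
    have h5 := add_mem_of_add_mem h4 (T3_X_pow_code_succ a)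
    rw [add_comm (T3 κ)] at h5
    have h5' : f + X ^ code a 0 ∈ wtFil 0 3 (3 + 2 * a) := wtFil_mono (by omega) (by omega) hfa
    have h5'' := add_mem_of_add_mem h5' h5
    have han := (hn _ ha).1
    rw [wt_code] at han
    have h6 : T3 κ ∈ oddPoly := heckePoly_mem_oddPoly oddPrime_three h1
    have h7 : T5 (f + T3 κ) = 0 := by rw [map_add, hf0, hcomm, h2, map_zero, add_zero]
    have h8 : f + T3 κ ∈ wtFil 0 0 (2 * a) := wtFil_mono (by omega) (by omega) h5''
    obtain ⟨g, h9, h10, h11⟩ := ih (2 * a) (by omega) (add_mem hf h6) h7 h8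
    refine ⟨g + κ, add_mem h9 h1, by rw [map_add, h10, h2, add_zero], ?_⟩
    rw [map_add, h11, add_assoc, CharTwo.add_self_eq_zero, add_zero]

/-- A leading code `(a + 1, 0)` would leave the nonzero leading code `(a, 0)` in `T₃ f`, so the
leading monomial is `X`, and nothing odd has smaller weight. -/
lemma eq_zero_or_eq_X_of_T3_T5_eq_zero {f : (ZMod 2)[X]} (hf : f ∈ oddPoly) (hf5 : T5 f = 0)
    (hf3 : T3 f = 0) : f = 0 ∨ f = X := by
  rcases eq_or_ne f 0 with rfl | hne
  · exact Or.inl rfl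
  obtain ⟨a, ha, hfa⟩ := exists_leading_of_T5_eq_zero hf hf5 hne
  rcases a with _ | a
  · right
    have h1 : f + X ^ code 0 0 = 0 := by
      rw [← support_eq_empty, Finset.eq_empty_iff_forall_notMem]
      intro l hl
      have h2 := (hfa l hl).1
      have h3 := add_mem hf (X_pow_mem_oddPoly (code_mod_two 0 0)) l hl
      have := wt_mod_two l
      omega
    rw [code_zero_zero, pow_one] at h1
    exact CharTwo.add_eq_zero.mp h1
  · exfalso
    have h1 := T3_mem_wtFil hfa
    rw [map_add, hf3, zero_add] at h1
    have h2 := T3_X_pow_code_succ a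
    rw [show 1 + 2 * (a + 1) = 3 + 2 * a by ring] at h1
    have h3 := add_mem h1 h2
    rw [← add_assoc, CharTwo.add_self_eq_zero, zero_add] at h3
    have h4 := (h3 (code a 0) (mem_support_X_pow_iff.mpr rfl)).1
    rw [wt_code] at h4
    omega

end
end HeckeModTwo

/-! ### Endomorphisms commuting with two locally nilpotent operators -/

namespace HeckeModTwo
section

/-- Let `S` be surjective and locally nilpotent. If an endomorphism commuting with `S` and the
operators in `C` is surjective on `ker S` as soon as it is nonzero there, then it is surjective as
soon as it is nonzero. -/
lemma surjective_of_surjective_on_ker {R V : Type*} [Ring R] [AddCommGroup V] [Module R V]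
    (S : Module.End R V) (C : Set (Module.End R V)) (hSC : ∀ c ∈ C, Commute S c)
    (hS : Function.Surjective S) (hnil : ∀ v, ∃ n : ℕ, (S ^ n) v = 0)
    (hK : ∀ w : Module.End R V, Commute w S → (∀ c ∈ C, Commute w c) →
      (∃ x, S x = 0 ∧ w x ≠ 0) → ∀ x, S x = 0 → ∃ y, S y = 0 ∧ w y = x)
    (u : Module.End R V) (huS : Commute u S) (huC : ∀ c ∈ C, Commute u c) (hu : u ≠ 0) :
    Function.Surjective u := by
  obtain ⟨v, hv⟩ : ∃ v, u v ≠ 0 := by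
    by_contra! h
    exact hu (LinearMap.ext h)
  obtain ⟨n, hn⟩ := hnil v
  clear hu
  induction n generalizing u v with
  | zero => exact absurd (by rw [show v = 0 from hn, map_zero]) hv
  | succ n ih =>
    have hc : ∀ x, u (S x) = S (u x) := fun x => LinearMap.congr_fun huS x
    by_cases h0 : ∃ x, S x = 0 ∧ u x ≠ 0
    · intro x
      obtain ⟨m, hm⟩ := hnil x
      induction m generalizing x with
      | zero => exact ⟨0, by rw [map_zero]; exact hm.symm⟩
      | succ m ihm =>
        -- A preimage of `S x` lifts through `S` to `z`; then `x - u z` lies in `ker S`, where `u`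
        -- is already surjective.
        obtain ⟨y, hy⟩ := ihm (S x) hm
        obtain ⟨z, rfl⟩ := hS y
        obtain ⟨w, -, hw⟩ := hK u huS huC h0 (x - u z) (by rw [map_sub, ← hc, hy, sub_self])
        exact ⟨z + w, by rw [map_add, hw, add_sub_cancel]⟩
    · push Not at h0
      -- Here `u` kills `ker S`, hence factors as `u' ∘ S`. Now `u' (S v) ≠ 0`, and `S v` is killed
      -- by a smaller power of `S`, so the factoring terminates.
      obtain ⟨g, hg⟩ := hS.hasRightInverse
      have hg' : ∀ x, u (g (S x)) = u x := fun x => by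
        have h : S (g (S x) - x) = 0 := by rw [map_sub, hg, sub_self]
        have := h0 _ h
        rwa [map_sub, sub_eq_zero] at this
      let u' : Module.End R V :=
        { toFun := fun x => u (g x)
          map_add' := fun x y => by
            obtain ⟨x, rfl⟩ := hS x
            obtain ⟨y, rfl⟩ := hS y
            rw [← map_add, hg', hg', hg', map_add]
          map_smul' := fun c x => by
            obtain ⟨x, rfl⟩ := hS x
            rw [← map_smul, hg', hg', map_smul, RingHom.id_apply] }
      have hu' : ∀ x, u' (S x) = u x := hg'
      have h1 : Commute u' S := LinearMap.ext fun x => by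
        obtain ⟨x, rfl⟩ := hS x
        change u' (S (S x)) = S (u' (S x))
        rw [hu', hu', hc]
      have h2 : ∀ c ∈ C, Commute u' c := fun c hcC => LinearMap.ext fun x => by
        obtain ⟨x, rfl⟩ := hS x
        change u' (c (S x)) = c (u' (S x))
        rw [← show S (c x) = c (S x) from LinearMap.congr_fun (hSC c hcC) x, hu', hu']
        exact LinearMap.congr_fun (huC c hcC) x
      intro y
      obtain ⟨x, hx⟩ := ih u' h1 h2 (S v) (by rwa [hu']) hn y
      obtain ⟨z, rfl⟩ := hS x
      exact ⟨z, by rw [← hx, hu']⟩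

/-- Endomorphisms commuting with two commuting locally nilpotent operators with a common kernel
consisting of two elements are surjective unless zero, provided that `S` is surjective and that
`T` is surjective on `ker S`. -/
lemma surjective_of_commute {R V : Type*} [Ring R] [AddCommGroup V] [Module R V]
    (S T : Module.End R V) (hST : Commute S T) (hS : Function.Surjective S)
    (hnS : ∀ v, ∃ n : ℕ, (S ^ n) v = 0) (hnT : ∀ v, ∃ n : ℕ, (T ^ n) v = 0)
    (hT : ∀ x, S x = 0 → ∃ y, S y = 0 ∧ T y = x) (e : V)
    (he : ∀ x, S x = 0 → T x = 0 → x = 0 ∨ x = e)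
    (u : Module.End R V) (huS : Commute u S) (huT : Commute u T) (hu : u ≠ 0) :
    Function.Surjective u := by
  have hker : ∀ w : Module.End R V, Commute w S → ∀ x ∈ LinearMap.ker S, w x ∈ LinearMap.ker S :=
    fun w hw x hx => by
      have h : w (S x) = S (w x) := LinearMap.congr_fun hw x
      rw [LinearMap.mem_ker] at hx ⊢
      rw [← h, hx, map_zero]
  refine surjective_of_surjective_on_ker S {T} (by simpa using hST) hS hnS ?_ u huS
    (by simpa using huT) hu
  intro w hwS hwT hne
  have hwT' : Commute w T := hwT T rfl
  obtain ⟨x₀, hx₀, hx₀'⟩ := hne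
  have key : Function.Surjective (w.restrict (hker w hwS)) := by
    -- The same criterion is applied inside `ker S` with `T` in the role of `S`. The kernel there
    -- has at most one nonzero element, so a map that is nonzero on it must send that element to
    -- itself.
    refine surjective_of_surjective_on_ker (T.restrict (hker T hST.symm)) ∅ (by simp) ?_ ?_ ?_
      (w.restrict (hker w hwS)) ?_ (by simp) ?_
    · rintro ⟨x, hx⟩
      obtain ⟨y, hy, hyx⟩ := hT x hx
      exact ⟨⟨y, hy⟩, Subtype.ext hyx⟩
    · rintro ⟨x, hx⟩
      obtain ⟨n, hn⟩ := hnT x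
      refine ⟨n, Subtype.ext ?_⟩
      rw [Module.End.pow_restrict]
      exact hn
    · rintro v hv - ⟨x, hx, hvx⟩ y hy
      have h1 : ∀ z : LinearMap.ker S, T.restrict (hker T hST.symm) z = 0 →
          z = 0 ∨ (z : V) = e := fun z hz => by
        rcases he z z.2 (congrArg Subtype.val hz) with h | h
        · exact Or.inl (Subtype.ext h)
        · exact Or.inr h
      rcases h1 y hy with h | h
      · exact ⟨0, map_zero _, by rw [map_zero, h]⟩
      · refine ⟨x, hx, Subtype.ext ?_⟩
        have h2 : T.restrict (hker T hST.symm) (v x) = 0 := by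
          have h3 := LinearMap.congr_fun hv x
          rw [Module.End.mul_apply, Module.End.mul_apply, hx, map_zero] at h3
          exact h3.symm
        rw [h, (h1 _ h2).resolve_left hvx]
    · exact LinearMap.ext fun x => Subtype.ext (LinearMap.congr_fun hwT' x)
    · intro h
      exact hx₀' (congrArg Subtype.val (LinearMap.congr_fun h ⟨x₀, hx₀⟩))
  intro x hx
  obtain ⟨⟨y, hy⟩, h⟩ := key ⟨x, hx⟩
  exact ⟨y, hy, congrArg Subtype.val h⟩

end
end HeckeModTwo

/-! ### Return to `ℱ` and the action of `A` -/

namespace HeckeModTwo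
section
open Polynomial

lemma heckeT_comm {p l : ℕ} (hp : p.Prime) (hl : l.Prime) (f : PowerSeries (ZMod 2)) :
    heckeT p (heckeT l f) = heckeT l (heckeT p f) := by
  rcases eq_or_ne p l with rfl | hne
  · rfl
  have hpl : Nat.Coprime p l := (Nat.coprime_primes hp hl).mpr hne
  ext n
  have h1 : l ∣ p * n ↔ l ∣ n := hpl.symm.dvd_mul_left
  have h2 : p ∣ l * n ↔ p ∣ n := hpl.dvd_mul_left
  simp only [coeff_heckeT, h1, h2]
  by_cases hpn : p ∣ n
  · obtain ⟨m, rfl⟩ := hpn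
    have h3 : l ∣ p * m ↔ l ∣ m := hpl.symm.dvd_mul_left
    by_cases hlm : l ∣ m
    · obtain ⟨k, rfl⟩ := hlm
      have e1 : p * (p * (l * k)) / l = p * (p * k) := by
        rw [show p * (p * (l * k)) = l * (p * (p * k)) by ring, Nat.mul_div_cancel_left _ hl.pos]
      have e2 : p * (l * k) / p = l * k := Nat.mul_div_cancel_left _ hp.pos
      have e3 : p * (l * k) / l = p * k := by
        rw [mul_left_comm, Nat.mul_div_cancel_left _ hl.pos]
      have e4 : l * (p * (l * k)) / p = l * (l * k) := by
        rw [mul_left_comm, Nat.mul_div_cancel_left _ hp.pos]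
      have d1 : p ∣ p * k := dvd_mul_right _ _
      have d2 : l ∣ l * k := dvd_mul_right _ _
      have d3 : l ∣ p * (l * k) := h3.mpr d2
      have d4 : p ∣ p * (l * k) := dvd_mul_right _ _
      simp only [e1, e2, e3, e4, d1, d2, d3, d4, if_true, Nat.mul_div_cancel_left _ hl.pos,
        Nat.mul_div_cancel_left _ hp.pos]
      rw [mul_left_comm l p]
      ring
    · have d3 : ¬ l ∣ p * m := fun h => hlm (h3.mp h)
      have d4 : p ∣ p * m := dvd_mul_right _ _
      have e4 : l * (p * m) / p = l * m := by
        rw [mul_left_comm, Nat.mul_div_cancel_left _ hp.pos]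
      simp only [hlm, d3, d4, e4, if_true, if_false, Nat.mul_div_cancel_left _ hp.pos, add_zero]
      rw [mul_left_comm l p]
  · by_cases hln : l ∣ n
    · obtain ⟨m, rfl⟩ := hln
      have d : ¬ p ∣ m := fun h => hpn (dvd_mul_of_dvd_right h _)
      have d4 : l ∣ l * m := dvd_mul_right _ _
      have e4 : p * (l * m) / l = p * m := by
        rw [mul_left_comm, Nat.mul_div_cancel_left _ hl.pos]
      simp only [hpn, d, d4, e4, if_true, if_false, Nat.mul_div_cancel_left _ hl.pos, add_zero]
      rw [mul_left_comm l p]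
    · simp only [hpn, hln, if_false, add_zero]
      rw [mul_left_comm l p]

lemma Fn_eq_map (n : ℕ) :
    Fn n = (oddPoly ⊓ degreeLT (ZMod 2) (2 * n)).map evalDelta.toLinearMap := by
  apply le_antisymm
  · rw [Fn, Submodule.span_le]
    rintro _ ⟨i, hi, rfl⟩
    have hi : i < n := hi
    refine ⟨X ^ (2 * i + 1), ⟨X_pow_mem_oddPoly (by omega), ?_⟩, ?_⟩
    · rw [SetLike.mem_coe, mem_degreeLT, degree_X_pow]
      exact_mod_cast (by omega : 2 * i + 1 < 2 * n)
    · change evalDelta _ = _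
      rw [map_pow, evalDelta_X]
  · rintro _ ⟨P, ⟨h1, h2⟩, rfl⟩
    change evalDelta P ∈ _
    rw [evalDelta_eq_sum]
    refine Submodule.sum_mem _ fun l hl => Submodule.smul_mem _ _ ?_
    have h3 := h1 l hl
    have h4 : l < 2 * n := by
      have := (le_degree_of_mem_supp l hl).trans_lt (mem_degreeLT.mp h2)
      exact_mod_cast this
    refine Submodule.subset_span ⟨l / 2, ?_, ?_⟩
    · rw [Set.mem_Iio]; omega
    · change Delta ^ (2 * (l / 2) + 1) = _
      congr 1; omega

lemma mem_F_iff {f : PowerSeries (ZMod 2)} : f ∈ F ↔ ∃ P ∈ oddPoly, evalDelta P = f := by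
  constructor
  · intro hf
    obtain ⟨n, hn⟩ := exists_mem_Fn hf
    rw [Fn_eq_map] at hn
    obtain ⟨P, ⟨h1, -⟩, h2⟩ := hn
    exact ⟨P, h1, h2⟩
  · rintro ⟨P, hP, rfl⟩
    rw [evalDelta_eq_sum]
    refine Submodule.sum_mem _ fun l hl => Submodule.smul_mem _ _ ?_
    have := hP l hl
    refine Submodule.subset_span ⟨l / 2, ?_⟩
    change Delta ^ (2 * (l / 2) + 1) = _
    congr 1; omega

lemma heckeT_mem_Fn {p : ℕ} (hp : OddPrime p) (n : ℕ) {f : PowerSeries (ZMod 2)} (hf : f ∈ Fn n) :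
    heckeT p f ∈ Fn n := by
  rw [Fn_eq_map] at hf ⊢
  obtain ⟨P, ⟨h1, h2⟩, rfl⟩ := hf
  refine ⟨heckePoly hp P, ⟨heckePoly_mem_oddPoly hp h1, ?_⟩, evalDelta_heckePoly hp P⟩
  refine map_mem_of_support _ P fun l hl => ?_
  rw [mem_degreeLT]
  have h3 := (le_degree_of_mem_supp l hl).trans_lt (mem_degreeLT.mp h2)
  refine lt_of_le_of_lt ?_ h3
  exact degree_le_of_natDegree_le (natDegree_heckePoly_X_pow hp l)

lemma heckeT_mem_F {p : ℕ} (hp : OddPrime p) : ∀ f ∈ F, heckeT p f ∈ F := fun f hf => by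
  obtain ⟨n, hn⟩ := exists_mem_Fn hf
  exact Fn_le_F n (heckeT_mem_Fn hp n hn)

/-- The Hecke operator `T_p` on `ℱ`. -/
noncomputable def heckeF {p : ℕ} (hp : OddPrime p) : Module.End (ZMod 2) F :=
  (heckeT p).restrict (heckeT_mem_F hp)

lemma coe_heckeF {p : ℕ} (hp : OddPrime p) (f : F) :
    (heckeF hp f : PowerSeries (ZMod 2)) = heckeT p f := rfl

lemma heckeF_commute {p l : ℕ} (hp : OddPrime p) (hl : OddPrime l) :
    Commute (heckeF hp) (heckeF hl) :=
  LinearMap.ext fun f => Subtype.ext (heckeT_comm hp.1 hl.1 f)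

lemma heckePoly_comm {p l : ℕ} (hp : OddPrime p) (hl : OddPrime l) (f : (ZMod 2)[X]) :
    heckePoly hp (heckePoly hl f) = heckePoly hl (heckePoly hp f) :=
  evalDelta_injective (by simp only [evalDelta_heckePoly, heckeT_comm hp.1 hl.1])

/-- Each application lowers the weight bound by 2, and weights are natural numbers. -/
lemma heckeF_pow_eq_zero {p : ℕ} (hp : OddPrime p)
    (h : ∀ (c n : ℕ) (f : (ZMod 2)[X]), f ∈ wtFil 0 c n → heckePoly hp f ∈ wtFil 0 (c + 2) n)
    (f : F) : ∃ m : ℕ, (heckeF hp ^ m) f = 0 := by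
  obtain ⟨f, hf⟩ := f
  obtain ⟨P, -, rfl⟩ := mem_F_iff.mp hf
  obtain ⟨n, hn⟩ := exists_wtFil P
  have key : ∀ (m c : ℕ) (P : (ZMod 2)[X]) (hf : evalDelta P ∈ F), P ∈ wtFil 0 c n →
      ∃ Q ∈ wtFil 0 (c + 2 * m) n,
        ((heckeF hp ^ m) ⟨evalDelta P, hf⟩ : PowerSeries (ZMod 2)) = evalDelta Q := by
    intro m
    induction m with
    | zero => exact fun c P hf hP => ⟨P, hP, rfl⟩
    | succ m ih =>
      intro c P hf hP
      have h1 : evalDelta (heckePoly hp P) ∈ F := by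
        rw [evalDelta_heckePoly]
        exact heckeT_mem_F hp _ hf
      obtain ⟨Q, hQ, h2⟩ := ih (c + 2) _ h1 (h c n P hP)
      refine ⟨Q, by rwa [show c + 2 * (m + 1) = c + 2 + 2 * m by ring], ?_⟩
      have h3 : heckeF hp ⟨evalDelta P, hf⟩ = ⟨evalDelta (heckePoly hp P), h1⟩ :=
        Subtype.ext (evalDelta_heckePoly hp P).symm
      rw [pow_succ, Module.End.mul_apply, h3, h2]
  obtain ⟨Q, hQ, h1⟩ := key (n + 1) 0 P hf hn
  refine ⟨n + 1, Subtype.ext ?_⟩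
  rw [h1, eq_zero_of_mem_wtFil (by omega) hQ, map_zero]
  rfl

lemma exists_heckePoly_of_heckeF {p : ℕ} (hp : OddPrime p) {f : F} (hf : heckeF hp f = 0)
    {P : (ZMod 2)[X]} (hP : evalDelta P = f) : heckePoly hp P = 0 := by
  apply evalDelta_injective
  rw [evalDelta_heckePoly, hP, ← coe_heckeF hp, hf, map_zero]
  rfl

lemma Delta_mem_F : Delta ∈ F := mem_F_iff.mpr ⟨X, by simpa using X_pow_mem_oddPoly (k := 1) rfl,
  evalDelta_X⟩

/-- A nonzero endomorphism of `ℱ` commuting with `T₃` and `T₅` is surjective. -/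
lemma surjective_of_commute_heckeF (u : Module.End (ZMod 2) F)
    (h3 : Commute u (heckeF oddPrime_three)) (h5 : Commute u (heckeF oddPrime_five)) (hu : u ≠ 0) :
    Function.Surjective u := by
  refine surjective_of_commute (heckeF oddPrime_five) (heckeF oddPrime_three)
    (heckeF_commute _ _) ?_ ?_ ?_ ?_ ⟨Delta, Delta_mem_F⟩ ?_ u h5 h3 hu
  · rintro ⟨f, hf⟩
    obtain ⟨P, hP, rfl⟩ := mem_F_iff.mp hf
    obtain ⟨n, hn⟩ := exists_wtFil P
    obtain ⟨Q, hQ, -, h⟩ := exists_T5_eq hP hn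
    refine ⟨⟨evalDelta Q, mem_F_iff.mpr ⟨Q, hQ, rfl⟩⟩, Subtype.ext ?_⟩
    rw [coe_heckeF, ← evalDelta_heckePoly oddPrime_five, h]
  · exact heckeF_pow_eq_zero _ fun c n f hf => T5_mem_wtFil hf
  · exact heckeF_pow_eq_zero _ fun c n f hf => T3_mem_wtFil hf
  · rintro ⟨f, hf⟩ h
    obtain ⟨P, hP, rfl⟩ := mem_F_iff.mp hf
    obtain ⟨Q, hQ, h1, h2⟩ := exists_T3_eq_of_T5_eq_zero (heckePoly_comm _ _) hP
      (exists_heckePoly_of_heckeF _ h rfl)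
    refine ⟨⟨evalDelta Q, mem_F_iff.mpr ⟨Q, hQ, rfl⟩⟩, Subtype.ext ?_, Subtype.ext ?_⟩
    · rw [coe_heckeF, ← evalDelta_heckePoly oddPrime_five, h1, map_zero]
      rfl
    · rw [coe_heckeF, ← evalDelta_heckePoly oddPrime_three, h2]
  · rintro ⟨f, hf⟩ h h'
    obtain ⟨P, hP, rfl⟩ := mem_F_iff.mp hf
    rcases eq_zero_or_eq_X_of_T3_T5_eq_zero hP (exists_heckePoly_of_heckeF _ h rfl)
      (exists_heckePoly_of_heckeF _ h' rfl) with rfl | rfl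
    · exact Or.inl (Subtype.ext (map_zero _))
    · exact Or.inr (Subtype.ext evalDelta_X)

lemma heckeF_surjective {p : ℕ} (hp : OddPrime p) : Function.Surjective (heckeF hp) := by
  refine surjective_of_commute_heckeF _ (heckeF_commute _ _) (heckeF_commute _ _) fun h => ?_
  have hodd := Nat.odd_iff.mp (hp.1.odd_of_ne_two hp.2)
  have hm : Delta ^ p ∈ F := mem_F_iff.mpr ⟨X ^ p, X_pow_mem_oddPoly hodd, by simp⟩
  have h1 : heckeT p (Delta ^ p) = 0 := congrArg Subtype.val (LinearMap.congr_fun h ⟨_, hm⟩)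
  have h2 := congrArg (PowerSeries.coeff 1) h1
  rw [coeff_heckeT, mul_one, coeff_Delta_pow_self, if_neg (by simpa using hp.1.one_lt.ne'),
    add_zero, map_zero] at h2
  exact one_ne_zero h2

/-- `A(n)` is generated by Hecke operators, which commute with one another. -/
lemma comp_heckeT {n : ℕ} {x : Module.End (ZMod 2) (Fn n)} (hx : x ∈ An n) {p : ℕ}
    (hp : OddPrime p) (f : Fn n) :
    (x ⟨heckeT p f, heckeT_mem_Fn hp n f.2⟩ : PowerSeries (ZMod 2)) = heckeT p (x f) := by
  induction hx using Algebra.adjoin_induction generalizing f with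
  | mem x hx =>
    obtain ⟨l, hl, -, h⟩ := hx
    rw [h, h, heckeT_comm hl hp.1]
  | algebraMap c => simp [Module.algebraMap_end_apply]
  | add x y _ _ hx hy => simp [hx, hy]
  | mul x y _ _ hx hy =>
    have h : y ⟨heckeT p f, heckeT_mem_Fn hp n f.2⟩ =
      ⟨heckeT p (y f), heckeT_mem_Fn hp n (y f).2⟩ := Subtype.ext (hy f)
    rw [Module.End.mul_apply, Module.End.mul_apply, h, hx]

/-- The endomorphism of `ℱ` given by an element of `A`. -/
noncomputable def actEnd (u : A) : Module.End (ZMod 2) F :=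
  AddMonoidHom.toZModLinearMap 2 (DistribSMul.toAddMonoidHom F u)

lemma actEnd_apply (u : A) (f : F) : actEnd u f = u • f := rfl

lemma coe_smul_eq (u : A) (f : F) (n : ℕ) (hn : (f : PowerSeries (ZMod 2)) ∈ Fn n) :
    ((u • f : F) : PowerSeries (ZMod 2)) = u.comp n ⟨f, hn⟩ := act_eq u f n hn

lemma actEnd_commute_heckeF (u : A) {p : ℕ} (hp : OddPrime p) :
    Commute (actEnd u) (heckeF hp) := by
  refine LinearMap.ext fun f => Subtype.ext ?_
  obtain ⟨n, hn⟩ := exists_mem_Fn f.2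
  rw [Module.End.mul_apply, Module.End.mul_apply, actEnd_apply, actEnd_apply, coe_heckeF,
    coe_smul_eq u f n hn, coe_smul_eq u (heckeF hp f) n (heckeT_mem_Fn hp n hn)]
  exact comp_heckeT (u.2.1 n) hp ⟨f, hn⟩

/-- The action is faithful: the components of `u` are the restrictions of its action to the `ℱ(n)`.
-/
lemma actEnd_ne_zero {u : A} (hu : u ≠ 0) : actEnd u ≠ 0 := by
  refine fun h => hu (Subtype.ext (funext fun n => LinearMap.ext fun f => Subtype.ext ?_))
  have h1 := coe_smul_eq u ⟨f, Fn_le_F n f.2⟩ n f.2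
  rw [← actEnd_apply, h] at h1
  exact h1.symm

lemma smul_surjective {u : A} (hu : u ≠ 0) : Function.Surjective fun f : F => u • f :=
  surjective_of_commute_heckeF (actEnd u) (actEnd_commute_heckeF u _) (actEnd_commute_heckeF u _)
    (actEnd_ne_zero hu)

end
end HeckeModTwo

theorem mainTheorem5 :
    -- each `ℱ(n)` is stable under the Hecke operators
    (∀ p : ℕ, p.Prime → p ≠ 2 → ∀ (n : ℕ), ∀ f ∈ HeckeModTwo.Fn n,
      HeckeModTwo.heckeT p f ∈ HeckeModTwo.Fn n) ∧
    -- `ℱ` is a divisible `A`-module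
    (∀ u : HeckeModTwo.A, u ≠ 0 →
      Function.Surjective (fun f : HeckeModTwo.F => u • f)) ∧
    -- every `T_p` maps `ℱ` to `ℱ`, and `T_p : ℱ → ℱ` is surjective
    (∀ p : ℕ, p.Prime → p ≠ 2 →
      ∃ hp : ∀ f ∈ HeckeModTwo.F, HeckeModTwo.heckeT p f ∈ HeckeModTwo.F,
        Function.Surjective ((HeckeModTwo.heckeT p).restrict hp)) := by
  refine ⟨fun p hp hp2 n f hf => HeckeModTwo.heckeT_mem_Fn ⟨hp, hp2⟩ n hf,
    fun u hu => HeckeModTwo.smul_surjective hu,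
    fun p hp hp2 => ⟨HeckeModTwo.heckeT_mem_F ⟨hp, hp2⟩, HeckeModTwo.heckeF_surjective ⟨hp, hp2⟩⟩⟩
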